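/- **Setting.** Let $M^7$ be a (Hausdorff, second countable) smooth 7-manifold with a contact Calabi–Yau structure: a smooth 1-form $\theta$ and a smooth complex 3-form $\Upsilon$ such that $(\omega,\Upsilon)$ with $\omega=d\theta$ is an $SU(3)$-structure on $\ker\theta$ (at each point there is a coframe $e^0,\dots,e^6$ with $\theta=e^0$, $\omega=e^{12}+e^{34}+e^{56}$, $\Upsilon=(e^1+ie^2)\wedge(e^3+ie^4)\wedge(e^5+ie^6)$) and $d\Upsilon=0$. Let $\xi$ be the Reeb field ($\theta(\xi)=1$, $\xi\lrcorner d\theta=0$), assume that its orbits are compact, and let $\pi:M\to N=M/\langle\xi\rangle$ be the projection to the leaf space, with the distance $d_N$ of the transverse Calabi–Yau metric $g_{CY}$. Let $h:M\to\mathbb R_{\ge 0}$ be constant along the Reeb orbits and put $$\varphi=h\,\theta\wedge\omega+\operatorname{Re}\Upsilon .$$ Where $h>0$ this is a $G_2$-structure; norms, the Hodge star and $d^*\varphi=-{*}d{*}\varphi$ are those of the metric induced by $\varphi$, and the size of the torsion is $|T|=(|d\varphi|^2+|d^*\varphi|^2)^{1/2}$. 1. On every set $A\subset M$ at whose points $h$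 is positive and differentiable, $|d^*\varphi|$ is bounded if and only if $|d\ln h|$ is bounded. Now let $p\in M$ with $h(p)=0$, let $O=\pi^{-1}(\pi(p))$ be the Reeb orbit of $p$, and suppose that $h$ is continuous at $p$ and is positive and differentiable on $V\setminus O$ for some neighbourhood $V$ of $p$ (so $h$ vanishes at an isolated point of $N$). 2. On $U\setminus O$, for every neighbourhood $U$ of $p$, none of $|d\ln h|$, $|d^*\varphi|$, $|T|$ is bounded. In particular $\varphi$ does not have bounded torsion. 3. Let $r(x)=d_N(\pi(p),\pi(x))$ and let $k>0$ be real. (a) If $h\le b\,r^k$ near $p$ for some constant $b$, then there is $c>0$ such that every neighbourhood of $p$ contains a point $x\notin O$ with $|d^*\varphi|(x)\ge c/r(x)$. (b) Suppose that near $p$ either $h$ is smooth and $a\,r^k\le h\le b\,r^k$ for constants $a>0$, $b$, or $h=u\,r^k$ with $u$ of class $C^1$ and $u(p)>0$. Then $|d^*\varphi|=O(r^{-1})$ and $|T|=O(r^{-1})$ on a neighbourhood of $p$ minus $O$. -/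

import Mathlib

open scoped Manifold ContDiff Topology ENNReal

noncomputable section

namespace ContactG2

/-- The model space: `ℝ⁷` with its Euclidean inner product, coordinates `0, …, 6`. In Mathlib the
tangent space `TangentSpace (𝓡 7) x` of a 7-manifold is by definition a copy of this space. -/
abbrev E7 := EuclideanSpace ℝ (Fin 7)

/-! ### Exterior algebra on `ℝ⁷` -/

section Linear

variable {𝕜 : Type} [RCLike 𝕜]

/-- A covector regarded as an alternating 1-form. -/
def oneForm (a : E7 →L[ℝ] 𝕜) : E7 [⋀^Fin 1]→L[ℝ] 𝕜 :=
  ContinuousAlternatingMap.ofSubsingleton ℝ E7 𝕜 (0 : Fin 1) a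

/-- The wedge product `a ∧ β` of a covector with a `k`-form:
`(a ∧ β)(v₀, …, v_k) = ∑ i, (-1)ⁱ a(v_i) β(v₀, …, v̂_i, …, v_k)`. -/
def covWedge {k : ℕ} (a : E7 →L[ℝ] 𝕜) (β : E7 [⋀^Fin k]→L[ℝ] 𝕜) :
    E7 [⋀^Fin (k + 1)]→L[ℝ] 𝕜 :=
  ContinuousAlternatingMap.alternatizeUncurryFin (a.smulRight β)

/-- The iterated wedge product `a₀ ∧ a₁ ∧ ⋯ ∧ a_{k-1}` of covectors. -/
def wedges : {k : ℕ} → (Fin k → (E7 →L[ℝ] 𝕜)) → E7 [⋀^Fin k]→L[ℝ] 𝕜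
  | 0, _ => ContinuousAlternatingMap.constOfIsEmpty ℝ E7 (Fin 0) 1
  | _ + 1, a => covWedge (a 0) (wedges fun i => a i.succ)

end Linear

/-- The standard vectors `e_i` and covectors `eⁱ`. -/
def vec (i : Fin 7) : E7 := EuclideanSpace.single i 1

def cov (i : Fin 7) : E7 →L[ℝ] ℝ := EuclideanSpace.proj i

/-- `ω₀ = e¹² + e³⁴ + e⁵⁶`. -/
def omega0 : E7 [⋀^Fin 2]→L[ℝ] ℝ :=
  wedges ![cov 1, cov 2] + wedges ![cov 3, cov 4] + wedges ![cov 5, cov 6]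

/-- The complex covector `eⁱ + √-1 eʲ`. -/
def complexCov (i j : Fin 7) : E7 →L[ℝ] ℂ :=
  Complex.ofRealCLM.comp (cov i) + Complex.I • Complex.ofRealCLM.comp (cov j)

/-- `Υ₀ = (e¹ + √-1 e²) ∧ (e³ + √-1 e⁴) ∧ (e⁵ + √-1 e⁶)`. -/
def upsilon0 : E7 [⋀^Fin 3]→L[ℝ] ℂ :=
  wedges ![complexCov 1 2, complexCov 3 4, complexCov 5 6]

/-- The real part of a complex-valued form. -/
def reForm {k : ℕ} (β : E7 [⋀^Fin k]→L[ℝ] ℂ) : E7 [⋀^Fin k]→L[ℝ] ℝ :=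
  Complex.reCLM.compContinuousAlternatingMap β

/-- The standard `G₂` 3-form `φ₀ = e⁰ ∧ ω₀ + Re Υ₀` on `ℝ⁷`. -/
def phi0 : E7 [⋀^Fin 3]→L[ℝ] ℝ := covWedge (cov 0) omega0 + reForm upsilon0

/-- The Hodge star of `k`-forms on Euclidean `ℝ⁷` (`k + m = 7`), with orientation `e⁰ ∧ ⋯ ∧ e⁶`:
`*β = 1/(k! m!) ∑_σ sgn(σ) β(e_{σ 0}, …, e_{σ (k-1)}) e^{σ k} ∧ ⋯ ∧ e^{σ 6}`. -/
def star0 {k m : ℕ} (hkm : k + m = 7) (β : E7 [⋀^Fin k]→L[ℝ] ℝ) : E7 [⋀^Fin m]→L[ℝ] ℝ :=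
  ((k.factorial * m.factorial : ℕ) : ℝ)⁻¹ • ∑ σ : Equiv.Perm (Fin 7),
    (((Equiv.Perm.sign σ : ℤ) : ℝ) * β fun a => vec (σ (Fin.cast hkm (Fin.castAdd m a)))) •
      wedges fun c => cov (σ (Fin.cast hkm (Fin.natAdd k c)))

/-- The Euclidean norm of a `k`-form: `|β|² = ∑_{i₁ < ⋯ < i_k} β(e_{i₁}, …, e_{i_k})²`, written as
`1/k!` times the sum over all multi-indices. -/
def norm0 {k : ℕ} (β : E7 [⋀^Fin k]→L[ℝ] ℝ) : ℝ :=
  Real.sqrt ((k.factorial : ℝ)⁻¹ * ∑ i : Fin k → Fin 7, (β fun a => vec (i a)) ^ 2)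

/-- A 3-form on a 7-dimensional space is a `G₂`-form if some linear isomorphism with `ℝ⁷`
identifies it with `φ₀`. -/
def IsG2Form (φ : E7 [⋀^Fin 3]→L[ℝ] ℝ) : Prop :=
  ∃ L : E7 ≃L[ℝ] E7, φ = phi0.compContinuousLinearMap (L : E7 →L[ℝ] E7)

open Classical in
/-- An isomorphism identifying the `G₂`-form `φ` with `φ₀`. The metric, orientation and Hodge star
of `φ` are the ones transported from `ℝ⁷`; since `G₂ ⊂ SO(7)` they do not depend on the choice.
(Only meaningful for `G₂`-forms.) -/
def g2Frame (φ : E7 [⋀^Fin 3]→L[ℝ] ℝ) : E7 ≃L[ℝ] E7 :=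
  if hφ : IsG2Form φ then hφ.choose else ContinuousLinearEquiv.refl ℝ E7

/-- The norm of a tangent vector in the metric of `φ`. -/
def vecNorm (φ : E7 [⋀^Fin 3]→L[ℝ] ℝ) (v : E7) : ℝ := ‖g2Frame φ v‖

/-- The norm of a `k`-form in the metric of `φ`. -/
def formNorm (φ : E7 [⋀^Fin 3]→L[ℝ] ℝ) {k : ℕ} (β : E7 [⋀^Fin k]→L[ℝ] ℝ) : ℝ :=
  norm0 (β.compContinuousLinearMap ((g2Frame φ).symm : E7 →L[ℝ] E7))

/-- The Hodge star of the metric and orientation of `φ`. -/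
def hodgeStar (φ : E7 [⋀^Fin 3]→L[ℝ] ℝ) {k m : ℕ} (hkm : k + m = 7) (β : E7 [⋀^Fin k]→L[ℝ] ℝ) :
    E7 [⋀^Fin m]→L[ℝ] ℝ :=
  (star0 hkm (β.compContinuousLinearMap
    ((g2Frame φ).symm : E7 →L[ℝ] E7))).compContinuousLinearMap (g2Frame φ : E7 →L[ℝ] E7)

/-! ### Differential forms on a 7-manifold -/

section Forms

variable {M : Type*} [TopologicalSpace M] [ChartedSpace E7 M]
variable {F : Type*} [NormedAddCommGroup F] [NormedSpace ℝ F] {k : ℕ}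

/-- The expression of the `k`-form `α` in the chart at `x₀`: its pullback under the inverse of
the chart. A `k`-form is a map sending `x` to an alternating form on `TangentSpace (𝓡 7) x`. -/
def chartForm (α : M → E7 [⋀^Fin k]→L[ℝ] F) (x₀ : M) (y : E7) : E7 [⋀^Fin k]→L[ℝ] F :=
  (α ((extChartAt (𝓡 7) x₀).symm y)).compContinuousLinearMap
    (mfderiv 𝓘(ℝ, E7) (𝓡 7) (extChartAt (𝓡 7) x₀).symm y : E7 →L[ℝ] E7)

/-- A form is smooth if all its expressions in charts are. -/
def SmoothForm (α : M → E7 [⋀^Fin k]→L[ℝ] F) : Prop :=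
  ∀ x₀ : M, ContDiffOn ℝ ∞ (chartForm α x₀) (extChartAt (𝓡 7) x₀).target

/-- The exterior derivative, computed at `x` in the chart at `x`. -/
def extD (α : M → E7 [⋀^Fin k]→L[ℝ] F) (x : M) : E7 [⋀^Fin (k + 1)]→L[ℝ] F :=
  (extDeriv (chartForm α x) (extChartAt (𝓡 7) x x)).compContinuousLinearMap
    (mfderiv (𝓡 7) 𝓘(ℝ, E7) (extChartAt (𝓡 7) x) x : E7 →L[ℝ] E7)

/-- The 4-form `*φ` of a 3-form `φ`, the star being the one of the metric that `φ` induces. -/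
def starPhi (φ : M → E7 [⋀^Fin 3]→L[ℝ] ℝ) (x : M) : E7 [⋀^Fin 4]→L[ℝ] ℝ :=
  hodgeStar (φ x) (show 3 + 4 = 7 by norm_num) (φ x)

/-- The codifferential `d^*φ = - * d * φ`, a 2-form. -/
def codiff (φ : M → E7 [⋀^Fin 3]→L[ℝ] ℝ) (x : M) : E7 [⋀^Fin 2]→L[ℝ] ℝ :=
  - hodgeStar (φ x) (show 5 + 2 = 7 by norm_num) (extD (starPhi φ) x)

/-- The pointwise norm `|d^*φ|`. -/
def codiffNorm (φ : M → E7 [⋀^Fin 3]→L[ℝ] ℝ) (x : M) : ℝ := formNorm (φ x) (codiff φ x)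

/-- The pointwise size `(|dφ|² + |d^*φ|²)^{1/2}` of the torsion of the `G₂`-structure `φ`. -/
def torsionNorm (φ : M → E7 [⋀^Fin 3]→L[ℝ] ℝ) (x : M) : ℝ :=
  Real.sqrt (formNorm (φ x) (extD φ x) ^ 2 + codiffNorm φ x ^ 2)

/-- The pointwise norm `|d ln h|` in the metric of `φ`. -/
def dLogNorm (φ : M → E7 [⋀^Fin 3]→L[ℝ] ℝ) (h : M → ℝ) (x : M) : ℝ :=
  formNorm (φ x)
    (oneForm (mfderiv (𝓡 7) 𝓘(ℝ, ℝ) (fun y => Real.log (h y)) x : E7 →L[ℝ] ℝ))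

/-- The Riemannian distance of the metric of `φ`: the infimum of the lengths of `C¹` paths. -/
def g2EDist (φ : M → E7 [⋀^Fin 3]→L[ℝ] ℝ) (x y : M) : ℝ≥0∞ :=
  letI : ∀ z : M, ENorm (TangentSpace (𝓡 7) z) :=
    fun z => ⟨fun v => ENNReal.ofReal (vecNorm (φ z) v)⟩
  Manifold.riemannianEDist (𝓡 7) x y

end Forms

/-! ### Contact Calabi–Yau manifolds and the ansatz -/

/-- A contact Calabi–Yau structure on a 7-manifold: a 1-form `θ` and a complex 3-form `Υ`, both
smooth, such that `(ω, Υ)` with `ω = dθ` is an `SU(3)`-structure on `ker θ` at each point (in a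
suitable frame `θ`, `ω`, `Υ` are `e⁰`, `ω₀`, `Υ₀`) and `dΥ = 0`; `ξ` is its Reeb vector field. -/
structure ContactCalabiYau (M : Type*) [TopologicalSpace M] [ChartedSpace E7 M]
    [IsManifold (𝓡 7) ∞ M] where
  θ : M → (E7 →L[ℝ] ℝ)
  Υ : M → E7 [⋀^Fin 3]→L[ℝ] ℂ
  ξ : (x : M) → TangentSpace (𝓡 7) x
  smooth_θ : SmoothForm fun x => oneForm (θ x)
  smooth_Υ : SmoothForm Υ
  smooth_ξ : ContMDiff (𝓡 7) (𝓡 7).tangent ∞ (fun x => (⟨x, ξ x⟩ : TangentBundle (𝓡 7) M))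
  frame : ∀ x, ∃ L : E7 ≃L[ℝ] E7,
    θ x = (cov 0).comp (L : E7 →L[ℝ] E7) ∧
    extD (fun y => oneForm (θ y)) x = omega0.compContinuousLinearMap (L : E7 →L[ℝ] E7) ∧
    Υ x = upsilon0.compContinuousLinearMap (L : E7 →L[ℝ] E7)
  closed : ∀ x, extD Υ x = 0
  θ_ξ : ∀ x, θ x (ξ x) = 1
  dθ_ξ : ∀ x (v : E7), extD (fun y => oneForm (θ y)) x ![ξ x, v] = 0

namespace ContactCalabiYau

variable {M : Type*} [TopologicalSpace M] [ChartedSpace E7 M] [IsManifold (𝓡 7) ∞ M]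
  (S : ContactCalabiYau M)

/-- The transverse Kähler form `ω = dθ`. -/
def omega : M → E7 [⋀^Fin 2]→L[ℝ] ℝ := extD fun x => oneForm (S.θ x)

/-- The ansatz `φ = h θ ∧ ω + Re Υ`. -/
def ansatz (h : M → ℝ) (x : M) : E7 [⋀^Fin 3]→L[ℝ] ℝ :=
  h x • covWedge (S.θ x) (S.omega x) + reForm (S.Υ x)

/-- All Reeb orbits are compact, i.e. the Reeb flow is complete with periodic orbits. -/
def CompactReebOrbits : Prop :=
  ∀ x : M, ∃ γ : ℝ → M, IsMIntegralCurve γ S.ξ ∧ γ 0 = x ∧ ∃ T > 0, Function.Periodic γ T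

/-- The Reeb orbit through `p`, i.e. the fibre over `π(p)` of the projection `π : M → N = M/⟨ξ⟩`
to the leaf space. -/
def reebOrbit (p : M) : Set M :=
  {x | ∃ γ : ℝ → M, IsMIntegralCurve γ S.ξ ∧ γ 0 = p ∧ ∃ t, γ t = x}

/-- `h` is constant along the Reeb orbits. -/
def ReebInvariant (h : M → ℝ) : Prop := ∀ p, ∀ x ∈ S.reebOrbit p, h x = h p

/-- The distance from `π(p)` to `π(x)` in the leaf space `N` with its transverse Calabi–Yau metric
`g_CY`. As `π` is a Riemannian submersion for the metric `g_CY + θ²` on `M`, which is the metric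
of the ansatz with `h = 1`, this is the distance in `M` from the fibre through `p` to `x`. -/
def leafDist (p x : M) : ℝ :=
  (⨅ y ∈ S.reebOrbit p, g2EDist (S.ansatz fun _ => 1) y x).toReal

end ContactCalabiYau

end ContactG2

end

/-! In a frame of the structure the ansatz is `phi0` pulled back by the map that stretches e₀ by h.
So its metric is g_CY + h²θ² and its dual 4-form is ½ω² − hθ ∧ Im Υ. Both ω² = d(θ ∧ dθ) and θ ∧ Im
Υ are closed, the second because ω ∧ Im Υ = 0 and dΥ = 0. Hence d(*φ) = −dh ∧ θ ∧ Im Υ = −d ln h ∧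
(hθ) ∧ Im Υ, and dφ = dh ∧ θ ∧ ω + hω². The coframe hθ, e¹, …, e⁶ is orthonormal, d ln h kills ξ,
and α ↦ α ∧ e⁰ ∧ Im Υ₀ is injective on covectors that kill e₀. Therefore |d^*φ| and |d ln h| bound
each other up to a constant, and |T| ≤ K(|d ln h| + h). This is `exists_pointwise_bounds`; it
reduces everything to estimates of d ln h.

Norms and stars are defined through an arbitrary frame. They can be computed in any frame because
the stabiliser of φ₀ consists of isometries (`norm_map_of_pull_phi0`), which follows from a
determinant identity that recovers the metric from the form. The same identity makes the metric
depend continuously on the point, so in a chart it is comparable to the Euclidean one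
(`exists_metric_bounds`).

Near a zero p, consider a ray in a chart leaving p transversally to ξ. The compact orbit stays near
p in a thin cone around ξ, so the distance r to it is comparable to the parameter t
(`exists_transverse_ray`). If |d ln h| were bounded, h could not tend to 0 along the ray. If h =
O(t^k) while |(ln h)'| ≤ m/t with m < k, then h ≥ const · t^m, a contradiction.

For the upper bound, r is Lipschitz. If h is smooth and comparable to r^k, Taylor expansion on a
ball of radius r gives |dh| = O(r^(k−1)) (`exists_fderiv_le_rpow`), hence |d ln h| = O(1/r). If h =
u r^k, then ln h = ln u + k ln r has local Lipschitz constant O(1/r). -/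

noncomputable section

/-! ### Wedge products and the standard forms in coordinates. -/

namespace ContactG2

/-- The pullback of a form by a linear map. -/
abbrev pull {F : Type*} [NormedAddCommGroup F] [NormedSpace ℝ F] {k : ℕ}
    (β : E7 [⋀^Fin k]→L[ℝ] F) (A : E7 →L[ℝ] E7) : E7 [⋀^Fin k]→L[ℝ] F :=
  β.compContinuousLinearMap A

section Wedges

variable {𝕜 : Type} [RCLike 𝕜]

theorem covWedge_apply {k : ℕ} (a : E7 →L[ℝ] 𝕜) (β : E7 [⋀^Fin k]→L[ℝ] 𝕜)
    (v : Fin (k + 1) → E7) :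
    covWedge a β v = ∑ i : Fin (k + 1), (-1) ^ (i : ℕ) * (a (v i) * β (i.removeNth v)) := by
  simp [covWedge, ContinuousAlternatingMap.alternatizeUncurryFin_apply]

theorem wedges_apply {k : ℕ} (a : Fin k → (E7 →L[ℝ] 𝕜)) (v : Fin k → E7) :
    wedges a v = Matrix.det (Matrix.of fun i j => a i (v j)) := by
  induction k with
  | zero => simp [wedges]
  | succ k ih =>
    rw [Matrix.det_succ_row_zero]
    simp only [wedges, covWedge_apply, ih, Matrix.of_apply, mul_assoc]
    rfl

theorem covWedge_pull {k : ℕ} (a : E7 →L[ℝ] 𝕜) (β : E7 [⋀^Fin k]→L[ℝ] 𝕜) (A : E7 →L[ℝ] E7) :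
    pull (covWedge a β) A = covWedge (a.comp A) (pull β A) := by
  ext v
  simp [covWedge_apply]
  rfl

theorem covWedge_add {k : ℕ} (a : E7 →L[ℝ] 𝕜) (β γ : E7 [⋀^Fin k]→L[ℝ] 𝕜) :
    covWedge a (β + γ) = covWedge a β + covWedge a γ := by
  ext v
  simp [covWedge_apply, mul_add, Finset.sum_add_distrib]

theorem covWedge_sub {k : ℕ} (a : E7 →L[ℝ] 𝕜) (β γ : E7 [⋀^Fin k]→L[ℝ] 𝕜) :
    covWedge a (β - γ) = covWedge a β - covWedge a γ := by
  ext v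
  simp [covWedge_apply, mul_sub, Finset.sum_sub_distrib]

theorem covWedge_smul {k : ℕ} (c : ℝ) (a : E7 →L[ℝ] ℝ) (β : E7 [⋀^Fin k]→L[ℝ] ℝ) :
    covWedge a (c • β) = c • covWedge a β := by
  ext v
  simp only [covWedge_apply, ContinuousAlternatingMap.smul_apply, smul_eq_mul, Finset.mul_sum]
  exact Finset.sum_congr rfl fun _ _ => by ring

theorem smul_covWedge {k : ℕ} (c : ℝ) (a : E7 →L[ℝ] ℝ) (β : E7 [⋀^Fin k]→L[ℝ] ℝ) :
    covWedge (c • a) β = c • covWedge a β := by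
  ext v
  simp only [covWedge_apply, ContinuousAlternatingMap.smul_apply,
    _root_.smul_apply, smul_eq_mul, Finset.mul_sum]
  exact Finset.sum_congr rfl fun _ _ => by ring

theorem wedges_cons {k : ℕ} (a : E7 →L[ℝ] 𝕜) (b : Fin k → (E7 →L[ℝ] 𝕜)) :
    wedges (Matrix.vecCons a b) = covWedge a (wedges b) := rfl

end Wedges

/-- The decomposable form `e^{i₁} ∧ ⋯ ∧ e^{i_k}`. -/
def basisForm {k : ℕ} (i : Fin k → Fin 7) : E7 [⋀^Fin k]→L[ℝ] ℝ := wedges fun a => cov (i a)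

theorem basisForm_apply {k : ℕ} (i : Fin k → Fin 7) (v : Fin k → E7) :
    basisForm i v = Matrix.det (Matrix.of fun a b => v b (i a)) := wedges_apply _ _

theorem covWedge_basisForm {k : ℕ} (a : Fin 7) (i : Fin k → Fin 7) :
    covWedge (cov a) (basisForm i) = basisForm (Matrix.vecCons a i) := by
  rw [basisForm, ← wedges_cons, basisForm]
  congr 1
  ext j : 1
  refine Fin.cases rfl (fun _ => rfl) j

theorem omega0_eq : omega0 = basisForm ![1, 2] + basisForm ![3, 4] + basisForm ![5, 6] := by
  simp only [omega0, basisForm]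
  congr <;> ext j : 1 <;> fin_cases j <;> rfl

/-- The imaginary part of a complex-valued form. -/
def imForm {k : ℕ} (β : E7 [⋀^Fin k]→L[ℝ] ℂ) : E7 [⋀^Fin k]→L[ℝ] ℝ :=
  Complex.imCLM.compContinuousAlternatingMap β

theorem complexCov_apply (i j : Fin 7) (v : E7) :
    complexCov i j v = (v i : ℂ) + Complex.I * (v j : ℂ) := by
  simp [complexCov, cov]

theorem reUpsilon0_eq : reForm upsilon0 =
    basisForm ![1, 3, 5] - basisForm ![1, 4, 6] - basisForm ![2, 3, 6] - basisForm ![2, 4, 5] := by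
  ext v
  simp only [reForm, upsilon0, ContinuousLinearMap.compContinuousAlternatingMap_coe,
    Function.comp_apply, wedges_apply, ContinuousAlternatingMap.sub_apply, basisForm_apply,
    Matrix.det_fin_three, Matrix.of_apply]
  simp [complexCov_apply]
  ring

theorem imUpsilon0_eq : imForm upsilon0 =
    basisForm ![1, 3, 6] + basisForm ![1, 4, 5] + basisForm ![2, 3, 5] - basisForm ![2, 4, 6] := by
  ext v
  simp only [imForm, upsilon0, ContinuousLinearMap.compContinuousAlternatingMap_coe,
    Function.comp_apply, wedges_apply, ContinuousAlternatingMap.sub_apply,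
    ContinuousAlternatingMap.add_apply, basisForm_apply,
    Matrix.det_fin_three, Matrix.of_apply]
  simp [complexCov_apply]
  ring

theorem phi0_eq : phi0 = basisForm ![0, 1, 2] + basisForm ![0, 3, 4] + basisForm ![0, 5, 6]
    + (basisForm ![1, 3, 5] - basisForm ![1, 4, 6] - basisForm ![2, 3, 6]
      - basisForm ![2, 4, 5]) := by
  simp only [phi0, omega0_eq, covWedge_add, covWedge_basisForm, reUpsilon0_eq]

/-- The bilinear form `φ(u, ·, ·)` in coordinates. -/
def sliceMatrix (β : E7 [⋀^Fin 3]→L[ℝ] ℝ) (u : E7) : Matrix (Fin 7) (Fin 7) ℝ :=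
  Matrix.of fun i j => β ![u, vec i, vec j]

/-- The matrix of a linear map in the standard basis. -/
def toMat (A : E7 →L[ℝ] E7) : Matrix (Fin 7) (Fin 7) ℝ := Matrix.of fun i j => A (vec j) i

theorem sum_smul_vec (x : E7) : ∑ i, x i • vec i = x := by
  ext j
  simp [vec, Finset.sum_apply, Pi.single_apply]

theorem three_form_apply (β : E7 [⋀^Fin 3]→L[ℝ] ℝ) (w x y : E7) :
    β ![w, x, y] = ∑ i, ∑ j, x i * y j * sliceMatrix β w i j := by
  have h : ∀ a b : E7, β ![w, a, b] = ((β.curryLeft w).curryLeft a).curryLeft b ![] := by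
    intro a b; simp
  have key : ∀ b : E7, β ![w, x, b] = ∑ i, x i * β ![w, vec i, b] := by
    intro b
    conv_lhs => rw [h, ← sum_smul_vec x]
    simp [map_sum, ContinuousAlternatingMap.sum_apply]
  have key2 : ∀ a : E7, β ![w, a, y] = ∑ j, y j * β ![w, a, vec j] := by
    intro a
    conv_lhs => rw [h, ← sum_smul_vec y]
    simp [map_sum, ContinuousAlternatingMap.sum_apply]
  rw [key]
  refine Finset.sum_congr rfl fun i _ => ?_
  rw [key2, Finset.mul_sum]
  refine Finset.sum_congr rfl fun j _ => ?_
  simp [sliceMatrix]; ring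

theorem sliceMatrix_pull (β : E7 [⋀^Fin 3]→L[ℝ] ℝ) (A : E7 →L[ℝ] E7) (u : E7) :
    sliceMatrix (pull β A) u = (toMat A).transpose * sliceMatrix β (A u) * toMat A := by
  ext i j
  have : sliceMatrix (pull β A) u i j = β ![A u, A (vec i), A (vec j)] := by
    simp only [sliceMatrix, Matrix.of_apply, ContinuousAlternatingMap.compContinuousLinearMap_apply]
    congr 1
    ext a : 1
    fin_cases a <;> rfl
  rw [this, three_form_apply]
  simp only [Matrix.mul_apply, Matrix.transpose_apply, toMat, Matrix.of_apply, Finset.sum_mul]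
  rw [Finset.sum_comm]
  refine Finset.sum_congr rfl fun k _ => Finset.sum_congr rfl fun l _ => by ring

theorem basisForm_three (i j k : Fin 7) (u v w : E7) :
    basisForm ![i, j, k] ![u, v, w] = u i * v j * w k - u i * v k * w j - u j * v i * w k
      + u k * v i * w j + u j * v k * w i - u k * v j * w i := by
  rw [basisForm_apply, Matrix.det_fin_three]
  simp
  ring

theorem phi0_apply (u v w : E7) : phi0 ![u, v, w] =
    ∑ t : Fin 7, u t * ((![v 1 * w 2 - v 2 * w 1 + (v 3 * w 4 - v 4 * w 3)
        + (v 5 * w 6 - v 6 * w 5),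
      -(v 0 * w 2 - v 2 * w 0) + (v 3 * w 5 - v 5 * w 3) - (v 4 * w 6 - v 6 * w 4),
      (v 0 * w 1 - v 1 * w 0) - (v 3 * w 6 - v 6 * w 3) - (v 4 * w 5 - v 5 * w 4),
      -(v 0 * w 4 - v 4 * w 0) - (v 1 * w 5 - v 5 * w 1) + (v 2 * w 6 - v 6 * w 2),
      (v 0 * w 3 - v 3 * w 0) + (v 1 * w 6 - v 6 * w 1) + (v 2 * w 5 - v 5 * w 2),
      -(v 0 * w 6 - v 6 * w 0) + (v 1 * w 3 - v 3 * w 1) - (v 2 * w 4 - v 4 * w 2),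
      (v 0 * w 5 - v 5 * w 0) - (v 1 * w 4 - v 4 * w 1) - (v 2 * w 3 - v 3 * w 2)]
        : Fin 7 → ℝ) t) := by
  simp only [phi0_eq, ContinuousAlternatingMap.sub_apply, ContinuousAlternatingMap.add_apply,
    basisForm_three, Fin.sum_univ_succ]
  simp [Fin.succ]
  ring

theorem slice_phi0 (u : E7) : sliceMatrix phi0 u =
    !![0, u 2, -u 1, u 4, -u 3, u 6, -u 5;
       -u 2, 0, u 0, u 5, -u 6, -u 3, u 4;
       u 1, -u 0, 0, -u 6, -u 5, u 4, u 3;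
       -u 4, -u 5, u 6, 0, u 0, u 1, -u 2;
       u 3, u 6, u 5, -u 0, 0, -u 2, -u 1;
       -u 6, u 3, -u 4, -u 1, u 2, 0, u 0;
       u 5, -u 4, -u 3, u 2, u 1, -u 0, 0] := by
  ext i j
  simp only [sliceMatrix, Matrix.of_apply, phi0_apply]
  fin_cases i <;> fin_cases j <;>
    simp [vec, Fin.sum_univ_succ, Fin.succ]

end ContactG2

/-! ### Recovering the metric from a G₂-form by determinants. -/

namespace ContactG2

open Matrix

theorem slice_phi0_transpose (u : E7) : (sliceMatrix phi0 u)ᵀ = -sliceMatrix phi0 u := by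
  rw [slice_phi0]
  ext i j
  fin_cases i <;> fin_cases j <;> simp

theorem norm_sq_eq_sum (u : E7) : ‖u‖ ^ 2 = u.ofLp ⬝ᵥ u.ofLp := by
  rw [EuclideanSpace.norm_sq_eq]
  simp [dotProduct, sq]

theorem slice_phi0_mulVec (u : E7) : sliceMatrix phi0 u *ᵥ u.ofLp = 0 := by
  rw [slice_phi0]
  ext i
  fin_cases i <;> simp [Matrix.mulVec, dotProduct, Fin.sum_univ_succ, Fin.succ] <;> ring

theorem slice_phi0_vecMul (u : E7) : u.ofLp ᵥ* sliceMatrix phi0 u = 0 := by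
  rw [← Matrix.mulVec_transpose, slice_phi0_transpose, Matrix.neg_mulVec, slice_phi0_mulVec,
    neg_zero]

/-- This is the identity u × (u × w) = ⟨u, w⟩u − |u|²w for the cross product defined by φ₀. It is
where the Euclidean metric becomes visible in φ₀. -/
theorem slice_phi0_mul_self (u : E7) : sliceMatrix phi0 u * sliceMatrix phi0 u =
    vecMulVec u.ofLp u.ofLp - (u.ofLp ⬝ᵥ u.ofLp) • (1 : Matrix (Fin 7) (Fin 7) ℝ) := by
  rw [slice_phi0]
  ext i j
  fin_cases i <;> fin_cases j <;>
    simp [Matrix.mul_apply, dotProduct, Fin.sum_univ_succ, Fin.succ, vecMulVec_apply] <;> ring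

theorem det_one_add_vecMulVec (u v : Fin 7 → ℝ) :
    (1 + vecMulVec u v).det = 1 + v ⬝ᵥ u := by
  rw [vecMulVec_eq Unit, Matrix.det_one_add_replicateCol_mul_replicateRow]

/-- The matrix `Φ_v + w wᵀ` with `w` proportional to `v`. -/
theorem det_slice_phi0_add_self_sq (v : E7) (hv : v ≠ 0) (s : ℝ) :
    (sliceMatrix phi0 v + s ^ 2 • vecMulVec v.ofLp v.ofLp).det ^ 2
      = (v.ofLp ⬝ᵥ v.ofLp) ^ 8 * s ^ 4 := by
  set n := v.ofLp ⬝ᵥ v.ofLp with hn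
  have hn0 : n ≠ 0 := by
    rw [hn, ← norm_sq_eq_sum]; positivity
  set M := sliceMatrix phi0 v + s ^ 2 • vecMulVec v.ofLp v.ofLp with hM
  have hMt : Mᵀ = -sliceMatrix phi0 v + s ^ 2 • vecMulVec v.ofLp v.ofLp := by
    rw [hM, Matrix.transpose_add, slice_phi0_transpose, Matrix.transpose_smul,
      Matrix.transpose_vecMulVec]
  -- As Φ_v is skew and kills v, the product is −Φ_v² + s⁴ n v vᵀ = n·1 + (s⁴ n − 1) v vᵀ, a
  -- multiple of a rank-one perturbation of the identity.
  have hMM : M * Mᵀ = n • (1 + vecMulVec (((s ^ 4 * n - 1) / n) • v.ofLp) v.ofLp) := by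
    rw [hMt, hM]
    simp only [mul_add, add_mul, mul_neg, slice_phi0_mul_self, Matrix.mul_smul, Matrix.smul_mul,
      Matrix.mul_vecMulVec, Matrix.vecMulVec_mul, slice_phi0_mulVec, slice_phi0_vecMul,
      Matrix.smul_mulVec, Matrix.vecMulVec_mulVec]
    ext i j
    simp [vecMulVec_apply, ← hn]
    field_simp
    ring
  have hdet : M.det ^ 2 = (M * Mᵀ).det := by rw [Matrix.det_mul, Matrix.det_transpose, sq]
  rw [hdet, hMM, Matrix.det_smul, det_one_add_vecMulVec, dotProduct_smul, ← hn]
  simp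
  field_simp
  ring

theorem det_slice_phi0_add_sq (v w : E7) (hvw : w.ofLp ⬝ᵥ v.ofLp ≠ 0) :
    (sliceMatrix phi0 v + vecMulVec w.ofLp w.ofLp).det ^ 2
      = (v.ofLp ⬝ᵥ v.ofLp) ^ 4 * (w.ofLp ⬝ᵥ v.ofLp) ^ 4 := by
  have hv : v ≠ 0 := by rintro rfl; simp at hvw
  set n := v.ofLp ⬝ᵥ v.ofLp with hn
  have hn0 : n ≠ 0 := by
    rw [hn, ← norm_sq_eq_sum]; positivity
  set c := w.ofLp ⬝ᵥ v.ofLp with hc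
  -- The vector x is chosen so that 1 + x vᵀ sends w to its component (c/n) v along v. Since x ⊥ v
  -- this map has determinant 1, and since Φ_v kills v it leaves Φ_v unchanged, which reduces to the
  -- case w ∥ v.
  set x : Fin 7 → ℝ := c⁻¹ • ((c / n) • v.ofLp - w.ofLp) with hx
  have hxv : x ⬝ᵥ v.ofLp = 0 := by
    rw [hx, smul_dotProduct, sub_dotProduct, smul_dotProduct, ← hn, ← hc]
    simp
    right; field_simp; ring
  have key : (1 + vecMulVec x v.ofLp) * (sliceMatrix phi0 v + vecMulVec w.ofLp w.ofLp)
      * (1 + vecMulVec v.ofLp x)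
      = sliceMatrix phi0 v + (c / n) ^ 2 • vecMulVec v.ofLp v.ofLp := by
    simp only [mul_add, add_mul, Matrix.mul_one, Matrix.one_mul, Matrix.vecMulVec_mul,
      Matrix.mul_vecMulVec, slice_phi0_mulVec, slice_phi0_vecMul]
    simp only [Matrix.vecMulVec_mulVec, Matrix.zero_vecMulVec, Matrix.vecMulVec_zero,
      zero_mulVec]
    rw [dotProduct_comm v.ofLp w.ofLp, ← hc]
    ext i j
    simp [vecMulVec_apply, hx]
    field_simp
    ring
  have h1 : (sliceMatrix phi0 v + vecMulVec w.ofLp w.ofLp).det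
      = (sliceMatrix phi0 v + (c / n) ^ 2 • vecMulVec v.ofLp v.ofLp).det := by
    rw [← key, Matrix.det_mul, Matrix.det_mul, det_one_add_vecMulVec, det_one_add_vecMulVec,
      dotProduct_comm v.ofLp x, hxv]
    simp
  rw [h1, det_slice_phi0_add_self_sq v hv, ← hn]
  field_simp

theorem toMat_mulVec (A : E7 →L[ℝ] E7) (x : E7) : toMat A *ᵥ x.ofLp = (A x).ofLp := by
  ext i
  conv_rhs => rw [← sum_smul_vec x]
  simp [toMat, Matrix.mulVec, dotProduct, map_sum, mul_comm]

theorem toMat_comp (A B : E7 →L[ℝ] E7) : toMat (A.comp B) = toMat A * toMat B := by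
  ext i j
  have := congrFun (toMat_mulVec A (B (vec j))) i
  simp only [Matrix.mul_apply, toMat, Matrix.of_apply] at this ⊢
  exact this.symm

theorem toMat_id : toMat (ContinuousLinearMap.id ℝ E7) = 1 := by
  ext i j
  simp [toMat, vec, Matrix.one_apply]

/-- The metric of a `G₂`-form as a polynomial expression in the form. -/
theorem det_slice_pull_phi0_sq (A : E7 ≃L[ℝ] E7) (u : E7) (hu : u ≠ 0) :
    (sliceMatrix (pull phi0 (A : E7 →L[ℝ] E7)) u + vecMulVec u.ofLp u.ofLp).det ^ 2
      = (toMat (A : E7 →L[ℝ] E7)).det ^ 4 * ‖A u‖ ^ 8 * ‖u‖ ^ 8 := by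
  set T := toMat (A : E7 →L[ℝ] E7) with hT
  set S := toMat (A.symm : E7 →L[ℝ] E7) with hS
  have hST : S * T = 1 := by
    rw [hS, hT, ← toMat_comp, ← toMat_id]
    congr 1
    ext x : 1
    simp
  have hTS : T * S = 1 := mul_eq_one_comm.1 hST
  -- The slice matrix alone is singular, with u in its kernel, so u uᵀ is added. Taking w = T⁻ᵀ u
  -- makes that term the pullback of w wᵀ, and then ⟨w, A u⟩ = |u|².
  set w : E7 := WithLp.toLp 2 (Sᵀ *ᵥ u.ofLp) with hw
  have hTw : Tᵀ *ᵥ w.ofLp = u.ofLp := by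
    rw [hw]
    simp only [Matrix.mulVec_mulVec, ← Matrix.transpose_mul, hST]
    simp
  have hwA : w.ofLp ⬝ᵥ (A u).ofLp = ‖u‖ ^ 2 := by
    have : (A u).ofLp = T *ᵥ u.ofLp := (toMat_mulVec (A : E7 →L[ℝ] E7) u).symm
    rw [this, Matrix.dotProduct_mulVec, ← Matrix.mulVec_transpose, hTw, norm_sq_eq_sum]
  have hne : w.ofLp ⬝ᵥ (A u).ofLp ≠ 0 := by rw [hwA]; positivity
  have hfac : sliceMatrix (pull phi0 (A : E7 →L[ℝ] E7)) u + vecMulVec u.ofLp u.ofLp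
      = Tᵀ * (sliceMatrix phi0 (A u) + vecMulVec w.ofLp w.ofLp) * T := by
    rw [sliceMatrix_pull, mul_add, add_mul, Matrix.mul_vecMulVec, Matrix.vecMulVec_mul,
      ← Matrix.mulVec_transpose, hTw]
    rfl
  rw [hfac, Matrix.det_mul, Matrix.det_mul, Matrix.det_transpose, mul_pow, mul_pow,
    det_slice_phi0_add_sq _ _ hne, hwA, ← norm_sq_eq_sum]
  ring

/-- A linear automorphism preserving `φ₀` is an isometry. -/
theorem norm_map_of_pull_phi0 (A : E7 ≃L[ℝ] E7) (hA : pull phi0 (A : E7 →L[ℝ] E7) = phi0)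
    (u : E7) : ‖A u‖ = ‖u‖ := by
  set T := toMat (A : E7 →L[ℝ] E7) with hT
  have key : ∀ u : E7, u ≠ 0 → T.det ^ 4 * ‖A u‖ ^ 8 = ‖u‖ ^ 8 := by
    intro u hu
    have h1 := det_slice_pull_phi0_sq A u hu
    have h2 := det_slice_pull_phi0_sq (ContinuousLinearEquiv.refl ℝ E7) u hu
    have h3 : ((ContinuousLinearEquiv.refl ℝ E7 : E7 ≃L[ℝ] E7) : E7 →L[ℝ] E7)
        = ContinuousLinearMap.id ℝ E7 := rfl
    have h4 : pull phi0 (ContinuousLinearMap.id ℝ E7) = phi0 := by ext v; rfl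
    rw [h3, h4, toMat_id] at h2
    rw [hA, h2] at h1
    have hu' : ‖u‖ ^ 8 ≠ 0 := by positivity
    have h5 : ‖u‖ ^ 8 = T.det ^ 4 * ‖A u‖ ^ 8 := by
      refine mul_right_cancel₀ hu' ?_
      simpa [← hT] using h1
    exact h5.symm
  have hdet : T.det ≠ 0 := by
    intro h0
    have := key (vec 0) (by simp [vec])
    rw [h0] at this
    simp [vec] at this
  -- Here μ = 1/|det T|, the conformal factor forced by det⁴ · |A u|⁸ = |u|⁸.
  set μ : ℝ := (Real.sqrt |T.det|)⁻¹ ^ 2 with hμ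
  have hpos : 0 < |T.det| := abs_pos.2 hdet
  have hμT : μ * |T.det| = 1 := by
    rw [hμ, inv_pow, Real.sq_sqrt hpos.le, inv_mul_cancel₀ hpos.ne']
  have hμ0 : 0 < μ := by positivity
  have hnorm : ∀ u : E7, ‖A u‖ ^ 2 = μ * ‖u‖ ^ 2 := by
    intro u
    by_cases hu : u = 0
    · simp [hu]
    have h := key u hu
    have h4 : (‖A u‖ ^ 2) ^ 4 = (μ * ‖u‖ ^ 2) ^ 4 := by
      have hd : T.det ^ 4 = |T.det| ^ 4 := by rw [← abs_pow, abs_of_nonneg (by positivity)]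
      rw [hd] at h
      have h5 : μ ^ 4 * |T.det| ^ 4 = 1 := by rw [← mul_pow, hμT, one_pow]
      calc (‖A u‖ ^ 2) ^ 4 = (μ ^ 4 * |T.det| ^ 4) * ‖A u‖ ^ 8 := by rw [h5]; ring
        _ = μ ^ 4 * ‖u‖ ^ 8 := by rw [mul_assoc, h]
        _ = _ := by ring
    exact (pow_left_inj₀ (by positivity) (by positivity) (by norm_num)).1 h4
  have hTT : Tᵀ * T = μ • (1 : Matrix (Fin 7) (Fin 7) ℝ) := by
    have hin : ∀ x y : E7, (A x).ofLp ⬝ᵥ (A y).ofLp = μ * (x.ofLp ⬝ᵥ y.ofLp) := by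
      intro x y
      have h1 := hnorm (x + y)
      have h2 := hnorm x
      have h3 := hnorm y
      rw [norm_sq_eq_sum, norm_sq_eq_sum] at h1 h2 h3
      simp only [map_add, WithLp.ofLp_add, add_dotProduct, dotProduct_add] at h1
      have h4 := dotProduct_comm (A x).ofLp (A y).ofLp
      have h5 := dotProduct_comm x.ofLp y.ofLp
      rw [← h4, ← h5] at h1
      linarith
    ext i j
    have := hin (vec i) (vec j)
    simp only [Matrix.mul_apply, Matrix.transpose_apply, hT, toMat, Matrix.of_apply]
    refine Eq.trans this ?_
    simp [vec, Matrix.one_apply, dotProduct, eq_comm]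
  have hd2 : T.det ^ 2 = μ ^ 7 := by
    have := congrArg Matrix.det hTT
    rw [Matrix.det_mul, Matrix.det_transpose, Matrix.det_smul] at this
    simpa [sq] using this
  have hμ1 : μ = 1 := by
    -- Conformality gives det² = μ⁷, while μ|det| = 1. Together they leave only μ = 1.
    have h9 : μ ^ 9 = 1 := by
      calc μ ^ 9 = μ ^ 2 * T.det ^ 2 := by rw [hd2]; ring
        _ = (μ * |T.det|) ^ 2 := by rw [mul_pow, sq_abs]
        _ = 1 := by rw [hμT, one_pow]
    exact (pow_eq_one_iff_of_nonneg hμ0.le (by norm_num)).1 h9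
  have := hnorm u
  rw [hμ1, one_mul] at this
  exact (pow_left_inj₀ (norm_nonneg _) (norm_nonneg _) (by norm_num)).1 this

end ContactG2

/-! ### The Euclidean Hodge star and the 4-form *φ₀. -/

namespace ContactG2

open Equiv

/-- The splitting of the index set `Fin 7` into the first `k` and the last `m` indices. -/
def splitEquiv {k m : ℕ} (hkm : k + m = 7) : Fin k ⊕ Fin m ≃ Fin 7 :=
  finSumFinEquiv.trans (finCongr hkm)

/-- The sum over S₇ collapses to the coset τ(S_k × S_m): off the coset the terms vanish by
assumption, and on it the signs from f and g cancel the sign of the permutation, so all k! m! terms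
are equal. -/
theorem block_sum {k m : ℕ} (hkm : k + m = 7)
    (f : (Fin k → Fin 7) → ℝ) (g : (Fin m → Fin 7) → ℝ)
    (hf : ∀ i (π : Perm (Fin k)), f (i ∘ π) = ((Perm.sign π : ℤ) : ℝ) * f i)
    (hg : ∀ i (π : Perm (Fin m)), g (i ∘ π) = ((Perm.sign π : ℤ) : ℝ) * g i)
    (τ : Perm (Fin 7))
    (h0 : ∀ ρ : Perm (Fin k ⊕ Fin m), ρ ∉ (Perm.sumCongrHom (Fin k) (Fin m)).range →
      f (fun a => τ (splitEquiv hkm (ρ (Sum.inl a)))) *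
        g (fun a => τ (splitEquiv hkm (ρ (Sum.inr a)))) = 0) :
    ∑ σ : Perm (Fin 7), ((Perm.sign σ : ℤ) : ℝ) *
      (f (fun a => σ (splitEquiv hkm (Sum.inl a))) * g (fun a => σ (splitEquiv hkm (Sum.inr a))))
    = ((k.factorial * m.factorial : ℕ) : ℝ) * (((Perm.sign τ : ℤ) : ℝ) *
      (f (fun a => τ (splitEquiv hkm (Sum.inl a))) *
        g (fun a => τ (splitEquiv hkm (Sum.inr a))))) := by
  rw [← ((splitEquiv hkm).permCongr.trans (Equiv.mulLeft τ)).sum_comp]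
  rw [← Fintype.sum_of_injective (Perm.sumCongrHom (Fin k) (Fin m))
    Perm.sumCongrHom_injective (fun _ => ((Perm.sign τ : ℤ) : ℝ) *
      (f (fun a => τ (splitEquiv hkm (Sum.inl a))) *
        g (fun a => τ (splitEquiv hkm (Sum.inr a)))))]
  · rw [Finset.sum_const, Finset.card_univ, Fintype.card_prod, Fintype.card_perm,
      Fintype.card_perm, Fintype.card_fin, Fintype.card_fin, nsmul_eq_mul]
  · intro ρ hρ
    have := h0 ρ hρ
    simp only [Equiv.trans_apply, Equiv.coe_mulLeft, Perm.mul_apply, Equiv.permCongr_apply,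
      Equiv.symm_apply_apply] at this ⊢
    rw [this, mul_zero]
  · rintro ⟨a, b⟩
    have h1 := hf (fun i => τ (splitEquiv hkm (Sum.inl i))) a
    have h2 := hg (fun i => τ (splitEquiv hkm (Sum.inr i))) b
    simp only [Function.comp_def] at h1 h2
    simp only [Equiv.trans_apply, Equiv.coe_mulLeft, Perm.mul_apply, Equiv.permCongr_apply,
      Equiv.symm_apply_apply, Perm.sumCongrHom_apply, Perm.sumCongr_apply, Sum.map_inl,
      Sum.map_inr, h1, h2, Perm.sign_mul, Perm.sign_permCongr, Perm.sign_sumCongr]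
    have ha : (((Perm.sign a : ℤ) : ℝ)) * ((Perm.sign a : ℤ) : ℝ) = 1 := by
      rcases Int.units_eq_one_or (Perm.sign a) with h | h <;> simp [h]
    have hb : (((Perm.sign b : ℤ) : ℝ)) * ((Perm.sign b : ℤ) : ℝ) = 1 := by
      rcases Int.units_eq_one_or (Perm.sign b) with h | h <;> simp [h]
    push_cast
    linear_combination (-((Perm.sign τ : ℤ) : ℝ) * f (fun a => τ (splitEquiv hkm (Sum.inl a))) *
      g (fun a => τ (splitEquiv hkm (Sum.inr a)))) * ((((Perm.sign b : ℤ) : ℝ)) * ((Perm.sign b : ℤ) : ℝ)) * ha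
      - (((Perm.sign τ : ℤ) : ℝ) * f (fun a => τ (splitEquiv hkm (Sum.inl a))) *
      g (fun a => τ (splitEquiv hkm (Sum.inr a)))) * hb

theorem form_comp_perm {k : ℕ} (β : E7 [⋀^Fin k]→L[ℝ] ℝ) (i : Fin k → Fin 7)
    (π : Perm (Fin k)) : β (fun a => vec ((i ∘ π) a)) =
      ((Perm.sign π : ℤ) : ℝ) * β fun a => vec (i a) := by
  have := β.toAlternatingMap.map_perm (fun a => vec (i a)) π
  have h2 : β (fun a => vec ((i ∘ π) a)) = Perm.sign π • β fun a => vec (i a) := this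
  rw [h2, Units.smul_def, zsmul_eq_mul]

theorem basisForm_comp_perm {k : ℕ} (i : Fin k → Fin 7) (π : Perm (Fin k)) :
    basisForm (i ∘ π) = ((Perm.sign π : ℤ) : ℝ) • basisForm i := by
  ext v
  simp only [basisForm_apply, ContinuousAlternatingMap.smul_apply, smul_eq_mul, Function.comp_apply]
  exact Matrix.det_permute π (Matrix.of fun a b => (v b).ofLp (i a))

theorem basisForm_vec {k : ℕ} (i j : Fin k → Fin 7) :
    basisForm i (fun a => vec (j a)) = Matrix.det (Matrix.of fun a b => if i a = j b then (1:ℝ) else 0) := by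
  rw [basisForm_apply]
  congr 1
  ext a b
  simp [vec]

theorem basisForm_vec_self {k : ℕ} (i : Fin k → Fin 7) (hi : Function.Injective i) :
    basisForm i (fun a => vec (i a)) = 1 := by
  rw [basisForm_vec]
  convert Matrix.det_one (R := ℝ) (n := Fin k)
  ext a b
  simp [Matrix.one_apply, hi.eq_iff]

theorem basisForm_vec_eq_zero {k : ℕ} (i j : Fin k → Fin 7) (a : Fin k) (h : ∀ b, i a ≠ j b) :
    basisForm i (fun a => vec (j a)) = 0 := by
  rw [basisForm_vec]
  exact Matrix.det_eq_zero_of_row_eq_zero a fun b => by simp [h b]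

/-- A scaled linear combination of forms. -/
def formSum {ι : Type*} (s : Finset ι) {m : ℕ} (c : ℝ) (f : ι → ℝ)
    (g : ι → E7 [⋀^Fin m]→L[ℝ] ℝ) : E7 [⋀^Fin m]→L[ℝ] ℝ := c • ∑ σ ∈ s, f σ • g σ

theorem formSum_apply {ι : Type*} (s : Finset ι) {m : ℕ} (c : ℝ) (f : ι → ℝ)
    (g : ι → E7 [⋀^Fin m]→L[ℝ] ℝ) (v : Fin m → E7) :
    formSum s c f g v = c * ∑ σ ∈ s, f σ * g σ v := by
  simp [formSum, ContinuousAlternatingMap.sum_apply]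

theorem star0_eq {k m : ℕ} (hkm : k + m = 7) (β : E7 [⋀^Fin k]→L[ℝ] ℝ) :
    star0 hkm β = formSum Finset.univ ((k.factorial * m.factorial : ℕ) : ℝ)⁻¹
      (fun σ : Perm (Fin 7) =>
        ((Perm.sign σ : ℤ) : ℝ) * β fun a => vec (σ (splitEquiv hkm (Sum.inl a))))
      (fun σ => basisForm fun a => σ (splitEquiv hkm (Sum.inr a))) := by
  unfold star0 formSum
  generalize (Finset.univ : Finset (Equiv.Perm (Fin 7))) = s
  refine congrArg _ (Finset.sum_congr rfl fun σ _ => ?_)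
  rfl

theorem star0_apply {k m : ℕ} (hkm : k + m = 7) (β : E7 [⋀^Fin k]→L[ℝ] ℝ) (v : Fin m → E7) :
    star0 hkm β v = ((k.factorial * m.factorial : ℕ) : ℝ)⁻¹ * ∑ σ : Equiv.Perm (Fin 7),
      ((Perm.sign σ : ℤ) : ℝ) * ((β fun a => vec (σ (splitEquiv hkm (Sum.inl a)))) *
        basisForm (fun a => σ (splitEquiv hkm (Sum.inr a))) v) := by
  simp only [← mul_assoc _ (β _) _]
  rw [star0_eq, formSum_apply]

theorem exists_of_not_mem_range {k m : ℕ} {ρ : Perm (Fin k ⊕ Fin m)}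
    (h : ρ ∉ (Perm.sumCongrHom (Fin k) (Fin m)).range) :
    (∃ a, ∀ b, ρ (Sum.inl a) ≠ Sum.inl b) ∧ ∃ a, ∀ b, ρ (Sum.inr a) ≠ Sum.inr b := by
  constructor
  · by_contra! hc
    refine h (Perm.mem_sumCongrHom_range_of_perm_mapsTo_inl ?_)
    rintro _ ⟨a, rfl⟩
    obtain ⟨b, hb⟩ := hc a
    exact ⟨b, hb.symm⟩
  · by_contra! hc
    refine h (Perm.mem_sumCongrHom_range_of_perm_mapsTo_inl
      ((Perm.perm_mapsTo_inl_iff_mapsTo_inr ρ).2 ?_))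
    rintro _ ⟨a, rfl⟩
    obtain ⟨b, hb⟩ := hc a
    exact ⟨b, hb.symm⟩

/-- The components of *β are, up to sign, the components of β at the complementary indices. This one
formula compares the norms of β and *β in both directions. -/
theorem star0_vec {k m : ℕ} (hkm : k + m = 7) (β : E7 [⋀^Fin k]→L[ℝ] ℝ) (τ : Perm (Fin 7)) :
    star0 hkm β (fun a => vec (τ (splitEquiv hkm (Sum.inr a)))) =
      ((Perm.sign τ : ℤ) : ℝ) * β fun a => vec (τ (splitEquiv hkm (Sum.inl a))) := by
  have h := block_sum hkm (fun i => β fun a => vec (i a))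
    (fun i => basisForm i (fun a => vec (τ (splitEquiv hkm (Sum.inr a)))))
    (fun i π => form_comp_perm β i π)
    (fun i π => by rw [basisForm_comp_perm]; rfl) τ ?_
  · rw [star0_apply, h, ← mul_assoc, inv_mul_cancel₀ (by positivity), one_mul,
      basisForm_vec_self, mul_one]
    intro a b hab
    simpa using hab
  · intro ρ hρ
    obtain ⟨-, a, ha⟩ := exists_of_not_mem_range hρ
    rw [basisForm_vec_eq_zero _ _ a, mul_zero]
    intro b hb
    exact ha b (by simpa using hb)

theorem star0_basisForm {k m : ℕ} (hkm : k + m = 7) (τ : Perm (Fin 7)) :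
    star0 hkm (basisForm fun a => τ (splitEquiv hkm (Sum.inl a))) =
      ((Perm.sign τ : ℤ) : ℝ) • basisForm fun a => τ (splitEquiv hkm (Sum.inr a)) := by
  ext v
  have h := block_sum hkm
    (fun i => basisForm (fun a => τ (splitEquiv hkm (Sum.inl a))) fun a => vec (i a))
    (fun i => basisForm i v)
    (fun i π => form_comp_perm _ i π)
    (fun i π => by rw [basisForm_comp_perm]; rfl) τ ?_
  · rw [star0_apply, h, ← mul_assoc, inv_mul_cancel₀ (by positivity), one_mul,
      basisForm_vec_self, one_mul]
    · rfl
    · intro a b hab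
      simpa using hab
  · intro ρ hρ
    obtain ⟨⟨a, ha⟩, -⟩ := exists_of_not_mem_range hρ
    have : basisForm (fun a => τ (splitEquiv hkm (Sum.inl a)))
        (fun a => vec (τ (splitEquiv hkm (ρ (Sum.inl a))))) = 0 := by
      rw [basisForm_vec]
      exact Matrix.det_eq_zero_of_column_eq_zero a fun b => by
        rw [Matrix.of_apply, if_neg]
        intro hb
        exact ha b (by simpa using hb.symm)
    rw [this, zero_mul]

theorem star0_add {k m : ℕ} (hkm : k + m = 7) (β γ : E7 [⋀^Fin k]→L[ℝ] ℝ) :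
    star0 hkm (β + γ) = star0 hkm β + star0 hkm γ := by
  ext v
  rw [ContinuousAlternatingMap.add_apply, star0_apply, star0_apply, star0_apply, ← mul_add,
    ← Finset.sum_add_distrib]
  refine congrArg _ (Finset.sum_congr rfl fun σ _ => ?_)
  rw [ContinuousAlternatingMap.add_apply]
  ring

theorem star0_sub {k m : ℕ} (hkm : k + m = 7) (β γ : E7 [⋀^Fin k]→L[ℝ] ℝ) :
    star0 hkm (β - γ) = star0 hkm β - star0 hkm γ := by
  ext v
  rw [ContinuousAlternatingMap.sub_apply, star0_apply, star0_apply, star0_apply, ← mul_sub,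
    ← Finset.sum_sub_distrib]
  refine congrArg _ (Finset.sum_congr rfl fun σ _ => ?_)
  rw [ContinuousAlternatingMap.sub_apply]
  ring

theorem star0_basisForm_three (τ : Perm (Fin 7)) :
    star0 (show 3 + 4 = 7 by norm_num) (basisForm ![τ 0, τ 1, τ 2]) =
      ((Perm.sign τ : ℤ) : ℝ) • basisForm ![τ 3, τ 4, τ 5, τ 6] := by
  have h := star0_basisForm (show 3 + 4 = 7 by norm_num) τ
  convert h using 3
  · ext a : 1; fin_cases a <;> rfl
  · ext a : 1; fin_cases a <;> rfl

/-- The permutation of the index set with given values. -/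
def permOf (f : Fin 7 → Fin 7) (h : Function.Injective f) : Perm (Fin 7) :=
  Equiv.ofBijective f (Finite.injective_iff_bijective.1 h)

/-- The sign is written as a product over inversions so that it can be decided by evaluation. -/
theorem star0_basisForm_three_of_sign (f : Fin 7 → Fin 7) (h : Function.Injective f)
    (hs : ∏ j, ∏ i ∈ Finset.Ioi j, (if f i < f j then (-1 : ℤˣ) else 1) = 1) :
    star0 (show 3 + 4 = 7 by norm_num) (basisForm ![f 0, f 1, f 2]) =
      basisForm ![f 3, f 4, f 5, f 6] := by
  have h1 := star0_basisForm_three (permOf f h)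
  have h2 : Perm.sign (permOf f h) = 1 := by
    rw [Perm.sign_eq_prod_prod_Ioi]
    refine Eq.trans ?_ hs
    refine Finset.prod_congr rfl fun j _ => Finset.prod_congr rfl fun i hi => ?_
    have hij : f i ≠ f j := h.ne (Finset.mem_Ioi.1 hi).ne'
    by_cases hlt : f i < f j
    · simp [permOf, hlt, not_lt.2 hlt.le]
    · simp [permOf, hlt, lt_of_le_of_ne (not_lt.1 hlt) hij.symm]
  rw [h2] at h1
  simpa [permOf] using h1

/-- The 4-form `*φ₀`. -/
@[irreducible] def psi0 : E7 [⋀^Fin 4]→L[ℝ] ℝ := star0 (show 3 + 4 = 7 by norm_num) phi0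

theorem psi0_eq : psi0 = basisForm ![3, 4, 5, 6] + basisForm ![1, 2, 5, 6]
    + basisForm ![1, 2, 3, 4] + (basisForm ![0, 2, 4, 6] - basisForm ![0, 2, 3, 5]
      - basisForm ![0, 1, 4, 5] - basisForm ![0, 1, 3, 6]) := by
  -- Each list is a term of φ₀ followed by its complement in increasing order. All seven
  -- permutations are even, so the stars carry no sign.
  have h1 := star0_basisForm_three_of_sign ![0, 1, 2, 3, 4, 5, 6] (by decide) (by decide)
  have h2 := star0_basisForm_three_of_sign ![0, 3, 4, 1, 2, 5, 6] (by decide) (by decide)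
  have h3 := star0_basisForm_three_of_sign ![0, 5, 6, 1, 2, 3, 4] (by decide) (by decide)
  have h4 := star0_basisForm_three_of_sign ![1, 3, 5, 0, 2, 4, 6] (by decide) (by decide)
  have h5 := star0_basisForm_three_of_sign ![1, 4, 6, 0, 2, 3, 5] (by decide) (by decide)
  have h6 := star0_basisForm_three_of_sign ![2, 3, 6, 0, 1, 4, 5] (by decide) (by decide)
  have h7 := star0_basisForm_three_of_sign ![2, 4, 5, 0, 1, 3, 6] (by decide) (by decide)
  simp at h1 h2 h3 h4 h5 h6 h7
  rw [psi0, phi0_eq]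
  simp only [star0_add, star0_sub, h1, h2, h3, h4, h5, h6, h7]

theorem basisForm_four (i j k l : Fin 7) (x y z w : E7) :
    basisForm ![i, j, k, l] ![x, y, z, w] =
      x i * basisForm ![j, k, l] ![y, z, w] - y i * basisForm ![j, k, l] ![x, z, w]
      + z i * basisForm ![j, k, l] ![x, y, w] - w i * basisForm ![j, k, l] ![x, y, z] := by
  have h : basisForm ![i, j, k, l] = covWedge (cov i) (basisForm ![j, k, l]) :=
    (covWedge_basisForm i ![j, k, l]).symm
  rw [h, covWedge_apply, Fin.sum_univ_four]
  have e0 : (0 : Fin 4).removeNth ![x, y, z, w] = ![y, z, w] := by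
    ext a : 1; fin_cases a <;> rfl
  have e1 : (1 : Fin 4).removeNth ![x, y, z, w] = ![x, z, w] := by
    ext a : 1; fin_cases a <;> rfl
  have e2 : (2 : Fin 4).removeNth ![x, y, z, w] = ![x, y, w] := by
    ext a : 1; fin_cases a <;> rfl
  have e3 : (3 : Fin 4).removeNth ![x, y, z, w] = ![x, y, z] := by
    ext a : 1; fin_cases a <;> rfl
  rw [e0, e1, e2, e3]
  simp [cov]
  ring

/-- `*φ₀` in terms of `φ₀` and the Euclidean inner product. -/
theorem psi0_apply (x y z w : E7) : psi0 ![x, y, z, w] =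
    ∑ m, phi0 ![x, y, vec m] * phi0 ![z, w, vec m]
      - inner ℝ x z * inner ℝ y w + inner ℝ x w * inner ℝ y z := by
  simp only [psi0_eq, phi0_apply, ContinuousAlternatingMap.sub_apply,
    ContinuousAlternatingMap.add_apply, basisForm_four, basisForm_three, PiLp.inner_apply,
    Fin.sum_univ_succ]
  simp [vec, Fin.succ]
  ring

end ContactG2

/-! ### Independence of the chosen G₂-frame. -/

namespace ContactG2

/-- Both sides compute the inner product of the vectors dual to f and g, in two orthonormal bases.
-/
theorem sum_mul_map_isometry (A : E7 ≃L[ℝ] E7) (hA : ∀ u, ‖A u‖ = ‖u‖) (f g : E7 →L[ℝ] ℝ) :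
    ∑ m, f (A (vec m)) * g (A (vec m)) = ∑ m, f (vec m) * g (vec m) := by
  have key : ∀ b : OrthonormalBasis (Fin 7) ℝ E7, ∑ m, f (b m) * g (b m) =
      inner ℝ ((InnerProductSpace.toDual ℝ E7).symm f)
        ((InnerProductSpace.toDual ℝ E7).symm g) := by
    intro b
    rw [← b.sum_inner_mul_inner]
    refine Finset.sum_congr rfl fun m _ => ?_
    rw [real_inner_comm _ (b m), InnerProductSpace.toDual_symm_apply,
      InnerProductSpace.toDual_symm_apply]
  let b := EuclideanSpace.basisFun (Fin 7) ℝ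
  have h1 := key (b.map ⟨A.toLinearEquiv, hA⟩)
  have h2 := key b
  rw [← h2] at h1
  simpa [b, vec] using h1

theorem sum_consEquiv {k : ℕ} (F : (Fin (k + 1) → Fin 7) → ℝ) :
    ∑ i, F i = ∑ m, ∑ i, F (Fin.cons m i) := by
  rw [← (Fin.consEquiv fun _ => Fin 7).sum_comp, Fintype.sum_prod_type]
  rfl

/-- Induction on the degree, removing the isometry from one slot at a time with the other arguments
frozen. -/
theorem sum_sq_map_isometry (A : E7 ≃L[ℝ] E7) (hA : ∀ u, ‖A u‖ = ‖u‖) {k : ℕ}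
    (β : E7 [⋀^Fin k]→L[ℝ] ℝ) :
    ∑ i : Fin k → Fin 7, (β fun a => A (vec (i a))) ^ 2 =
      ∑ i : Fin k → Fin 7, (β fun a => vec (i a)) ^ 2 := by
  induction k with
  | zero =>
    refine Finset.sum_congr rfl fun i _ => ?_
    congr 2
    exact Subsingleton.elim _ _
  | succ k ih =>
    have hc : ∀ (B : E7 → E7) (m : Fin 7) (i : Fin k → Fin 7),
        (β fun a => B (vec ((Fin.cons m i : Fin (k + 1) → Fin 7) a))) =
          β.curryLeft (B (vec m)) fun a => B (vec (i a)) := by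
      intro B m i
      rw [ContinuousAlternatingMap.curryLeft_apply_apply]
      congr 1
      ext a : 1
      refine Fin.cases rfl (fun _ => rfl) a
    have hc1 := hc A
    have hc2 := hc id
    simp only [id] at hc2
    rw [sum_consEquiv, sum_consEquiv]
    simp only [hc1, hc2, ih]
    rw [Finset.sum_comm]
    conv_rhs => rw [Finset.sum_comm]
    refine Finset.sum_congr rfl fun i _ => ?_
    let f : E7 →L[ℝ] ℝ := LinearMap.toContinuousLinearMap
      { toFun := fun u => β.curryLeft u fun a => vec (i a)
        map_add' := by intro u v; rw [map_add]; rfl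
        map_smul' := by intro c u; rw [map_smul]; rfl }
    have := sum_mul_map_isometry A hA f f
    simp only [sq]
    exact this

theorem norm0_pull_isometry (A : E7 ≃L[ℝ] E7) (hA : ∀ u, ‖A u‖ = ‖u‖) {k : ℕ}
    (β : E7 [⋀^Fin k]→L[ℝ] ℝ) : norm0 (pull β (A : E7 →L[ℝ] E7)) = norm0 β := by
  unfold norm0
  rw [← sum_sq_map_isometry A hA β]
  rfl

theorem inner_map_isometry (A : E7 ≃L[ℝ] E7) (hA : ∀ u, ‖A u‖ = ‖u‖) (x y : E7) :
    inner ℝ (A x) (A y) = inner ℝ x y := by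
  let e : E7 ≃ₗᵢ[ℝ] E7 := ⟨A.toLinearEquiv, hA⟩
  exact e.inner_map_map x y

/-- The formula for ψ involves only φ₀ and the inner product, both preserved by A. Thus *φ₀ is
invariant without a separate proof that A preserves the orientation. -/
theorem pull_eq_of_apply (ψ : E7 [⋀^Fin 4]→L[ℝ] ℝ) (hψ : ∀ x y z w, ψ ![x, y, z, w] =
    ∑ m, phi0 ![x, y, vec m] * phi0 ![z, w, vec m]
      - inner ℝ x z * inner ℝ y w + inner ℝ x w * inner ℝ y z)
    (A : E7 ≃L[ℝ] E7) (hA : pull phi0 (A : E7 →L[ℝ] E7) = phi0) :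
    pull ψ (A : E7 →L[ℝ] E7) = ψ := by
  have hn := norm_map_of_pull_phi0 A hA
  have h3 : ∀ x y z, phi0 ![A x, A y, A z] = phi0 ![x, y, z] := by
    intro x y z
    conv_rhs => rw [← hA]
    rw [ContinuousAlternatingMap.compContinuousLinearMap_apply]
    congr 1
    ext a : 1; fin_cases a <;> rfl
  have h4 : ∀ x y z w, ψ ![A x, A y, A z, A w] = ψ ![x, y, z, w] := by
    intro x y z w
    rw [hψ, hψ]
    simp only [inner_map_isometry A hn]
    have hup : ∀ x y u : E7, Function.update ![x, y, (0 : E7)] 2 u = ![x, y, u] := by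
      intro x y u
      ext a : 1
      fin_cases a <;> rfl
    let f : E7 → E7 → E7 →L[ℝ] ℝ := fun x y => LinearMap.toContinuousLinearMap
      { toFun := fun u => phi0 ![x, y, u]
        map_add' := by
          intro u v
          have := phi0.map_update_add ![x, y, 0] 2 u v
          rwa [hup, hup, hup] at this
        map_smul' := by
          intro c u
          have := phi0.map_update_smul ![x, y, 0] 2 c u
          rwa [hup, hup] at this }
    have h5 := sum_mul_map_isometry A hn (f (A x) (A y)) (f (A z) (A w))
    have h6 : ∑ m, phi0 ![x, y, vec m] * phi0 ![z, w, vec m] =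
        ∑ m, phi0 ![A x, A y, vec m] * phi0 ![A z, A w, vec m] := by
      refine Eq.trans (Finset.sum_congr rfl fun m _ => ?_) h5
      rw [← h3 x, ← h3 z]
      rfl
    rw [h6]
  ext v
  have h7 := h4 (v 0) (v 1) (v 2) (v 3)
  have h8 : ![v 0, v 1, v 2, v 3] = v := by ext a : 1; fin_cases a <;> rfl
  have h9 : ![A (v 0), A (v 1), A (v 2), A (v 3)] = fun a => A (v a) := by
    ext a : 1; fin_cases a <;> rfl
  rw [ContinuousAlternatingMap.compContinuousLinearMap_apply]
  exact (congrArg (⇑ψ) h9).symm.trans (h7.trans (congrArg (⇑ψ) h8))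

theorem pull_psi0 (A : E7 ≃L[ℝ] E7) (hA : pull phi0 (A : E7 →L[ℝ] E7) = phi0) :
    pull psi0 (A : E7 →L[ℝ] E7) = psi0 :=
  pull_eq_of_apply psi0 psi0_apply A hA

theorem pull_pull {F : Type*} [NormedAddCommGroup F] [NormedSpace ℝ F] {k : ℕ}
    (β : E7 [⋀^Fin k]→L[ℝ] F) (A B : E7 →L[ℝ] E7) :
    pull (pull β A) B = pull β (A.comp B) := rfl

theorem pull_id {F : Type*} [NormedAddCommGroup F] [NormedSpace ℝ F] {k : ℕ}
    (β : E7 [⋀^Fin k]→L[ℝ] F) : pull β (ContinuousLinearMap.id ℝ E7) = β := rfl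

theorem comp_symm_self (A : E7 ≃L[ℝ] E7) :
    (A : E7 →L[ℝ] E7).comp (A.symm : E7 →L[ℝ] E7) = ContinuousLinearMap.id ℝ E7 := by
  ext1 x; simp

section Frame

variable {φ : E7 [⋀^Fin 3]→L[ℝ] ℝ} {L : E7 ≃L[ℝ] E7}

theorem g2Frame_spec (h : φ = pull phi0 (L : E7 →L[ℝ] E7)) :
    φ = pull phi0 (g2Frame φ : E7 →L[ℝ] E7) := by
  have hφ : IsG2Form φ := ⟨L, h⟩
  rw [g2Frame, dif_pos hφ]
  exact hφ.choose_spec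

/-- Two frames of the same form differ by an element of the stabiliser of φ₀, hence by an isometry.
This is what allows norms to be computed in the frame of the contact structure. -/
theorem pull_frame_change (h : φ = pull phi0 (L : E7 →L[ℝ] E7)) :
    pull phi0 (((g2Frame φ).symm.trans L : E7 ≃L[ℝ] E7) : E7 →L[ℝ] E7) = phi0 := by
  have h1 : (((g2Frame φ).symm.trans L : E7 ≃L[ℝ] E7) : E7 →L[ℝ] E7) =
    (L : E7 →L[ℝ] E7).comp ((g2Frame φ).symm : E7 →L[ℝ] E7) := rfl
  rw [h1, ← pull_pull, ← h]
  conv_lhs => enter [1]; rw [g2Frame_spec h]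
  rw [pull_pull, comp_symm_self, pull_id]

theorem vecNorm_eq (h : φ = pull phi0 (L : E7 →L[ℝ] E7)) (v : E7) : vecNorm φ v = ‖L v‖ := by
  have := norm_map_of_pull_phi0 _ (pull_frame_change h) (g2Frame φ v)
  rw [vecNorm, ← this]
  simp

theorem formNorm_eq (h : φ = pull phi0 (L : E7 →L[ℝ] E7)) {k : ℕ} (β : E7 [⋀^Fin k]→L[ℝ] ℝ) :
    formNorm φ β = norm0 (pull β (L.symm : E7 →L[ℝ] E7)) := by
  rw [← norm0_pull_isometry _ (norm_map_of_pull_phi0 _ (pull_frame_change h)), formNorm, pull_pull]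
  congr 2
  ext1 x
  simp

theorem hodgeStar_self (h : φ = pull phi0 (L : E7 →L[ℝ] E7)) :
    hodgeStar φ (show 3 + 4 = 7 by norm_num) φ = pull psi0 (L : E7 →L[ℝ] E7) := by
  have h1 : φ.compContinuousLinearMap ((g2Frame φ).symm : E7 →L[ℝ] E7) = phi0 := by
    conv_lhs => enter [1]; rw [g2Frame_spec h]
    exact (pull_pull _ _ _).trans (by rw [comp_symm_self, pull_id])
  have h2 : (((g2Frame φ).symm.trans L : E7 ≃L[ℝ] E7) : E7 →L[ℝ] E7).comp
      (g2Frame φ : E7 →L[ℝ] E7) = L := by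
    ext1 x
    simp
  have h3 := pull_psi0 _ (pull_frame_change h)
  rw [← h2, ← pull_pull, h3, hodgeStar, h1, psi0]

/-- The star of a 5-form is needed only up to a constant factor in norm, so the chosen frame can
stay; only *φ itself has to be identified exactly. -/
theorem formNorm_hodgeStar (φ : E7 [⋀^Fin 3]→L[ℝ] ℝ) {k m : ℕ} (hkm : k + m = 7)
    (β : E7 [⋀^Fin k]→L[ℝ] ℝ) : formNorm φ (hodgeStar φ hkm β) =
      norm0 (star0 hkm (pull β ((g2Frame φ).symm : E7 →L[ℝ] E7))) := by
  have : pull (hodgeStar φ hkm β) ((g2Frame φ).symm : E7 →L[ℝ] E7) =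
      star0 hkm (pull β ((g2Frame φ).symm : E7 →L[ℝ] E7)) := by
    rw [hodgeStar, pull_pull, comp_symm_self, pull_id]
  rw [formNorm, ← this]

end Frame

/-! ### Comparing the norm of a form with its components. -/

section Norm0

theorem norm0_nonneg {k : ℕ} (β : E7 [⋀^Fin k]→L[ℝ] ℝ) : 0 ≤ norm0 β := Real.sqrt_nonneg _

theorem norm0_neg {k : ℕ} (β : E7 [⋀^Fin k]→L[ℝ] ℝ) : norm0 (-β) = norm0 β := by
  simp [norm0]

/-- A deliberately crude bound: only the existence of constants matters for all later estimates. -/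
theorem norm0_le_of_forall {k : ℕ} (β : E7 [⋀^Fin k]→L[ℝ] ℝ) {B : ℝ} (hB : 0 ≤ B)
    (h : ∀ i : Fin k → Fin 7, |β fun a => vec (i a)| ≤ B) : norm0 β ≤ 7 ^ k * B := by
  refine Real.sqrt_le_iff.2 ⟨by positivity, ?_⟩
  have h1 : ∑ i : Fin k → Fin 7, (β fun a => vec (i a)) ^ 2 ≤ 7 ^ k * B ^ 2 := by
    calc _ ≤ ∑ i : Fin k → Fin 7, B ^ 2 := Finset.sum_le_sum fun i _ => by
            rw [← sq_abs]; exact pow_le_pow_left₀ (abs_nonneg _) (h i) 2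
      _ = _ := by simp
  have h2 : ((k.factorial : ℝ))⁻¹ ≤ 1 := inv_le_one_of_one_le₀ (by
    exact_mod_cast Nat.one_le_iff_ne_zero.2 (Nat.factorial_ne_zero k))
  have h3 : (0:ℝ) ≤ ∑ i : Fin k → Fin 7, (β fun a => vec (i a)) ^ 2 :=
    Finset.sum_nonneg fun _ _ => sq_nonneg _
  have h4 : (1:ℝ) ≤ 7 ^ k := one_le_pow₀ (by norm_num)
  calc _ ≤ 1 * ∑ i : Fin k → Fin 7, (β fun a => vec (i a)) ^ 2 := by gcongr
    _ ≤ 7 ^ k * B ^ 2 := by rw [one_mul]; exact h1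
    _ ≤ 7 ^ k * B ^ 2 * 7 ^ k := le_mul_of_one_le_right (by positivity) h4
    _ = _ := by ring

theorem abs_le_norm0 {k : ℕ} (β : E7 [⋀^Fin k]→L[ℝ] ℝ) (i : Fin k → Fin 7) :
    |β fun a => vec (i a)| ≤ k.factorial * norm0 β := by
  have hk : (1:ℝ) ≤ k.factorial := by
    exact_mod_cast Nat.one_le_iff_ne_zero.2 (Nat.factorial_ne_zero k)
  refine abs_le_of_sq_le_sq ?_ (by have := norm0_nonneg β; positivity)
  have h1 : (β fun a => vec (i a)) ^ 2 ≤ ∑ i : Fin k → Fin 7, (β fun a => vec (i a)) ^ 2 :=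
    Finset.single_le_sum (f := fun i : Fin k → Fin 7 => (β fun a => vec (i a)) ^ 2)
      (fun _ _ => sq_nonneg _) (Finset.mem_univ i)
  have h3 : (0:ℝ) ≤ ∑ i : Fin k → Fin 7, (β fun a => vec (i a)) ^ 2 :=
    Finset.sum_nonneg fun _ _ => sq_nonneg _
  rw [mul_pow, norm0, Real.sq_sqrt (by positivity), ← mul_assoc]
  have : (k.factorial : ℝ) ^ 2 * (k.factorial : ℝ)⁻¹ = k.factorial := by
    field_simp
  rw [this]
  nlinarith

theorem norm0_smul {k : ℕ} (c : ℝ) (hc : 0 ≤ c) (β : E7 [⋀^Fin k]→L[ℝ] ℝ) :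
    norm0 (c • β) = c * norm0 β := by
  simp only [norm0, ContinuousAlternatingMap.smul_apply, smul_eq_mul, mul_pow, ← Finset.mul_sum]
  rw [mul_left_comm, Real.sqrt_mul (sq_nonneg c), Real.sqrt_sq hc]

theorem exists_perm_extend {k m : ℕ} (hkm : k + m = 7) (i : Fin k → Fin 7)
    (hi : Function.Injective i) :
    ∃ τ : Equiv.Perm (Fin 7), ∀ a, τ (splitEquiv hkm (Sum.inl a)) = i a := by
  let f : Fin 7 → Fin 7 := fun j => Sum.elim i (fun _ => 0) ((splitEquiv hkm).symm j)
  obtain ⟨g, hg⟩ := Set.MapsTo.exists_equiv_extend_of_card_eq (t := (Finset.univ : Finset (Fin 7)))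
    (s := Set.range fun a => splitEquiv hkm (Sum.inl a)) (f := f) (by simp) (by simp)
    (by
      rintro _ ⟨a, rfl⟩ _ ⟨b, rfl⟩ hab
      simp only [f, Equiv.symm_apply_apply, Sum.elim_inl] at hab
      rw [hi hab])
  refine ⟨g.trans (Equiv.subtypeUnivEquiv fun x => Finset.mem_univ x), fun a => ?_⟩
  have := hg _ ⟨a, rfl⟩
  simp only [f, Equiv.symm_apply_apply, Sum.elim_inl] at this
  simpa using this

theorem exists_perm_extend' {k m : ℕ} (hkm : k + m = 7) (i : Fin m → Fin 7)
    (hi : Function.Injective i) :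
    ∃ τ : Equiv.Perm (Fin 7), ∀ a, τ (splitEquiv hkm (Sum.inr a)) = i a := by
  let f : Fin 7 → Fin 7 := fun j => Sum.elim (fun _ => 0) i ((splitEquiv hkm).symm j)
  obtain ⟨g, hg⟩ := Set.MapsTo.exists_equiv_extend_of_card_eq (t := (Finset.univ : Finset (Fin 7)))
    (s := Set.range fun a => splitEquiv hkm (Sum.inr a)) (f := f) (by simp) (by simp)
    (by
      rintro _ ⟨a, rfl⟩ _ ⟨b, rfl⟩ hab
      simp only [f, Equiv.symm_apply_apply, Sum.elim_inr] at hab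
      rw [hi hab])
  refine ⟨g.trans (Equiv.subtypeUnivEquiv fun x => Finset.mem_univ x), fun a => ?_⟩
  have := hg _ ⟨a, rfl⟩
  simp only [f, Equiv.symm_apply_apply, Sum.elim_inr] at this
  simpa using this

theorem form_vec_eq_zero {k : ℕ} (β : E7 [⋀^Fin k]→L[ℝ] ℝ) (i : Fin k → Fin 7)
    (hi : ¬ Function.Injective i) : (β fun a => vec (i a)) = 0 := by
  simp only [Function.Injective, not_forall] at hi
  obtain ⟨a, b, hab, hne⟩ := hi
  exact β.map_eq_zero_of_eq _ (by rw [hab]) hne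

theorem abs_sign_cast (τ : Equiv.Perm (Fin 7)) : |((Equiv.Perm.sign τ : ℤ) : ℝ)| = 1 := by
  rcases Int.units_eq_one_or (Equiv.Perm.sign τ) with h | h <;> simp [h]

theorem norm0_le_of_components {k m : ℕ} (β : E7 [⋀^Fin k]→L[ℝ] ℝ) (γ : E7 [⋀^Fin m]→L[ℝ] ℝ)
    (h : ∀ i : Fin m → Fin 7, Function.Injective i →
      ∃ j : Fin k → Fin 7, |γ fun a => vec (i a)| = |β fun a => vec (j a)|) :
    norm0 γ ≤ 7 ^ m * (k.factorial * norm0 β) := by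
  have h0 := norm0_nonneg β
  refine norm0_le_of_forall _ (by positivity) fun i => ?_
  by_cases hi : Function.Injective i
  · obtain ⟨j, hj⟩ := h i hi
    rw [hj]
    exact abs_le_norm0 β _
  · rw [form_vec_eq_zero _ _ hi, abs_zero]; positivity

section Star

variable {k m : ℕ} (hkm : k + m = 7) (β : E7 [⋀^Fin k]→L[ℝ] ℝ)

/-- Every injective multi-index extends to a permutation, so each nonzero component of one form is
plus or minus a component of the other. Multi-indices with a repetition contribute zero. -/
theorem norm0_le_of_dual (γ : E7 [⋀^Fin m]→L[ℝ] ℝ)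
    (key : ∀ τ : Equiv.Perm (Fin 7), (γ fun a => vec (τ (splitEquiv hkm (Sum.inr a)))) =
      ((Equiv.Perm.sign τ : ℤ) : ℝ) * β fun a => vec (τ (splitEquiv hkm (Sum.inl a)))) :
    norm0 γ ≤ 7 ^ m * (k.factorial * norm0 β) ∧ norm0 β ≤ 7 ^ k * (m.factorial * norm0 γ) := by
  constructor
  · refine norm0_le_of_components β γ fun i hi => ?_
    obtain ⟨τ, hτ⟩ := exists_perm_extend' hkm i hi
    have := key τ
    simp only [hτ] at this
    exact ⟨fun a => τ (splitEquiv hkm (Sum.inl a)),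
      by rw [this, abs_mul, abs_sign_cast, one_mul]⟩
  · refine norm0_le_of_components γ β fun i hi => ?_
    obtain ⟨τ, hτ⟩ := exists_perm_extend hkm i hi
    have := key τ
    simp only [hτ] at this
    exact ⟨fun a => τ (splitEquiv hkm (Sum.inr a)),
      by rw [this, abs_mul, abs_sign_cast, one_mul]⟩

theorem norm0_star0_le : norm0 (star0 hkm β) ≤ 7 ^ m * (k.factorial * norm0 β) :=
  (norm0_le_of_dual hkm β _ (star0_vec hkm β)).1

theorem norm0_le_star0 : norm0 β ≤ 7 ^ k * (m.factorial * norm0 (star0 hkm β)) :=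
  (norm0_le_of_dual hkm β _ (star0_vec hkm β)).2

end Star

theorem norm0_oneForm (η : E7 →L[ℝ] ℝ) : norm0 (oneForm η) = ‖η‖ := by
  have h1 : ∑ i : Fin 1 → Fin 7, (oneForm η fun a => vec (i a)) ^ 2 = ∑ m, η (vec m) ^ 2 := by
    rw [← (Equiv.funUnique (Fin 1) (Fin 7)).symm.sum_comp]
    rfl
  set y := (InnerProductSpace.toDual ℝ E7).symm η with hy
  have h2 : ‖η‖ = ‖y‖ := by rw [hy, LinearIsometryEquiv.norm_map]
  rw [norm0, h1, h2, EuclideanSpace.norm_eq]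
  congr 1
  simp only [Nat.factorial_one, Nat.cast_one, inv_one, one_mul]
  refine Finset.sum_congr rfl fun m _ => ?_
  rw [Real.norm_eq_abs, sq_abs]
  have : η (vec m) = inner ℝ y (vec m) := by rw [hy, InnerProductSpace.toDual_symm_apply]
  rw [this, vec, EuclideanSpace.inner_single_right]
  simp

/-- Bound for the components of a wedge product with a covector. -/
theorem exists_abs_covWedge_le {k : ℕ} (β : E7 [⋀^Fin k]→L[ℝ] ℝ) :
    ∃ K : ℝ, 0 ≤ K ∧ ∀ (η : E7 →L[ℝ] ℝ) (i : Fin (k + 1) → Fin 7),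
      |covWedge η β fun a => vec (i a)| ≤ K * ‖η‖ := by
  refine ⟨(k + 1) * (k.factorial * norm0 β), by have := norm0_nonneg β; positivity, fun η i => ?_⟩
  rw [covWedge_apply]
  refine (Finset.abs_sum_le_sum_abs _ _).trans ?_
  have : ∀ a ∈ (Finset.univ : Finset (Fin (k + 1))),
      |(-1) ^ (a : ℕ) * (η (vec (i a)) * β (a.removeNth fun a => vec (i a)))| ≤
        ‖η‖ * (k.factorial * norm0 β) := by
    intro a _
    rw [abs_mul, abs_pow, abs_neg, abs_one, one_pow, one_mul, abs_mul]
    refine mul_le_mul ?_ (abs_le_norm0 β fun b => i (a.succAbove b)) (abs_nonneg _) (norm_nonneg _)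
    have := η.le_opNorm (vec (i a))
    simpa [vec] using this
  refine (Finset.sum_le_sum this).trans_eq ?_
  simp
  ring

end Norm0

/-- The form `e⁰ ∧ Im Υ₀`. -/
def thetaIm0 : E7 [⋀^Fin 4]→L[ℝ] ℝ := covWedge (cov 0) (imForm upsilon0)

theorem thetaIm0_eq : thetaIm0 = basisForm ![0, 1, 3, 6] + basisForm ![0, 1, 4, 5]
    + basisForm ![0, 2, 3, 5] - basisForm ![0, 2, 4, 6] := by
  rw [thetaIm0, imUpsilon0_eq]
  simp only [covWedge_add, covWedge_sub, covWedge_basisForm]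

theorem covWedge_thetaIm0_apply (η : E7 →L[ℝ] ℝ) (i j k l m : Fin 7) :
    covWedge η thetaIm0 (fun a => vec (![i, j, k, l, m] a)) =
      η (vec i) * thetaIm0 ![vec j, vec k, vec l, vec m]
      - η (vec j) * thetaIm0 ![vec i, vec k, vec l, vec m]
      + η (vec k) * thetaIm0 ![vec i, vec j, vec l, vec m]
      - η (vec l) * thetaIm0 ![vec i, vec j, vec k, vec m]
      + η (vec m) * thetaIm0 ![vec i, vec j, vec k, vec l] := by
  rw [covWedge_apply, Fin.sum_univ_five]
  have e0 : (0 : Fin 5).removeNth (fun a => vec (![i, j, k, l, m] a))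
      = ![vec j, vec k, vec l, vec m] := by ext a : 1; fin_cases a <;> rfl
  have e1 : (1 : Fin 5).removeNth (fun a => vec (![i, j, k, l, m] a))
      = ![vec i, vec k, vec l, vec m] := by ext a : 1; fin_cases a <;> rfl
  have e2 : (2 : Fin 5).removeNth (fun a => vec (![i, j, k, l, m] a))
      = ![vec i, vec j, vec l, vec m] := by ext a : 1; fin_cases a <;> rfl
  have e3 : (3 : Fin 5).removeNth (fun a => vec (![i, j, k, l, m] a))
      = ![vec i, vec j, vec k, vec m] := by ext a : 1; fin_cases a <;> rfl
  have e4 : (4 : Fin 5).removeNth (fun a => vec (![i, j, k, l, m] a))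
      = ![vec i, vec j, vec k, vec l] := by ext a : 1; fin_cases a <;> rfl
  rw [e0, e1, e2, e3, e4]
  simp
  ring

/-- Quantitative injectivity of η ↦ η ∧ e⁰ ∧ Im Υ₀ on covectors that kill e₀. This is what bounds |d
ln h| by |d^*φ|. -/
theorem abs_le_norm0_covWedge_thetaIm0 (η : E7 →L[ℝ] ℝ) (h0 : η (vec 0) = 0) (t : Fin 7) :
    |η (vec t)| ≤ 120 * norm0 (covWedge η thetaIm0) := by
  have key : ∀ i : Fin 5 → Fin 7, |covWedge η thetaIm0 fun a => vec (i a)| ≤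
      120 * norm0 (covWedge η thetaIm0) := fun i => by
    have := abs_le_norm0 (covWedge η thetaIm0) i
    simpa [Nat.factorial] using this
  have hn : 0 ≤ 120 * norm0 (covWedge η thetaIm0) := by
    have := norm0_nonneg (covWedge η thetaIm0)
    positivity
  -- Each index set consists of t, 0 and a triple occurring in Im Υ₀, chosen so that deleting any
  -- index other than t leaves no term of e⁰ ∧ Im Υ₀. The component is then ±η(e_t).
  have h1 := key ![1, 0, 2, 3, 5]
  have h2 := key ![2, 0, 1, 3, 6]
  have h3 := key ![3, 0, 4, 1, 5]
  have h4 := key ![4, 0, 3, 1, 6]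
  have h5 := key ![5, 0, 6, 1, 3]
  have h6 := key ![6, 0, 5, 1, 4]
  generalize 120 * norm0 (covWedge η thetaIm0) = B at hn h1 h2 h3 h4 h5 h6 ⊢
  rw [covWedge_thetaIm0_apply, thetaIm0_eq] at h1 h2 h3 h4 h5 h6
  simp only [ContinuousAlternatingMap.sub_apply, ContinuousAlternatingMap.add_apply,
    basisForm_four, basisForm_three] at h1 h2 h3 h4 h5 h6
  fin_cases t
  · simp [h0]; exact hn
  · simpa [vec] using h1
  · simpa [vec] using h2
  · simpa [vec] using h3
  · simpa [vec] using h4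
  · simpa [vec] using h5
  · simpa [vec] using h6

end ContactG2

/-! ### Exterior derivatives of wedge products on ℝ⁷. -/

namespace ContactG2

open ContinuousAlternatingMap in
/-- The wedge product with a covector as a bilinear map. -/
def covWedgeCLM (k : ℕ) : (E7 →L[ℝ] ℝ) →L[ℝ] (E7 [⋀^Fin k]→L[ℝ] ℝ) →L[ℝ]
    (E7 [⋀^Fin (k + 1)]→L[ℝ] ℝ) :=
  ((ContinuousLinearMap.compL ℝ (E7 [⋀^Fin k]→L[ℝ] ℝ) (E7 →L[ℝ] E7 [⋀^Fin k]→L[ℝ] ℝ)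
    (E7 [⋀^Fin (k + 1)]→L[ℝ] ℝ)) (alternatizeUncurryFinCLM ℝ E7 ℝ)).comp
    (ContinuousLinearMap.smulRightL ℝ E7 (E7 [⋀^Fin k]→L[ℝ] ℝ))

theorem covWedgeCLM_apply {k : ℕ} (a : E7 →L[ℝ] ℝ) (β : E7 [⋀^Fin k]→L[ℝ] ℝ) :
    covWedgeCLM k a β = covWedge a β := rfl

/-- The 1-form of a covector as a linear equivalence. -/
def oneFormEquiv : (E7 →L[ℝ] ℝ) ≃L[ℝ] (E7 [⋀^Fin 1]→L[ℝ] ℝ) :=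
  (ContinuousAlternatingMap.ofSubsingletonLIE (𝕜 := ℝ) (E := E7) (F := ℝ)
    (0 : Fin 1)).toContinuousLinearEquiv

theorem oneFormEquiv_apply (a : E7 →L[ℝ] ℝ) : oneFormEquiv a = oneForm a := rfl

/-- `ω₀ ∧ β`. -/
def omegaWedge {k : ℕ} (β : E7 [⋀^Fin k]→L[ℝ] ℝ) : E7 [⋀^Fin (k + 1 + 1)]→L[ℝ] ℝ :=
  covWedge (cov 1) (covWedge (cov 2) β) + covWedge (cov 3) (covWedge (cov 4) β)
    + covWedge (cov 5) (covWedge (cov 6) β)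

section Exterior

variable {k : ℕ} {θ : E7 → (E7 →L[ℝ] ℝ)} {β : E7 → E7 [⋀^Fin k]→L[ℝ] ℝ} {y : E7}

theorem differentiableAt_oneForm_iff :
    DifferentiableAt ℝ (fun z => oneForm (θ z)) y ↔ DifferentiableAt ℝ θ y :=
  oneFormEquiv.comp_differentiableAt_iff

theorem extDeriv_oneForm_apply (u v : E7) :
    extDeriv (fun z => oneForm (θ z)) y ![u, v] = fderiv ℝ θ y u v - fderiv ℝ θ y v u := by
  have h : fderiv ℝ (fun z => oneForm (θ z)) y =
      (oneFormEquiv : (E7 →L[ℝ] ℝ) →L[ℝ] (E7 [⋀^Fin 1]→L[ℝ] ℝ)).comp (fderiv ℝ θ y) :=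
    oneFormEquiv.comp_fderiv
  rw [extDeriv, h, ContinuousAlternatingMap.alternatizeUncurryFin_apply, Fin.sum_univ_two]
  simp [oneFormEquiv_apply, oneForm, Fin.removeNth]
  rfl

theorem hasFDerivAt_covWedge (hθ : DifferentiableAt ℝ θ y) (hβ : DifferentiableAt ℝ β y) :
    HasFDerivAt (fun z => covWedge (θ z) (β z))
      ((covWedgeCLM k).precompR E7 (θ y) (fderiv ℝ β y)
        + (covWedgeCLM k).precompL E7 (fderiv ℝ θ y) (β y)) y :=
  (covWedgeCLM k).hasFDerivAt_of_bilinear hθ.hasFDerivAt hβ.hasFDerivAt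

theorem pull_omegaWedge (β₀ : E7 [⋀^Fin k]→L[ℝ] ℝ) (L : E7 →L[ℝ] E7) :
    pull (omegaWedge β₀) L = covWedge ((cov 1).comp L) (covWedge ((cov 2).comp L) (pull β₀ L))
      + covWedge ((cov 3).comp L) (covWedge ((cov 4).comp L) (pull β₀ L))
      + covWedge ((cov 5).comp L) (covWedge ((cov 6).comp L) (pull β₀ L)) := by
  simp only [← covWedge_pull]
  rfl

/-- The form `T ∧ β` for a bilinear form `T`. -/
def wedgeTwo (β : E7 [⋀^Fin k]→L[ℝ] ℝ) :
    (E7 →L[ℝ] E7 →L[ℝ] ℝ) →L[ℝ] (E7 [⋀^Fin (k + 1 + 1)]→L[ℝ] ℝ) :=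
  (ContinuousAlternatingMap.alternatizeUncurryFinCLM ℝ E7 ℝ).comp
    (((covWedgeCLM k).precompL E7).flip β)

theorem wedgeTwo_smulRight (β : E7 [⋀^Fin k]→L[ℝ] ℝ) (a b : E7 →L[ℝ] ℝ) :
    wedgeTwo β (a.smulRight b) = covWedge a (covWedge b β) := by
  have h : ((covWedgeCLM k).precompL E7).flip β (a.smulRight b) = a.smulRight (covWedge b β) := by
    ext1 v
    exact ((covWedgeCLM k).flip β).map_smul (a v) b
  rw [wedgeTwo, ContinuousLinearMap.comp_apply, h]
  rfl

/-- Alternating twice uses each pair of slots in both orders, so only the antisymmetric part of T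
survives. -/
theorem wedgeTwo_congr (β : E7 [⋀^Fin k]→L[ℝ] ℝ) {T S : E7 →L[ℝ] E7 →L[ℝ] ℝ}
    (h : ∀ u v, T u v - T v u = S u v - S v u) : wedgeTwo β T = wedgeTwo β S := by
  have key : ∀ T : E7 →L[ℝ] E7 →L[ℝ] ℝ, wedgeTwo β T =
      ContinuousAlternatingMap.alternatizeUncurryFin
        ((ContinuousAlternatingMap.alternatizeUncurryFinCLM ℝ E7 ℝ).comp
          (((ContinuousLinearMap.smulRightL ℝ E7 (E7 [⋀^Fin k]→L[ℝ] ℝ)).flip β).comp T)) :=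
    fun _ => rfl
  ext v
  rw [key, key,
    ContinuousAlternatingMap.alternatizeUncurryFin_alternatizeUncurryFinCLM_comp_apply,
    ContinuousAlternatingMap.alternatizeUncurryFin_alternatizeUncurryFinCLM_comp_apply]
  refine Finset.sum_congr rfl fun i _ => Finset.sum_congr rfl fun j _ => ?_
  have h1 := h (v i.castSucc) (v j.succ)
  congr 1
  simp only [ContinuousLinearMap.comp_apply, ContinuousLinearMap.flip_apply,
    ContinuousLinearMap.smulRightL_apply_apply, ContinuousAlternatingMap.smul_apply, ← sub_smul,
    ContinuousLinearMap.smulRight_apply, h1]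

/-- Of the derivative T of θ only the antisymmetrisation dθ is known. It is replaced by e¹⊗e² +
e³⊗e⁴ + e⁵⊗e⁶, which has the same antisymmetrisation and an explicit wedge product. -/
theorem wedgeTwo_eq (T : E7 →L[ℝ] E7 →L[ℝ] ℝ) (L : E7 →L[ℝ] E7) (β : E7 [⋀^Fin k]→L[ℝ] ℝ)
    (hT : ∀ u v, T u v - T v u =
      (L u 1 * L v 2 - L v 1 * L u 2) + (L u 3 * L v 4 - L v 3 * L u 4)
        + (L u 5 * L v 6 - L v 5 * L u 6)) :
    wedgeTwo β T = covWedge ((cov 1).comp L) (covWedge ((cov 2).comp L) β)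
      + covWedge ((cov 3).comp L) (covWedge ((cov 4).comp L) β)
      + covWedge ((cov 5).comp L) (covWedge ((cov 6).comp L) β) := by
  let S : E7 →L[ℝ] E7 →L[ℝ] ℝ := ((cov 1).comp L).smulRight ((cov 2).comp L)
    + ((cov 3).comp L).smulRight ((cov 4).comp L) + ((cov 5).comp L).smulRight ((cov 6).comp L)
  have hS : ∀ u v, S u v = L u 1 * L v 2 + L u 3 * L v 4 + L u 5 * L v 6 := fun _ _ => rfl
  have h := wedgeTwo_congr β (T := T) (S := S) (by
    intro u v
    rw [hT, hS, hS]; ring)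
  rw [h, ← wedgeTwo_smulRight, ← wedgeTwo_smulRight, ← wedgeTwo_smulRight]
  simp only [S, map_add]

open ContinuousAlternatingMap in
/-- `d(θ ∧ β) = dθ ∧ β - θ ∧ dβ` when `dθ` is the pullback of `ω₀`. -/
theorem extDeriv_covWedge (hθ : DifferentiableAt ℝ θ y) (hβ : DifferentiableAt ℝ β y)
    (L : E7 →L[ℝ] E7) (β₀ : E7 [⋀^Fin k]→L[ℝ] ℝ) (hβ₀ : β y = pull β₀ L)
    (hω : extDeriv (fun z => oneForm (θ z)) y = pull omega0 L) :
    extDeriv (fun z => covWedge (θ z) (β z)) y =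
      pull (omegaWedge β₀) L - covWedge (θ y) (extDeriv β y) := by
  set T := fderiv ℝ θ y with hT
  set B := fderiv ℝ β y with hB
  have hTω : ∀ u v, T u v - T v u =
      (L u 1 * L v 2 - L v 1 * L u 2) + (L u 3 * L v 4 - L v 3 * L u 4)
        + (L u 5 * L v 6 - L v 5 * L u 6) := by
    intro u v
    rw [← extDeriv_oneForm_apply, hω, omega0_eq,
      ContinuousAlternatingMap.compContinuousLinearMap_apply]
    simp [basisForm_apply, Matrix.det_fin_two]
  rw [extDeriv, (hasFDerivAt_covWedge hθ hβ).fderiv, alternatizeUncurryFin_add]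
  have h1 : alternatizeUncurryFin ((covWedgeCLM k).precompR E7 (θ y) B) =
      - covWedge (θ y) (extDeriv β y) := by
    -- The form f(u, v) = θ(v) B(u) + θ(u) B(v) is symmetric, so its double alternation vanishes.
    -- Its two halves alternate to the wanted term and to θ ∧ dβ, whence the minus sign.
    let f : E7 →L[ℝ] E7 →L[ℝ] E7 [⋀^Fin k]→L[ℝ] ℝ :=
      ((ContinuousLinearMap.smulRightL ℝ E7 (E7 [⋀^Fin k]→L[ℝ] ℝ)) (θ y)).comp B
        + (θ y).smulRight B
    have hf := alternatizeUncurryFin_alternatizeUncurryFinCLM_comp_of_symmetric (f := f)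
      (by intro u v; simp [f, add_comm])
    have h2 : alternatizeUncurryFinCLM ℝ E7 ℝ ∘L f = (covWedgeCLM k).precompR E7 (θ y) B
        + (θ y).smulRight (extDeriv β y) := by
      ext1 v
      simp only [f, ContinuousLinearMap.comp_add, _root_.add_apply]
      congr 1
      simp [extDeriv, hB]
    rw [h2, alternatizeUncurryFin_add] at hf
    rw [eq_neg_iff_add_eq_zero]
    exact hf
  have h3 : alternatizeUncurryFin ((covWedgeCLM k).precompL E7 T (β y)) =
      pull (omegaWedge β₀) L := by
    have h4 := wedgeTwo_eq T L (β y) hTω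
    rw [hβ₀] at h4 ⊢
    exact h4.trans (pull_omegaWedge β₀ L).symm
  rw [h1, h3]
  abel

theorem extDeriv_smul_form {h : E7 → ℝ} (hh : DifferentiableAt ℝ h y)
    (hβ : DifferentiableAt ℝ β y) :
    extDeriv (fun z => h z • β z) y = covWedge (fderiv ℝ h y) (β y) + h y • extDeriv β y := by
  rw [extDeriv, (hh.hasFDerivAt.fun_smul hβ.hasFDerivAt).fderiv,
    ContinuousAlternatingMap.alternatizeUncurryFin_add,
    ContinuousAlternatingMap.alternatizeUncurryFin_smul]
  exact add_comm _ _

theorem extDeriv_clm_comp {Υ : E7 → E7 [⋀^Fin k]→L[ℝ] ℂ} (p : ℂ →L[ℝ] ℝ)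
    (hΥ : DifferentiableAt ℝ Υ y) :
    extDeriv (fun z => p.compContinuousAlternatingMap (Υ z)) y =
      p.compContinuousAlternatingMap (extDeriv Υ y) := by
  let P := ContinuousLinearMap.compContinuousAlternatingMapCLM ℝ E7 ℂ ℝ (Fin k) p
  have h : fderiv ℝ (fun z => p.compContinuousAlternatingMap (Υ z)) y = P.comp (fderiv ℝ Υ y) :=
    (P.hasFDerivAt.comp y hΥ.hasFDerivAt).fderiv
  rw [extDeriv, h]
  ext v
  rw [ContinuousLinearMap.compContinuousAlternatingMap_coe, Function.comp_apply, extDeriv,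
    ContinuousAlternatingMap.alternatizeUncurryFin_apply,
    ContinuousAlternatingMap.alternatizeUncurryFin_apply, map_sum]
  refine Finset.sum_congr rfl fun i _ => ?_
  rw [map_zsmul]
  rfl

theorem differentiableAt_clm_comp {Υ : E7 → E7 [⋀^Fin k]→L[ℝ] ℂ} (p : ℂ →L[ℝ] ℝ)
    (hΥ : DifferentiableAt ℝ Υ y) :
    DifferentiableAt ℝ (fun z => p.compContinuousAlternatingMap (Υ z)) y :=
  ((ContinuousLinearMap.compContinuousAlternatingMapCLM ℝ E7 ℂ ℝ (Fin k) p).differentiableAt).comp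
    y hΥ

end Exterior

/-! ### Rescaling the Reeb direction -/

theorem basisForm_eq_zero {k : ℕ} (i : Fin k → Fin 7) (hi : ¬ Function.Injective i) :
    basisForm i = 0 := by
  simp only [Function.Injective, not_forall] at hi
  obtain ⟨a, b, hab, hne⟩ := hi
  ext v
  rw [basisForm_apply]
  exact Matrix.det_zero_of_row_eq hne (by ext c; simp [hab])

/-- On ℂ³ the form ω₀ has type (1,1) and Υ₀ has type (3,0), so ω₀ ∧ Υ₀ would have type (4,1). In
coordinates every product repeats an index. -/
theorem omegaWedge_im : omegaWedge (imForm upsilon0) = 0 := by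
  simp only [omegaWedge, imUpsilon0_eq, covWedge_add, covWedge_sub, covWedge_basisForm]
  simp only [basisForm_eq_zero _ (show ¬ Function.Injective ![(1 : Fin 7), 2, 1, 3, 6] by decide),
    basisForm_eq_zero _ (show ¬ Function.Injective ![(1 : Fin 7), 2, 1, 4, 5] by decide),
    basisForm_eq_zero _ (show ¬ Function.Injective ![(1 : Fin 7), 2, 2, 3, 5] by decide),
    basisForm_eq_zero _ (show ¬ Function.Injective ![(1 : Fin 7), 2, 2, 4, 6] by decide),
    basisForm_eq_zero _ (show ¬ Function.Injective ![(3 : Fin 7), 4, 1, 3, 6] by decide),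
    basisForm_eq_zero _ (show ¬ Function.Injective ![(3 : Fin 7), 4, 1, 4, 5] by decide),
    basisForm_eq_zero _ (show ¬ Function.Injective ![(3 : Fin 7), 4, 2, 3, 5] by decide),
    basisForm_eq_zero _ (show ¬ Function.Injective ![(3 : Fin 7), 4, 2, 4, 6] by decide),
    basisForm_eq_zero _ (show ¬ Function.Injective ![(5 : Fin 7), 6, 1, 3, 6] by decide),
    basisForm_eq_zero _ (show ¬ Function.Injective ![(5 : Fin 7), 6, 1, 4, 5] by decide),
    basisForm_eq_zero _ (show ¬ Function.Injective ![(5 : Fin 7), 6, 2, 3, 5] by decide),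
    basisForm_eq_zero _ (show ¬ Function.Injective ![(5 : Fin 7), 6, 2, 4, 6] by decide)]
  simp

theorem omegaWedge_omega0 : omegaWedge omega0 =
    (2 : ℝ) • (basisForm ![3, 4, 5, 6] + basisForm ![1, 2, 5, 6] + basisForm ![1, 2, 3, 4]) := by
  simp only [omegaWedge, omega0_eq, covWedge_add, covWedge_basisForm]
  change (basisForm ![1, 2, 1, 2] + basisForm ![1, 2, 3, 4] + basisForm ![1, 2, 5, 6]
    + (basisForm ![3, 4, 1, 2] + basisForm ![3, 4, 3, 4] + basisForm ![3, 4, 5, 6])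
    + (basisForm ![5, 6, 1, 2] + basisForm ![5, 6, 3, 4] + basisForm ![5, 6, 5, 6])
      : E7 [⋀^Fin 4]→L[ℝ] ℝ) = _
  ext v
  have h8 : ![v 0, v 1, v 2, v 3] = v := by ext a : 1; fin_cases a <;> rfl
  rw [← h8]
  generalize v 0 = x; generalize v 1 = y; generalize v 2 = z; generalize v 3 = w
  simp only [ContinuousAlternatingMap.add_apply, ContinuousAlternatingMap.smul_apply, basisForm_four,
    basisForm_three, smul_eq_mul]
  ring

/-- This separates the part of *φ₀ without e⁰ from the part linear in e⁰; stretching e₀ affects only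
the latter. -/
theorem psi0_eq_omegaWedge : psi0 = (2⁻¹ : ℝ) • omegaWedge omega0 - thetaIm0 := by
  rw [psi0_eq, omegaWedge_omega0, thetaIm0_eq, smul_smul]
  norm_num
  abel

/-- The linear map multiplying `e₀` by `c`. -/
def scaleMap (c : ℝ) : E7 →L[ℝ] E7 :=
  ContinuousLinearMap.id ℝ E7 + (c - 1) • (cov 0).smulRight (vec 0)

theorem cov_scaleMap (c : ℝ) (i : Fin 7) :
    (cov i).comp (scaleMap c) = if i = 0 then c • cov 0 else cov i := by
  ext x
  by_cases hi : i = 0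
  · subst hi
    simp [scaleMap, cov, vec]; ring
  · simp [scaleMap, cov, vec, hi]

theorem scaleMap_scaleMap (c d : ℝ) (h : c * d = 1) (x : E7) : scaleMap c (scaleMap d x) = x := by
  ext i
  have h1 := congrArg (fun f : E7 →L[ℝ] ℝ => f (scaleMap d x)) (cov_scaleMap c i)
  have h2 := congrArg (fun f : E7 →L[ℝ] ℝ => f x) (cov_scaleMap d i)
  simp only [ContinuousLinearMap.comp_apply] at h1 h2
  have h3 : (scaleMap c (scaleMap d x)) i = cov i (scaleMap c (scaleMap d x)) := rfl
  rw [h3, h1]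
  by_cases hi : i = 0
  · subst hi
    simp only [if_true, _root_.smul_apply, smul_eq_mul] at h2 ⊢
    rw [h2, ← mul_assoc, h, one_mul]
    rfl
  · simp only [hi, if_false] at h2 ⊢
    rw [h2]
    rfl

/-- The linear automorphism multiplying `e₀` by `c ≠ 0`. -/
def scaleEquiv (c : ℝ) (hc : c ≠ 0) : E7 ≃L[ℝ] E7 :=
  ContinuousLinearEquiv.equivOfInverse (scaleMap c) (scaleMap c⁻¹)
    (scaleMap_scaleMap _ _ (inv_mul_cancel₀ hc)) (scaleMap_scaleMap _ _ (mul_inv_cancel₀ hc))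

theorem pull_basisForm_scaleMap (c : ℝ) {k : ℕ} (i : Fin k → Fin 7) (hi : ∀ a, i a ≠ 0) :
    pull (basisForm i) (scaleMap c) = basisForm i := by
  ext v
  rw [ContinuousAlternatingMap.compContinuousLinearMap_apply, basisForm_apply, basisForm_apply]
  congr 1
  ext a b
  have := congrArg (fun f : E7 →L[ℝ] ℝ => f (v b)) (cov_scaleMap c (i a))
  simp only [ContinuousLinearMap.comp_apply, hi a, if_false] at this
  exact this

theorem pull_add {k : ℕ} (β γ : E7 [⋀^Fin k]→L[ℝ] ℝ) (A : E7 →L[ℝ] E7) :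
    pull (β + γ) A = pull β A + pull γ A := rfl

theorem pull_sub {k : ℕ} (β γ : E7 [⋀^Fin k]→L[ℝ] ℝ) (A : E7 →L[ℝ] E7) :
    pull (β - γ) A = pull β A - pull γ A := rfl

theorem pull_smul {k : ℕ} (c : ℝ) (β : E7 [⋀^Fin k]→L[ℝ] ℝ) (A : E7 →L[ℝ] E7) :
    pull (c • β) A = c • pull β A := rfl

theorem pull_omega0_scaleMap (c : ℝ) : pull omega0 (scaleMap c) = omega0 := by
  rw [omega0_eq, pull_add, pull_add, pull_basisForm_scaleMap c _ (by decide),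
    pull_basisForm_scaleMap c _ (by decide), pull_basisForm_scaleMap c _ (by decide)]

theorem pull_re_scaleMap (c : ℝ) : pull (reForm upsilon0) (scaleMap c) = reForm upsilon0 := by
  rw [reUpsilon0_eq, pull_sub, pull_sub, pull_sub, pull_basisForm_scaleMap c _ (by decide),
    pull_basisForm_scaleMap c _ (by decide), pull_basisForm_scaleMap c _ (by decide),
    pull_basisForm_scaleMap c _ (by decide)]

theorem pull_im_scaleMap (c : ℝ) : pull (imForm upsilon0) (scaleMap c) = imForm upsilon0 := by
  rw [imUpsilon0_eq, pull_sub, pull_add, pull_add, pull_basisForm_scaleMap c _ (by decide),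
    pull_basisForm_scaleMap c _ (by decide), pull_basisForm_scaleMap c _ (by decide),
    pull_basisForm_scaleMap c _ (by decide)]

theorem pull_thetaIm0_scaleMap (c : ℝ) : pull thetaIm0 (scaleMap c) = c • thetaIm0 := by
  rw [thetaIm0, covWedge_pull, pull_im_scaleMap, cov_scaleMap, if_pos rfl, smul_covWedge]

theorem pull_omegaWedge_scaleMap (c : ℝ) :
    pull (omegaWedge omega0) (scaleMap c) = omegaWedge omega0 := by
  simp only [omegaWedge, pull_add, covWedge_pull, pull_omega0_scaleMap, cov_scaleMap]
  simp

/-- With c = h this shows that the ansatz is a G₂-form and supplies its frame, the original one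
stretched by h along ξ. -/
theorem pull_phi0_scaleMap (c : ℝ) :
    pull phi0 (scaleMap c) = c • covWedge (cov 0) omega0 + reForm upsilon0 := by
  rw [phi0, pull_add, covWedge_pull, pull_omega0_scaleMap, pull_re_scaleMap, cov_scaleMap,
    if_pos rfl, smul_covWedge]

theorem pull_psi0_scaleMap (c : ℝ) :
    pull psi0 (scaleMap c) = (2⁻¹ : ℝ) • omegaWedge omega0 - c • thetaIm0 := by
  rw [psi0_eq_omegaWedge, pull_sub, pull_smul, pull_omegaWedge_scaleMap, pull_thetaIm0_scaleMap]

end ContactG2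

/-! ### The derivatives of φ and *φ in flat coordinates, and their norms. -/

namespace ContactG2

theorem covWedge_zero {k : ℕ} (a : E7 →L[ℝ] ℝ) : covWedge a (0 : E7 [⋀^Fin k]→L[ℝ] ℝ) = 0 := by
  rw [← covWedgeCLM_apply, map_zero]

theorem zero_covWedge {k : ℕ} (β : E7 [⋀^Fin k]→L[ℝ] ℝ) : covWedge (0 : E7 →L[ℝ] ℝ) β = 0 := by
  rw [← covWedgeCLM_apply, map_zero, _root_.zero_apply]

theorem neg_covWedge {k : ℕ} (a : E7 →L[ℝ] ℝ) (β : E7 [⋀^Fin k]→L[ℝ] ℝ) :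
    covWedge (-a) β = - covWedge a β := by
  rw [← neg_one_smul ℝ, smul_covWedge, neg_one_smul]

section Flat

variable {θ : E7 → (E7 →L[ℝ] ℝ)} {Υ : E7 → E7 [⋀^Fin 3]→L[ℝ] ℂ} {h : E7 → ℝ} {y : E7}
  {L : E7 →L[ℝ] E7}

theorem differentiableAt_extDeriv {k : ℕ} {β : E7 → E7 [⋀^Fin k]→L[ℝ] ℝ}
    (hβ : ContDiffAt ℝ ∞ β y) : DifferentiableAt ℝ (extDeriv β) y := by
  have h1 : ContDiffAt ℝ 1 (fderiv ℝ β) y := hβ.fderiv_right (by norm_cast)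
  exact ((ContinuousAlternatingMap.alternatizeUncurryFinCLM ℝ E7 ℝ).differentiableAt).comp y
    (h1.differentiableAt one_ne_zero)

theorem extDeriv_extDeriv_eq_zero {k : ℕ} {β : E7 → E7 [⋀^Fin k]→L[ℝ] ℝ}
    (hβ : ContDiffAt ℝ ∞ β y) : extDeriv (extDeriv β) y = 0 :=
  extDeriv_extDeriv_apply hβ (by rw [minSmoothness_of_isRCLikeNormedField]; exact WithTop.coe_le_coe.2 (le_top (a := (2 : ℕ∞))))

theorem contDiffAt_extDeriv {k : ℕ} {β : E7 → E7 [⋀^Fin k]→L[ℝ] ℝ}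
    (hβ : ContDiffAt ℝ ∞ β y) : ContDiffAt ℝ ∞ (extDeriv β) y := by
  have h1 : ContDiffAt ℝ ∞ (fderiv ℝ β) y := hβ.fderiv_right (by norm_cast)
  exact ((ContinuousAlternatingMap.alternatizeUncurryFinCLM ℝ E7 ℝ).contDiff.contDiffAt).comp y h1

theorem contDiffAt_oneForm_iff {n : WithTop ℕ∞} :
    ContDiffAt ℝ n (fun z => oneForm (θ z)) y ↔ ContDiffAt ℝ n θ y :=
  oneFormEquiv.comp_contDiffAt_iff

theorem contDiffAt_covWedge {k : ℕ} {β : E7 → E7 [⋀^Fin k]→L[ℝ] ℝ} {n : WithTop ℕ∞}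
    (hθ : ContDiffAt ℝ n θ y) (hβ : ContDiffAt ℝ n β y) :
    ContDiffAt ℝ n (fun z => covWedge (θ z) (β z)) y :=
  (covWedgeCLM k).isBoundedBilinearMap.contDiff.contDiffAt.comp y (hθ.prodMk hβ)

/-- `d(θ ∧ dθ) = ω ∧ ω`. -/
theorem extDeriv_theta_dtheta (hθ : ContDiffAt ℝ ∞ (fun z => oneForm (θ z)) y)
    (hω : extDeriv (fun z => oneForm (θ z)) y = pull omega0 L) :
    extDeriv (fun z => covWedge (θ z) (extDeriv (fun z => oneForm (θ z)) z)) y =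
      pull (omegaWedge omega0) L := by
  rw [extDeriv_covWedge (differentiableAt_oneForm_iff.1 (hθ.differentiableAt (by simp)))
    (differentiableAt_extDeriv hθ) L omega0 hω hω, extDeriv_extDeriv_eq_zero hθ,
    covWedge_zero]
  ext v
  simp

theorem extDeriv_ansatz (hθ : ContDiffAt ℝ ∞ (fun z => oneForm (θ z)) y)
    (hω : extDeriv (fun z => oneForm (θ z)) y = pull omega0 L)
    (hΥ : DifferentiableAt ℝ Υ y) (hdΥ : extDeriv Υ y = 0) (hh : DifferentiableAt ℝ h y) :
    extDeriv (fun z => h z • covWedge (θ z) (extDeriv (fun z => oneForm (θ z)) z)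
        + reForm (Υ z)) y =
      covWedge (fderiv ℝ h y) (covWedge (θ y) (pull omega0 L))
        + h y • pull (omegaWedge omega0) L := by
  have hθ' := differentiableAt_oneForm_iff.1 (hθ.differentiableAt (by simp))
  have h1 : DifferentiableAt ℝ
      (fun z => covWedge (θ z) (extDeriv (fun z => oneForm (θ z)) z)) y :=
    (hasFDerivAt_covWedge hθ' (differentiableAt_extDeriv hθ)).differentiableAt
  have h2 : extDeriv (fun z => reForm (Υ z)) y = 0 := by
    have := extDeriv_clm_comp Complex.reCLM hΥ
    rw [hdΥ] at this
    refine this.trans ?_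
    ext v; simp
  have h3 : DifferentiableAt ℝ (fun z => reForm (Υ z)) y :=
    differentiableAt_clm_comp Complex.reCLM hΥ
  have h4 := extDeriv_add (hh.fun_smul h1) h3
  refine h4.trans ?_
  rw [h2, extDeriv_smul_form hh h1, extDeriv_theta_dtheta hθ hω, hω, add_zero]

/-- The term ½ω² enters as ½ d(θ ∧ dθ), so d² = 0 removes it. The form θ ∧ Im Υ is closed since ω ∧
Im Υ = 0 and Im Υ is closed. Only the derivative of h remains. -/
theorem extDeriv_psi (hθ : ContDiffAt ℝ ∞ (fun z => oneForm (θ z)) y)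
    (hθL : θ y = (cov 0).comp L)
    (hω : extDeriv (fun z => oneForm (θ z)) y = pull omega0 L)
    (hΥ : DifferentiableAt ℝ Υ y) (hdΥ : extDeriv Υ y = 0)
    (hΥL : Υ y = upsilon0.compContinuousLinearMap L) (hh : DifferentiableAt ℝ h y) :
    extDeriv (fun z => (2⁻¹ : ℝ) • extDeriv (fun z => covWedge (θ z)
        (extDeriv (fun z => oneForm (θ z)) z)) z - h z • covWedge (θ z) (imForm (Υ z))) y =
      - covWedge (fderiv ℝ h y) (pull thetaIm0 L) := by
  have hθ' := differentiableAt_oneForm_iff.1 (hθ.differentiableAt (by simp))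
  have h1 : DifferentiableAt ℝ (fun z => imForm (Υ z)) y :=
    differentiableAt_clm_comp Complex.imCLM hΥ
  have h2 : extDeriv (fun z => imForm (Υ z)) y = 0 := by
    have := extDeriv_clm_comp Complex.imCLM hΥ
    rw [hdΥ] at this
    refine this.trans ?_
    ext v; simp
  have h3 : imForm (Υ y) = pull (imForm upsilon0) L := by rw [hΥL]; rfl
  have h4 := extDeriv_covWedge hθ' h1 L (imForm upsilon0) h3 hω
  have h5 : extDeriv (fun z => covWedge (θ z) (imForm (Υ z))) y = 0 := by
    rw [h4, h2, omegaWedge_im, covWedge_zero]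
    ext v; simp
  have h6 : DifferentiableAt ℝ (fun z => covWedge (θ z) (imForm (Υ z))) y :=
    (hasFDerivAt_covWedge hθ' h1).differentiableAt
  have h7 : ContDiffAt ℝ ∞ (fun z => covWedge (θ z) (extDeriv (fun z => oneForm (θ z)) z)) y :=
    contDiffAt_covWedge (contDiffAt_oneForm_iff.1 hθ) (contDiffAt_extDeriv hθ)
  have h8 := differentiableAt_extDeriv h7
  have h9 := extDeriv_extDeriv_eq_zero h7
  have h10 := extDeriv_smul_form (β := fun z => extDeriv (fun z => covWedge (θ z)
    (extDeriv (fun z => oneForm (θ z)) z)) z) (h := fun _ => (2⁻¹ : ℝ))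
    (differentiableAt_const _) h8
  have h11 := extDeriv_smul_form hh.fun_neg h6
  have h12 := extDeriv_add ((differentiableAt_const (2⁻¹ : ℝ)).fun_smul h8) (hh.fun_neg.fun_smul h6)
  have h13 : covWedge (θ y) (imForm (Υ y)) = pull thetaIm0 L := by
    rw [h3, hθL, thetaIm0, covWedge_pull]
  have h14 : (fun z => (2⁻¹ : ℝ) • extDeriv (fun z => covWedge (θ z)
        (extDeriv (fun z => oneForm (θ z)) z)) z - h z • covWedge (θ z) (imForm (Υ z))) =
      (fun z => (2⁻¹ : ℝ) • extDeriv (fun z => covWedge (θ z)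
        (extDeriv (fun z => oneForm (θ z)) z)) z) +
        fun z => (-h z) • covWedge (θ z) (imForm (Υ z)) := by
    funext z
    rw [Pi.add_apply, neg_smul, sub_eq_add_neg]
  rw [h14, h12, h10, h11, h9, h5, h13, fderiv_const_apply, fderiv_fun_neg,
    zero_covWedge, neg_covWedge]
  ext v
  simp

end Flat

section Norms

theorem norm0_add_le {k : ℕ} (β γ : E7 [⋀^Fin k]→L[ℝ] ℝ) :
    norm0 (β + γ) ≤ 7 ^ k * (k.factorial * (norm0 β + norm0 γ)) := by
  have h1 := norm0_nonneg β
  have h2 := norm0_nonneg γ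
  refine norm0_le_of_forall _ (by positivity) fun i => ?_
  rw [ContinuousAlternatingMap.add_apply, mul_add]
  exact (abs_add_le _ _).trans (add_le_add (abs_le_norm0 _ _) (abs_le_norm0 _ _))

variable {φ : E7 [⋀^Fin 3]→L[ℝ] ℝ} {c : ℝ} {L : E7 ≃L[ℝ] E7} {a : E7 →L[ℝ] ℝ}

theorem comp_symm_comp (L : E7 ≃L[ℝ] E7) (B : E7 →L[ℝ] E7) :
    (L : E7 →L[ℝ] E7).comp ((L.symm : E7 →L[ℝ] E7).comp B) = B := by
  ext1 x; simp

theorem scaleMap_comp_symm (hc : c ≠ 0) (L : E7 ≃L[ℝ] E7) :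
    ((L.trans (scaleEquiv c hc)).symm : E7 →L[ℝ] E7) =
      (L.symm : E7 →L[ℝ] E7).comp (scaleMap c⁻¹) := rfl

theorem formNorm_oneForm (hc : c ≠ 0)
    (hφ : φ = pull phi0 ((scaleMap c).comp (L : E7 →L[ℝ] E7))) :
    formNorm φ (oneForm a) = ‖a.comp ((L.symm : E7 →L[ℝ] E7).comp (scaleMap c⁻¹))‖ := by
  rw [formNorm_eq (L := L.trans (scaleEquiv c hc)) hφ, scaleMap_comp_symm, ← norm0_oneForm]
  rfl

/-- Passing to the stretched frame turns θ into c⁻¹ e⁰, which cancels the factor c of dh = h d ln h.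
The covector `a` plays the role of d ln h. -/
theorem formNorm_covWedge_thetaIm0 (hc : c ≠ 0)
    (hφ : φ = pull phi0 ((scaleMap c).comp (L : E7 →L[ℝ] E7))) :
    formNorm φ (- covWedge (c • a) (pull thetaIm0 L)) =
      norm0 (covWedge (a.comp ((L.symm : E7 →L[ℝ] E7).comp (scaleMap c⁻¹))) thetaIm0) := by
  rw [formNorm_eq (L := L.trans (scaleEquiv c hc)) hφ, scaleMap_comp_symm]
  have h1 : pull (- covWedge (c • a) (pull thetaIm0 L))
      ((L.symm : E7 →L[ℝ] E7).comp (scaleMap c⁻¹)) =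
      - pull (covWedge (c • a) (pull thetaIm0 L))
        ((L.symm : E7 →L[ℝ] E7).comp (scaleMap c⁻¹)) := rfl
  rw [h1, norm0_neg, covWedge_pull, pull_pull, comp_symm_comp, pull_thetaIm0_scaleMap, ContinuousLinearMap.smul_comp,
    smul_covWedge, covWedge_smul, smul_smul, mul_inv_cancel₀ hc, one_smul]

theorem formNorm_extD_ansatz (hc : c ≠ 0)
    (hφ : φ = pull phi0 ((scaleMap c).comp (L : E7 →L[ℝ] E7))) :
    formNorm φ (covWedge (c • a) (covWedge ((cov 0).comp (L : E7 →L[ℝ] E7)) (pull omega0 L))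
        + c • pull (omegaWedge omega0) L) =
      norm0 (covWedge (a.comp ((L.symm : E7 →L[ℝ] E7).comp (scaleMap c⁻¹)))
        (covWedge (cov 0) omega0) + c • omegaWedge omega0) := by
  rw [formNorm_eq (L := L.trans (scaleEquiv c hc)) hφ, scaleMap_comp_symm, pull_add, pull_smul,
    ← covWedge_pull, covWedge_pull (c • a), pull_pull, pull_pull, comp_symm_comp,
    pull_omegaWedge_scaleMap, covWedge_pull, pull_omega0_scaleMap,
    cov_scaleMap, if_pos rfl, ContinuousLinearMap.smul_comp, smul_covWedge, smul_covWedge,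
    covWedge_smul, smul_smul, mul_inv_cancel₀ hc, one_smul]

end Norms

end ContactG2

/-! ### Forms on the manifold in charts. -/

namespace ContactG2

section Charts

variable {M : Type*} [TopologicalSpace M] [ChartedSpace E7 M] [IsManifold (𝓡 7) ∞ M]
variable {F : Type*} [NormedAddCommGroup F] [NormedSpace ℝ F] {k : ℕ}

/-- The derivative of the inverse of the chart at `x₀`. -/
def chartD (x₀ : M) (y : E7) : E7 →L[ℝ] E7 :=
  mfderiv 𝓘(ℝ, E7) (𝓡 7) (extChartAt (𝓡 7) x₀).symm y

/-- The derivative of the chart at `x₀`. -/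
def chartDInv (x₀ x : M) : E7 →L[ℝ] E7 :=
  mfderiv (𝓡 7) 𝓘(ℝ, E7) (extChartAt (𝓡 7) x₀) x

theorem isManifold_one (M : Type*) [TopologicalSpace M] [ChartedSpace E7 M]
    [IsManifold (𝓡 7) ∞ M] : IsManifold (𝓡 7) 1 M := IsManifold.of_le (n := ∞) (by norm_cast)

theorem chartForm_eq (α : M → E7 [⋀^Fin k]→L[ℝ] F) (x₀ : M) (y : E7) :
    chartForm α x₀ y = pull (α ((extChartAt (𝓡 7) x₀).symm y)) (chartD x₀ y) := rfl

variable {x₀ : M} {y : E7}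

theorem mfderiv_chart_comp_chartD (hy : y ∈ (extChartAt (𝓡 7) x₀).target) :
    (chartDInv x₀ ((extChartAt (𝓡 7) x₀).symm y)).comp (chartD x₀ y) = ContinuousLinearMap.id ℝ E7 := by
  have := isManifold_one M
  have := mfderiv_extChartAt_comp_mfderivWithin_extChartAt_symm (I := 𝓡 7) hy
  rw [ModelWithCorners.range_eq_univ, mfderivWithin_univ] at this
  exact this

theorem chartD_comp_mfderiv_chart (hy : y ∈ (extChartAt (𝓡 7) x₀).target) :
    (chartD x₀ y).comp (chartDInv x₀ ((extChartAt (𝓡 7) x₀).symm y)) = ContinuousLinearMap.id ℝ E7 := by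
  have := isManifold_one M
  have := mfderivWithin_extChartAt_symm_comp_mfderiv_extChartAt (I := 𝓡 7) hy
  rw [ModelWithCorners.range_eq_univ, mfderivWithin_univ] at this
  exact this

/-- The derivative of the inverse chart as a linear equivalence. -/
def chartDEquiv (hy : y ∈ (extChartAt (𝓡 7) x₀).target) : E7 ≃L[ℝ] E7 :=
  ContinuousLinearEquiv.equivOfInverse (chartD x₀ y)
    (chartDInv x₀ ((extChartAt (𝓡 7) x₀).symm y))
    (fun v => congrArg (fun f : E7 →L[ℝ] E7 => f v) (mfderiv_chart_comp_chartD hy))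
    (fun v => congrArg (fun f : E7 →L[ℝ] E7 => f v) (chartD_comp_mfderiv_chart hy))

theorem chartDInv_self (x : M) : chartDInv x x = ContinuousLinearMap.id ℝ E7 := by
  have := isManifold_one M
  exact mfderiv_extChartAt_self

theorem chartD_self (x : M) : chartD x (extChartAt (𝓡 7) x x) = ContinuousLinearMap.id ℝ E7 := by
  have h := mfderiv_chart_comp_chartD (mem_extChartAt_target (I := 𝓡 7) x)
  rw [extChartAt_to_inv, chartDInv_self] at h
  exact h

theorem extD_eq (α : M → E7 [⋀^Fin k]→L[ℝ] F) (x : M) :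
    extD α x = extDeriv (chartForm α x) (extChartAt (𝓡 7) x x) := by
  have := isManifold_one M
  rw [extD, mfderiv_extChartAt_self]
  rfl

theorem target_mem_nhds' (hy : y ∈ (extChartAt (𝓡 7) x₀).target) :
    (extChartAt (𝓡 7) x₀).target ∈ 𝓝 y := (isOpen_extChartAt_target x₀).mem_nhds hy

theorem mdifferentiableAt_chart_symm (hy : y ∈ (extChartAt (𝓡 7) x₀).target) :
    MDifferentiableAt 𝓘(ℝ, E7) (𝓡 7) (extChartAt (𝓡 7) x₀).symm y :=
  (((contMDiffOn_extChartAt_symm (n := ∞) x₀).contMDiffAt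
    (target_mem_nhds' hy)).mdifferentiableAt (by simp))

theorem continuousAt_chart_symm (hy : y ∈ (extChartAt (𝓡 7) x₀).target) :
    ContinuousAt (extChartAt (𝓡 7) x₀).symm y := (mdifferentiableAt_chart_symm hy).continuousAt

/-- The exterior derivative commutes with passing to a chart. -/
theorem chartForm_extD {α : M → E7 [⋀^Fin k]→L[ℝ] F} (hα : SmoothForm α)
    (hy : y ∈ (extChartAt (𝓡 7) x₀).target) :
    chartForm (extD α) x₀ y = extDeriv (chartForm α x₀) y := by
  have := isManifold_one M
  set x := (extChartAt (𝓡 7) x₀).symm y with hx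
  -- The derivative at x is defined in the chart at x, so it is transported by the transition map f
  -- from the chart at x₀, using that the exterior derivative commutes with pullback.
  set f : E7 → E7 := extChartAt (𝓡 7) x ∘ (extChartAt (𝓡 7) x₀).symm with hf
  have hfy : f y = extChartAt (𝓡 7) x x := rfl
  have hfs : ContDiffAt ℝ ∞ f y := by
    have := contDiffWithinAt_ext_coord_change (I := 𝓡 7) (n := ∞) x x₀ (y := y)
      (by
        rw [PartialEquiv.trans_source]
        exact ⟨hy, mem_extChartAt_source x⟩)
    rwa [ModelWithCorners.range_eq_univ, contDiffWithinAt_univ] at this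
  have hα' : DifferentiableAt ℝ (chartForm α x) (f y) :=
    ((hα x).contDiffAt (target_mem_nhds' (mem_extChartAt_target x))).differentiableAt (by simp)
  have hpull := extDeriv_pullback hα' hfs
    (by rw [minSmoothness_of_isRCLikeNormedField]; exact WithTop.coe_le_coe.2 (le_top (a := (2 : ℕ∞))))
  have hmf : ∀ z ∈ (extChartAt (𝓡 7) x₀).target, (extChartAt (𝓡 7) x₀).symm z ∈
      (extChartAt (𝓡 7) x).source → (chartDInv x ((extChartAt (𝓡 7) x₀).symm z)).comp (chartD x₀ z) = fderiv ℝ f z := by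
    intro z hz hzs
    have := mfderiv_comp (I := 𝓘(ℝ, E7)) (I' := 𝓡 7) (I'' := 𝓘(ℝ, E7)) z
      (g := extChartAt (𝓡 7) x) (f := (extChartAt (𝓡 7) x₀).symm)
      (mdifferentiableAt_extChartAt (by rwa [extChartAt_source] at hzs))
      (mdifferentiableAt_chart_symm hz)
    rw [← mfderiv_eq_fderiv]
    exact this.symm
  have hsrc : ∀ᶠ z in 𝓝 y, (extChartAt (𝓡 7) x₀).symm z ∈ (extChartAt (𝓡 7) x).source :=
    (continuousAt_chart_symm hy).eventually (extChartAt_source_mem_nhds x)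
  have heq : chartForm α x₀ =ᶠ[𝓝 y]
      fun z => (chartForm α x (f z)).compContinuousLinearMap (fderiv ℝ f z) := by
    filter_upwards [hsrc, target_mem_nhds' hy] with z hzs hz
    have hzs' : (extChartAt (𝓡 7) x).symm (f z) = (extChartAt (𝓡 7) x₀).symm z :=
      (extChartAt (𝓡 7) x).left_inv hzs
    have hft : f z ∈ (extChartAt (𝓡 7) x).target := (extChartAt (𝓡 7) x).map_source hzs
    rw [chartForm_eq, chartForm_eq, hzs', ← hmf z hz hzs]
    have h1 := chartD_comp_mfderiv_chart hft
    rw [hzs'] at h1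
    change pull _ _ = pull (pull _ _) _
    rw [pull_pull, ← ContinuousLinearMap.comp_assoc, h1, ContinuousLinearMap.id_comp]
  rw [heq.extDeriv_eq, hpull, chartForm_eq, ← hx, extD_eq, ← hmf y hy (mem_extChartAt_source x),
    ← hx, chartDInv_self, hfy]
  rfl

/-- The differential of a function, as a covector. -/
def dM (h : M → ℝ) (x : M) : E7 →L[ℝ] ℝ := mfderiv (𝓡 7) 𝓘(ℝ, ℝ) h x

theorem hasFDerivAt_comp_chart_symm {h : M → ℝ} (hy : y ∈ (extChartAt (𝓡 7) x₀).target)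
    (hh : MDifferentiableAt (𝓡 7) 𝓘(ℝ, ℝ) h ((extChartAt (𝓡 7) x₀).symm y)) :
    HasFDerivAt (h ∘ (extChartAt (𝓡 7) x₀).symm)
      ((dM h ((extChartAt (𝓡 7) x₀).symm y)).comp (chartD x₀ y)) y := by
  have := hh.hasMFDerivAt.comp y (mdifferentiableAt_chart_symm hy).hasMFDerivAt
  exact this.hasFDerivAt

end Charts

namespace ContactCalabiYau

variable {M : Type*} [TopologicalSpace M] [ChartedSpace E7 M] [IsManifold (𝓡 7) ∞ M]
  (S : ContactCalabiYau M)

/-- The Reeb field, with values in the model space. -/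
def xi (x : M) : E7 := S.ξ x

theorem eq_vec_zero_of_omega0 {u : E7} (h0 : u 0 = 1) (h : ∀ v, omega0 ![u, v] = 0) :
    u = vec 0 := by
  have key : ∀ v : E7, (u 1 * v 2 - v 1 * u 2) + (u 3 * v 4 - v 3 * u 4)
        + (u 5 * v 6 - v 5 * u 6) = 0 := by
    intro v
    rw [← h v, omega0_eq]
    simp [basisForm_apply, Matrix.det_fin_two]
  have h1 := key (vec 1)
  have h2 := key (vec 2)
  have h3 := key (vec 3)
  have h4 := key (vec 4)
  have h5 := key (vec 5)
  have h6 := key (vec 6)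
  simp [vec] at h1 h2 h3 h4 h5 h6
  ext i
  fin_cases i <;> simp [vec, *]

/-- Since ω₀ is nondegenerate on the span of e₁, …, e₆, the two Reeb conditions determine ξ. Hence
every frame of the structure sends it to e₀. -/
theorem frame_reeb {x : M} {L : E7 ≃L[ℝ] E7} (hθ : S.θ x = (cov 0).comp (L : E7 →L[ℝ] E7))
    (hω : S.omega x = pull omega0 (L : E7 →L[ℝ] E7)) : L (S.xi x) = vec 0 := by
  refine eq_vec_zero_of_omega0 ?_ fun v => ?_
  · have := S.θ_ξ x
    rw [hθ] at this
    exact this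
  · have := S.dθ_ξ x (L.symm v)
    change S.omega x _ = 0 at this
    rw [hω, ContinuousAlternatingMap.compContinuousLinearMap_apply] at this
    rw [← this]
    congr 1
    ext i : 1
    fin_cases i
    · rfl
    · exact (L.apply_symm_apply v).symm

/-- The frame of the structure in the chart at `x₀`. -/
theorem exists_frame_chart {x₀ : M} {y : E7} (hy : y ∈ (extChartAt (𝓡 7) x₀).target) :
    ∃ L : E7 ≃L[ℝ] E7,
      S.θ ((extChartAt (𝓡 7) x₀).symm y) = (cov 0).comp (L : E7 →L[ℝ] E7) ∧
      S.omega ((extChartAt (𝓡 7) x₀).symm y) = pull omega0 (L : E7 →L[ℝ] E7) ∧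
      S.Υ ((extChartAt (𝓡 7) x₀).symm y) = upsilon0.compContinuousLinearMap (L : E7 →L[ℝ] E7) ∧
      (S.θ ((extChartAt (𝓡 7) x₀).symm y)).comp (chartD x₀ y) =
        (cov 0).comp ((L : E7 →L[ℝ] E7).comp (chartD x₀ y)) ∧
      extDeriv (fun z => oneForm ((S.θ ((extChartAt (𝓡 7) x₀).symm z)).comp (chartD x₀ z))) y =
        pull omega0 ((L : E7 →L[ℝ] E7).comp (chartD x₀ y)) ∧
      chartForm S.Υ x₀ y =
        upsilon0.compContinuousLinearMap ((L : E7 →L[ℝ] E7).comp (chartD x₀ y)) := by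
  obtain ⟨L, h1, h2, h3⟩ := S.frame ((extChartAt (𝓡 7) x₀).symm y)
  refine ⟨L, h1, h2, h3, by rw [h1]; rfl, ?_, by rw [chartForm, h3]; rfl⟩
  have := chartForm_extD S.smooth_θ hy
  rw [chartForm_eq, h2] at this
  exact this.symm

theorem ansatz_eq_pull {h : M → ℝ} {x : M} {L : E7 ≃L[ℝ] E7}
    (hθ : S.θ x = (cov 0).comp (L : E7 →L[ℝ] E7))
    (hω : S.omega x = pull omega0 (L : E7 →L[ℝ] E7))
    (hΥ : S.Υ x = upsilon0.compContinuousLinearMap (L : E7 →L[ℝ] E7)) :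
    S.ansatz h x = pull phi0 ((scaleMap (h x)).comp (L : E7 →L[ℝ] E7)) := by
  rw [← pull_pull, pull_phi0_scaleMap, pull_add, pull_smul, covWedge_pull, ansatz, hθ, hω, hΥ]
  rfl

theorem starPhi_ansatz {h : M → ℝ} {x : M} (hx : h x ≠ 0) {L : E7 ≃L[ℝ] E7}
    (hθ : S.θ x = (cov 0).comp (L : E7 →L[ℝ] E7))
    (hω : S.omega x = pull omega0 (L : E7 →L[ℝ] E7))
    (hΥ : S.Υ x = upsilon0.compContinuousLinearMap (L : E7 →L[ℝ] E7)) :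
    starPhi (S.ansatz h) x = pull ((2⁻¹ : ℝ) • omegaWedge omega0 - h x • thetaIm0) L := by
  rw [starPhi, hodgeStar_self (L := L.trans (scaleEquiv (h x) hx)) (S.ansatz_eq_pull hθ hω hΥ),
    ← pull_psi0_scaleMap, pull_pull]
  rfl

end ContactCalabiYau

end ContactG2

/-! ### The torsion of the ansatz and its pointwise comparison with d ln h. -/

namespace ContactG2

theorem formNorm_neg (φ : E7 [⋀^Fin 3]→L[ℝ] ℝ) {k : ℕ} (β : E7 [⋀^Fin k]→L[ℝ] ℝ) :
    formNorm φ (-β) = formNorm φ β :=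
  norm0_neg (pull β ((g2Frame φ).symm : E7 →L[ℝ] E7))

theorem codiffNorm_eq {M : Type*} [TopologicalSpace M] [ChartedSpace E7 M]
    (φ : M → E7 [⋀^Fin 3]→L[ℝ] ℝ) (x : M) : codiffNorm φ x =
      norm0 (star0 (show 5 + 2 = 7 by norm_num) (pull (extD (starPhi φ) x)
        ((g2Frame (φ x)).symm : E7 →L[ℝ] E7))) := by
  rw [codiffNorm, codiff, formNorm_neg, formNorm_hodgeStar]

namespace ContactCalabiYau

variable {M : Type*} [TopologicalSpace M] [ChartedSpace E7 M] [IsManifold (𝓡 7) ∞ M]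
  (S : ContactCalabiYau M)

/-- The contact form in the chart at `x₀`. -/
def thetaC (x₀ : M) (z : E7) : E7 →L[ℝ] ℝ :=
  (S.θ ((extChartAt (𝓡 7) x₀).symm z)).comp (chartD x₀ z)

theorem contDiffAt_thetaC {x₀ : M} {y : E7} (hy : y ∈ (extChartAt (𝓡 7) x₀).target) :
    ContDiffAt ℝ ∞ (fun z : E7 => oneForm (S.thetaC x₀ z)) y :=
  (S.smooth_θ x₀).contDiffAt (target_mem_nhds' hy)

theorem contDiffAt_upsilonC {x₀ : M} {y : E7} (hy : y ∈ (extChartAt (𝓡 7) x₀).target) :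
    ContDiffAt ℝ ∞ (chartForm S.Υ x₀) y :=
  (S.smooth_Υ x₀).contDiffAt (target_mem_nhds' hy)

theorem chartForm_omega {x₀ : M} {y : E7} (hy : y ∈ (extChartAt (𝓡 7) x₀).target) :
    chartForm S.omega x₀ y = extDeriv (fun z : E7 => oneForm (S.thetaC x₀ z)) y :=
  chartForm_extD S.smooth_θ hy

theorem chartForm_ansatz (h : M → ℝ) {x₀ : M} {y : E7}
    (hy : y ∈ (extChartAt (𝓡 7) x₀).target) :
    chartForm (S.ansatz h) x₀ y = h ((extChartAt (𝓡 7) x₀).symm y) •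
      covWedge (S.thetaC x₀ y) (extDeriv (fun z : E7 => oneForm (S.thetaC x₀ z)) y)
        + reForm (chartForm S.Υ x₀ y) := by
  rw [← S.chartForm_omega hy, chartForm_eq, chartForm_eq, ansatz, pull_add, pull_smul,
    covWedge_pull]
  rfl

variable {h : M → ℝ}

/-- The formula must hold on an open set to be differentiated, so ½ω² is given as ½ d(θ ∧ dθ) in the
coordinates, with no reference to a pointwise frame. -/
theorem chartForm_starPhi {x₀ : M} {y : E7} (hy : y ∈ (extChartAt (𝓡 7) x₀).target)
    (hx : h ((extChartAt (𝓡 7) x₀).symm y) ≠ 0) :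
    chartForm (starPhi (S.ansatz h)) x₀ y =
      (2⁻¹ : ℝ) • extDeriv (fun z : E7 => covWedge (S.thetaC x₀ z)
        (extDeriv (fun z : E7 => oneForm (S.thetaC x₀ z)) z)) y -
      h ((extChartAt (𝓡 7) x₀).symm y) • covWedge (S.thetaC x₀ y)
        (imForm (chartForm S.Υ x₀ y)) := by
  obtain ⟨L, h1, h2, h3, h4, h5, h6⟩ := S.exists_frame_chart hy
  rw [extDeriv_theta_dtheta (S.contDiffAt_thetaC hy) h5, chartForm_eq,
    S.starPhi_ansatz hx h1 h2 h3, pull_pull, pull_sub, pull_smul, pull_smul, h6]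
  congr 2
  rw [thetaIm0, covWedge_pull, thetaC, h4]
  rfl

/-- `dh(ξ) = 0`. -/
theorem mfderiv_reeb (hS : S.CompactReebOrbits) (h_inv : S.ReebInvariant h) {x : M}
    (hd : MDifferentiableAt (𝓡 7) 𝓘(ℝ, ℝ) h x) :
    (dM h x) (S.xi x) = 0 := by
  obtain ⟨γ, hγ, rfl, -⟩ := hS x
  -- Differentiating the constant h along the integral curve through x gives dh(ξ) = 0.
  have h1 : h ∘ γ = fun _ => h (γ 0) := by
    funext t
    exact h_inv (γ 0) (γ t) ⟨γ, hγ, rfl, t, rfl⟩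
  have h2 : HasFDerivAt (h ∘ γ)
      ((dM h (γ 0)).comp ((1 : ℝ →L[ℝ] ℝ).smulRight (S.xi (γ 0)))) 0 :=
    (hd.hasMFDerivAt.comp (0 : ℝ) (hγ 0)).hasFDerivAt
  rw [h1] at h2
  have h3 := h2.unique (hasFDerivAt_const (h (γ 0)) (0 : ℝ))
  have h4 := DFunLike.congr_fun h3 (1 : ℝ)
  simpa using h4

/-- The exterior derivatives of `φ` and `*φ`. -/
theorem extD_ansatz {x : M} (hx : 0 < h x) (hd : MDifferentiableAt (𝓡 7) 𝓘(ℝ, ℝ) h x)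
    {L : E7 ≃L[ℝ] E7}
    (hθ : S.θ x = (cov 0).comp (L : E7 →L[ℝ] E7))
    (hω : S.omega x = pull omega0 (L : E7 →L[ℝ] E7))
    (hΥ : S.Υ x = upsilon0.compContinuousLinearMap (L : E7 →L[ℝ] E7)) :
    extD (S.ansatz h) x =
      covWedge (dM h x)
        (covWedge ((cov 0).comp (L : E7 →L[ℝ] E7)) (pull omega0 L))
        + h x • pull (omegaWedge omega0) L ∧
    extD (starPhi (S.ansatz h)) x =
      - covWedge (dM h x) (pull thetaIm0 L) := by
  set y : E7 := extChartAt (𝓡 7) x x with hy'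
  have hy : y ∈ (extChartAt (𝓡 7) x).target := mem_extChartAt_target x
  have hyx : (extChartAt (𝓡 7) x).symm y = x := extChartAt_to_inv x
  have hD : chartD x y = ContinuousLinearMap.id ℝ E7 := chartD_self x
  have hth : S.thetaC x y = (cov 0).comp (L : E7 →L[ℝ] E7) := by
    rw [thetaC, hD, hyx, ContinuousLinearMap.comp_id, hθ]
  have hom : extDeriv (fun z : E7 => oneForm (S.thetaC x z)) y = pull omega0 (L : E7 →L[ℝ] E7) := by
    rw [← S.chartForm_omega hy, chartForm_eq, hD, hyx, pull_id, hω]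
  have hup : chartForm S.Υ x y = upsilon0.compContinuousLinearMap (L : E7 →L[ℝ] E7) := by
    rw [chartForm_eq, hD, hyx, pull_id, hΥ]
  have hdu : extDeriv (chartForm S.Υ x) y = 0 := by rw [← extD_eq, S.closed]
  have hdu' := (S.contDiffAt_upsilonC hy).differentiableAt (by simp)
  have hh : HasFDerivAt (h ∘ (extChartAt (𝓡 7) x).symm)
      (dM h x) y := by
    have := hasFDerivAt_comp_chart_symm (h := h) hy (by rwa [hyx])
    rwa [hD, hyx, ContinuousLinearMap.comp_id] at this
  have hhv : (h ∘ (extChartAt (𝓡 7) x).symm) y = h x := congrArg h hyx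
  have ht := target_mem_nhds' hy
  constructor
  · have e1 : chartForm (S.ansatz h) x =ᶠ[𝓝 y] fun z : E7 => (h ∘ (extChartAt (𝓡 7) x).symm) z •
      covWedge (S.thetaC x z) (extDeriv (fun z : E7 => oneForm (S.thetaC x z)) z)
        + reForm (chartForm S.Υ x z) := by
      filter_upwards [ht] with z hz
      exact S.chartForm_ansatz h hz
    rw [extD_eq, e1.extDeriv_eq, extDeriv_ansatz (S.contDiffAt_thetaC hy) hom hdu' hdu
      hh.differentiableAt, hh.fderiv, hth, hhv]
  -- The formula for *φ needs h ≠ 0 in a neighbourhood; continuity of h at x suffices, and h need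
  -- not be differentiable at other points.
  · have hpos : ∀ᶠ z in 𝓝 y, h ((extChartAt (𝓡 7) x).symm z) ≠ 0 :=
      (hh.continuousAt.eventually_ne (by rw [hhv]; exact hx.ne'))
    have e1 : chartForm (starPhi (S.ansatz h)) x =ᶠ[𝓝 y] fun z : E7 =>
      (2⁻¹ : ℝ) • extDeriv (fun z : E7 => covWedge (S.thetaC x z)
        (extDeriv (fun z : E7 => oneForm (S.thetaC x z)) z)) z -
      (h ∘ (extChartAt (𝓡 7) x).symm) z • covWedge (S.thetaC x z)
        (imForm (chartForm S.Υ x z)) := by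
      filter_upwards [ht, hpos] with z hz hz'
      exact S.chartForm_starPhi hz hz'
    rw [extD_eq, e1.extDeriv_eq, extDeriv_psi (S.contDiffAt_thetaC hy) hth hom hdu' hdu hup
      hh.differentiableAt, hh.fderiv]

theorem mfderiv_log {x : M} (hx : 0 < h x) (hd : MDifferentiableAt (𝓡 7) 𝓘(ℝ, ℝ) h x) :
    HasMFDerivAt (𝓡 7) 𝓘(ℝ, ℝ) (fun y => Real.log (h y)) x
      ((h x)⁻¹ • (dM h x)) := by
  have h1 := (Real.hasDerivAt_log hx.ne').hasFDerivAt.hasMFDerivAt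
  have := h1.comp x hd.hasMFDerivAt
  refine this.congr_mfderiv ?_
  ext v
  exact mul_comm (dM h x v) (h x)⁻¹

/-- The pointwise comparison of `|d^*φ|`, `|d ln h|` and the torsion. -/
theorem exists_pointwise_bounds (hS : S.CompactReebOrbits) (h_inv : S.ReebInvariant h) :
    ∃ K > 0, ∀ x, 0 < h x → MDifferentiableAt (𝓡 7) 𝓘(ℝ, ℝ) h x →
      dLogNorm (S.ansatz h) h x ≤ K * codiffNorm (S.ansatz h) x ∧
      codiffNorm (S.ansatz h) x ≤ K * dLogNorm (S.ansatz h) h x ∧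
      torsionNorm (S.ansatz h) x ≤ K * (dLogNorm (S.ansatz h) h x + h x) := by
  obtain ⟨K₁, hK₁, h₁⟩ := exists_abs_covWedge_le thetaIm0
  obtain ⟨K₂, hK₂, h₂⟩ := exists_abs_covWedge_le (covWedge (cov 0) omega0)
  have hn := norm0_nonneg (omegaWedge omega0)
  -- Constants of the three comparisons: powers of 7 count multi-indices, and 120, 2, 24 are the
  -- factorials of the degrees 5, 2, 4.
  set A : ℝ := 7 * 120 * (7 ^ 5 * 2) with hA
  set B : ℝ := 7 ^ 2 * (120 * (7 ^ 5 * K₁)) with hB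
  set C : ℝ := 7 ^ 4 * (24 * (7 ^ 4 * K₂ + norm0 (omegaWedge omega0))) with hC
  have hA0 : 0 < A := by positivity
  have hB0 : 0 ≤ B := by positivity
  have hC0 : 0 ≤ C := by positivity
  refine ⟨A + B + C, by positivity, fun x hx hd => ?_⟩
  obtain ⟨L, hθ, hω, hΥ⟩ := S.frame x
  obtain ⟨e1, e2⟩ := S.extD_ansatz hx hd hθ hω hΥ
  have hφ := S.ansatz_eq_pull (h := h) hθ hω hΥ
  set a : E7 →L[ℝ] ℝ := (h x)⁻¹ • (dM h x) with ha
  have hda : (dM h x) = h x • a := by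
    rw [ha, smul_smul, mul_inv_cancel₀ hx.ne', one_smul]
  have hlog : dLogNorm (S.ansatz h) h x = formNorm (S.ansatz h x) (oneForm a) := by
    rw [dLogNorm, (mfderiv_log hx hd).mfderiv]
  rw [hda] at e1 e2
  rw [formNorm_oneForm hx.ne' hφ] at hlog
  -- η is d ln h in a frame that is orthonormal for φ; the torsion norms below are all expressed
  -- through it.
  set η := a.comp ((L.symm : E7 →L[ℝ] E7).comp (scaleMap (h x)⁻¹)) with hη
  have f1 : formNorm (S.ansatz h x) (extD (S.ansatz h) x) =
      norm0 (covWedge η (covWedge (cov 0) omega0) + h x • omegaWedge omega0) := by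
    rw [e1, formNorm_extD_ansatz hx.ne' hφ]
  have f2 : formNorm (S.ansatz h x) (extD (starPhi (S.ansatz h)) x) =
      norm0 (covWedge η thetaIm0) := by
    rw [e2, formNorm_covWedge_thetaIm0 hx.ne' hφ]
  -- Invariance of h along the orbits enters here: without it the wedge with e⁰ ∧ Im Υ₀ would lose
  -- the e⁰ component of η.
  have hη0 : η (vec 0) = 0 := by
    have h1 : scaleMap (h x)⁻¹ (vec 0) = (h x)⁻¹ • vec 0 := by
      ext i
      fin_cases i <;> simp [scaleMap, vec, cov]
    have h2 : L.symm (vec 0) = S.xi x := by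
      rw [← S.frame_reeb hθ hω, L.symm_apply_apply]
    change a (L.symm (scaleMap (h x)⁻¹ (vec 0))) = 0
    rw [h1, map_smul, h2, map_smul, ha]
    have := S.mfderiv_reeb hS h_inv hd
    rw [_root_.smul_apply, this, smul_zero, smul_zero]
  have f3 := codiffNorm_eq (S.ansatz h) x
  have f4 : norm0 (pull (extD (starPhi (S.ansatz h)) x)
        ((g2Frame (S.ansatz h x)).symm : E7 →L[ℝ] E7)) = norm0 (covWedge η thetaIm0) := f2
  have f5 := norm0_star0_le (show 5 + 2 = 7 by norm_num) (pull (extD (starPhi (S.ansatz h)) x)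
        ((g2Frame (S.ansatz h x)).symm : E7 →L[ℝ] E7))
  have f6 := norm0_le_star0 (show 5 + 2 = 7 by norm_num) (pull (extD (starPhi (S.ansatz h)) x)
        ((g2Frame (S.ansatz h x)).symm : E7 →L[ℝ] E7))
  rw [← f3] at f5 f6
  rw [f4] at f5 f6
  have h5 : ((Nat.factorial 5 : ℕ) : ℝ) = 120 := by norm_num [Nat.factorial]
  have h2 : ((Nat.factorial 2 : ℕ) : ℝ) = 2 := by norm_num [Nat.factorial]
  have h4 : ((Nat.factorial 4 : ℕ) : ℝ) = 24 := by norm_num [Nat.factorial]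
  rw [h5] at f5
  rw [h2] at f6
  have hηn : 0 ≤ ‖η‖ := norm_nonneg η
  have g1 : ‖η‖ ≤ 7 ^ 1 * (120 * norm0 (covWedge η thetaIm0)) := by
    rw [← norm0_oneForm]
    refine norm0_le_of_forall _ (by have := norm0_nonneg (covWedge η thetaIm0); positivity)
      fun i => ?_
    exact abs_le_norm0_covWedge_thetaIm0 η hη0 (i 0)
  have g2 : norm0 (covWedge η thetaIm0) ≤ 7 ^ 5 * (K₁ * ‖η‖) :=
    norm0_le_of_forall _ (by positivity) (h₁ η)
  have g3 : norm0 (covWedge η (covWedge (cov 0) omega0)) ≤ 7 ^ 4 * (K₂ * ‖η‖) :=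
    norm0_le_of_forall _ (by positivity) (h₂ η)
  have g4 := norm0_add_le (covWedge η (covWedge (cov 0) omega0)) (h x • omegaWedge omega0)
  rw [← f1, h4, norm0_smul _ hx.le] at g4
  have cn : 0 ≤ codiffNorm (S.ansatz h) x := norm0_nonneg _
  have fn : 0 ≤ formNorm (S.ansatz h x) (extD (S.ansatz h) x) := norm0_nonneg _
  have r1 : ‖η‖ ≤ A * codiffNorm (S.ansatz h) x := by rw [hA]; linarith
  have r2 : codiffNorm (S.ansatz h) x ≤ B * ‖η‖ := by rw [hB]; linarith
  have r3 : formNorm (S.ansatz h x) (extD (S.ansatz h) x) ≤ C * (‖η‖ + h x) := by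
    rw [hC]
    have p1 := mul_nonneg hK₂ hx.le
    have p2 := mul_nonneg hn hηn
    have p3 : norm0 (covWedge η (covWedge (cov 0) omega0)) + h x * norm0 (omegaWedge omega0) ≤
        (7 ^ 4 * K₂ + norm0 (omegaWedge omega0)) * (‖η‖ + h x) := by
      rw [add_mul, mul_add, mul_add]
      linarith
    refine g4.trans ?_
    rw [mul_assoc, mul_assoc]
    gcongr
  have r4 : torsionNorm (S.ansatz h) x ≤ formNorm (S.ansatz h x) (extD (S.ansatz h) x)
      + codiffNorm (S.ansatz h) x := by
    refine Real.sqrt_le_iff.2 ⟨by positivity, ?_⟩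
    nlinarith
  rw [hlog]
  refine ⟨?_, ?_, ?_⟩
  · have := mul_nonneg (add_nonneg hB0 hC0) cn
    linarith
  · have := mul_nonneg (add_nonneg hA0.le hC0) hηn
    linarith
  · have p1 := mul_nonneg hA0.le hηn
    have p2 := mul_nonneg (add_nonneg hA0.le hB0) hx.le
    linarith

end ContactCalabiYau

end ContactG2

/-! ### In a chart the metric is comparable to the Euclidean one. -/

namespace ContactG2

section Metric

open Matrix

/-- The matrix of the bilinear form `β + a ⊗ a`. -/
def twoMatrix (β : E7 [⋀^Fin 2]→L[ℝ] ℝ) (a : E7 →L[ℝ] ℝ) : Matrix (Fin 7) (Fin 7) ℝ :=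
  Matrix.of fun i j => β ![vec i, vec j] + a (vec i) * a (vec j)

/-- The matrix of `ω₀ + e⁰ ⊗ e⁰`. -/
def omegaMatrix : Matrix (Fin 7) (Fin 7) ℝ :=
  !![1, 0, 0, 0, 0, 0, 0;
     0, 0, 1, 0, 0, 0, 0;
     0, -1, 0, 0, 0, 0, 0;
     0, 0, 0, 0, 1, 0, 0;
     0, 0, 0, -1, 0, 0, 0;
     0, 0, 0, 0, 0, 0, 1;
     0, 0, 0, 0, 0, -1, 0]

theorem det_omegaMatrix_sq : omegaMatrix.det ^ 2 = 1 := by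
  have h : omegaMatrix * omegaMatrixᵀ = 1 := by
    ext i j
    fin_cases i <;> fin_cases j <;>
      simp [omegaMatrix, Matrix.mul_apply, Fin.sum_univ_succ, Fin.succ]
  rw [sq]
  nth_rw 2 [← Matrix.det_transpose]
  rw [← Matrix.det_mul, h, Matrix.det_one]

theorem omega0_add_apply (u v : E7) :
    omega0 ![u, v] + u 0 * v 0 = u.ofLp ⬝ᵥ omegaMatrix *ᵥ v.ofLp := by
  rw [omega0_eq]
  simp [basisForm_apply, Matrix.det_fin_two, omegaMatrix, dotProduct, Matrix.mulVec,
    Fin.sum_univ_succ, Fin.succ]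
  ring

theorem twoMatrix_pull (A : E7 →L[ℝ] E7) :
    twoMatrix (pull omega0 A) ((cov 0).comp A) = (toMat A)ᵀ * omegaMatrix * toMat A := by
  ext i j
  rw [Matrix.mul_mul_apply]
  have h := omega0_add_apply (A (vec i)) (A (vec j))
  have h2 : pull omega0 A ![vec i, vec j] = omega0 ![A (vec i), A (vec j)] := by
    rw [ContinuousAlternatingMap.compContinuousLinearMap_apply]
    congr 1
    ext a : 1
    fin_cases a <;> rfl
  rw [twoMatrix, Matrix.of_apply, h2]
  exact h

/-- This supplies the factor det⁴ in the determinant formula for the metric. The quotient expresses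
|A u| by the forms alone, so it is continuous although the frames A are not chosen continuously. -/
theorem det_twoMatrix_sq (A : E7 →L[ℝ] E7) :
    (twoMatrix (pull omega0 A) ((cov 0).comp A)).det ^ 2 = (toMat A).det ^ 4 := by
  rw [twoMatrix_pull, Matrix.det_mul, Matrix.det_mul, Matrix.det_transpose, mul_pow, mul_pow,
    det_omegaMatrix_sq]
  ring

theorem det_toMat_ne_zero (A : E7 ≃L[ℝ] E7) : (toMat (A : E7 →L[ℝ] E7)).det ≠ 0 := by
  intro h
  have h1 := toMat_comp (A : E7 →L[ℝ] E7) (A.symm : E7 →L[ℝ] E7)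
  rw [comp_symm_self, toMat_id] at h1
  have h2 := congrArg Matrix.det h1
  rw [Matrix.det_mul, h, zero_mul, Matrix.det_one] at h2
  exact one_ne_zero h2

/-- The metric of the structure as a continuous function of its forms. -/
def metricPow (φ : E7 [⋀^Fin 3]→L[ℝ] ℝ) (τ : E7 [⋀^Fin 2]→L[ℝ] ℝ) (θ : E7 →L[ℝ] ℝ) (u : E7) : ℝ :=
  (sliceMatrix φ u + vecMulVec u.ofLp u.ofLp).det ^ 2 / (twoMatrix τ θ).det ^ 2

theorem metricPow_eq (A : E7 ≃L[ℝ] E7) {u : E7} (hu : u ≠ 0) :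
    metricPow (pull phi0 (A : E7 →L[ℝ] E7)) (pull omega0 (A : E7 →L[ℝ] E7))
      ((cov 0).comp (A : E7 →L[ℝ] E7)) u = ‖A u‖ ^ 8 * ‖u‖ ^ 8 := by
  rw [metricPow, det_slice_pull_phi0_sq A u hu, det_twoMatrix_sq]
  have := det_toMat_ne_zero A
  field_simp

theorem continuousAt_det {X : Type*} [TopologicalSpace X] {x : X}
    {f : X → Matrix (Fin 7) (Fin 7) ℝ} (hf : ContinuousAt f x) :
    ContinuousAt (fun z => (f z).det) x := by
  simp only [Matrix.det_apply]
  refine tendsto_finsetSum _ fun s _ => Filter.Tendsto.const_smul ?_ _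
  exact tendsto_finsetProd _ fun i _ =>
    continuousAt_pi.1 (continuousAt_pi.1 hf (s i)) i

theorem continuousAt_metricPow {X : Type*} [TopologicalSpace X] {x : X}
    {φ : X → E7 [⋀^Fin 3]→L[ℝ] ℝ} {τ : X → E7 [⋀^Fin 2]→L[ℝ] ℝ} {θ : X → E7 →L[ℝ] ℝ} {u : X → E7}
    (hφ : ContinuousAt φ x) (hω : ContinuousAt τ x) (hθ : ContinuousAt θ x)
    (hu : ContinuousAt u x) (h0 : (twoMatrix (τ x) (θ x)).det ≠ 0) :
    ContinuousAt (fun z => metricPow (φ z) (τ z) (θ z) (u z)) x := by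
  have h1 : ContinuousAt (fun z => sliceMatrix (φ z) (u z)
      + vecMulVec (u z).ofLp (u z).ofLp) x := by
    refine continuousAt_pi.2 fun i => continuousAt_pi.2 fun j => ?_
    refine ContinuousAt.add ?_ ?_
    · refine ContinuousAt.eval hφ ?_
      refine continuousAt_pi.2 fun a => ?_
      fin_cases a
      · exact hu
      · exact continuousAt_const
      · exact continuousAt_const
    · have hi : ∀ i, ContinuousAt (fun z => (u z).ofLp i) x := fun i =>
        (EuclideanSpace.proj i : E7 →L[ℝ] ℝ).continuous.continuousAt.comp hu
      exact (hi i).mul (hi j)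
  have h2 : ContinuousAt (fun z => twoMatrix (τ z) (θ z)) x := by
    refine continuousAt_pi.2 fun i => continuousAt_pi.2 fun j => ?_
    have h3 : ∀ i, ContinuousAt (fun z => θ z (vec i)) x := fun i =>
      hθ.clm_apply continuousAt_const
    refine ContinuousAt.add ?_ ((h3 i).mul (h3 j))
    exact hω.eval_const ![vec i, vec j]
  have e1 := continuousAt_det h1
  have e2 := continuousAt_det h2
  unfold metricPow
  exact ContinuousAt.div₀ (e1.pow 2) (e2.pow 2) (pow_ne_zero 2 h0)

end Metric

namespace ContactCalabiYau

variable {M : Type*} [TopologicalSpace M] [ChartedSpace E7 M] [IsManifold (𝓡 7) ∞ M]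
  (S : ContactCalabiYau M)

/-- The 3-form of the ansatz with `h = 1`. -/
abbrev phiOne : M → E7 [⋀^Fin 3]→L[ℝ] ℝ := S.ansatz fun _ => 1

theorem phiOne_eq_pull {x : M} {L : E7 ≃L[ℝ] E7}
    (hθ : S.θ x = (cov 0).comp (L : E7 →L[ℝ] E7))
    (hω : S.omega x = pull omega0 (L : E7 →L[ℝ] E7))
    (hΥ : S.Υ x = upsilon0.compContinuousLinearMap (L : E7 →L[ℝ] E7)) :
    S.phiOne x = pull phi0 (L : E7 →L[ℝ] E7) := by
  have h := S.ansatz_eq_pull (h := fun _ => 1) hθ hω hΥ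
  have h1 : scaleMap 1 = ContinuousLinearMap.id ℝ E7 := by
    ext1 v
    simp [scaleMap]
  rwa [h1, ContinuousLinearMap.id_comp] at h

theorem continuousAt_chartForm_phiOne {x₀ : M} {y : E7} (hy : y ∈ (extChartAt (𝓡 7) x₀).target) :
    ContinuousAt (chartForm S.phiOne x₀) y := by
  have h1 : chartForm S.phiOne x₀ =ᶠ[𝓝 y] fun z =>
      covWedge (S.thetaC x₀ z) (extDeriv (fun z => oneForm (S.thetaC x₀ z)) z)
        + reForm (chartForm S.Υ x₀ z) := by
    filter_upwards [target_mem_nhds' hy] with z hz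
    rw [S.chartForm_ansatz _ hz, one_smul]
  refine ContinuousAt.congr ?_ h1.symm
  refine ContinuousAt.add ?_ ?_
  · exact (contDiffAt_covWedge (contDiffAt_oneForm_iff.1 (S.contDiffAt_thetaC hy))
      (contDiffAt_extDeriv (S.contDiffAt_thetaC hy))).continuousAt
  · exact (differentiableAt_clm_comp Complex.reCLM
      ((S.contDiffAt_upsilonC hy).differentiableAt (by simp))).continuousAt

/-- Near a point of a chart the metric is comparable to the Euclidean one. -/
theorem exists_metric_bounds (x₀ : M) :
    ∃ c > 0, ∃ C > 0, ∀ᶠ y in 𝓝 (extChartAt (𝓡 7) x₀ x₀), ∀ u : E7,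
      c * ‖u‖ ≤ vecNorm (S.phiOne ((extChartAt (𝓡 7) x₀).symm y)) (chartD x₀ y u) ∧
      vecNorm (S.phiOne ((extChartAt (𝓡 7) x₀).symm y)) (chartD x₀ y u) ≤ C * ‖u‖ := by
  set y₀ : E7 := extChartAt (𝓡 7) x₀ x₀ with hy₀
  have hy : y₀ ∈ (extChartAt (𝓡 7) x₀).target := mem_extChartAt_target x₀
  have key : ∀ y ∈ (extChartAt (𝓡 7) x₀).target, ∃ A : E7 ≃L[ℝ] E7,
      (twoMatrix (extDeriv (fun z => oneForm (S.thetaC x₀ z)) y) (S.thetaC x₀ y)).det ≠ 0 ∧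
      (∀ u, vecNorm (S.phiOne ((extChartAt (𝓡 7) x₀).symm y)) (chartD x₀ y u) = ‖A u‖) ∧
      ∀ u, u ≠ 0 → metricPow (chartForm S.phiOne x₀ y)
        (extDeriv (fun z => oneForm (S.thetaC x₀ z)) y) (S.thetaC x₀ y) u = ‖A u‖ ^ 8 * ‖u‖ ^ 8 := by
    intro y hy
    obtain ⟨L, h1, h2, h3, h4, h5, h6⟩ := S.exists_frame_chart hy
    have hφ := S.phiOne_eq_pull h1 h2 h3
    refine ⟨(chartDEquiv hy).trans L, ?_, fun u => vecNorm_eq hφ _, fun u hu => ?_⟩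
    · have := det_twoMatrix_sq ((L : E7 →L[ℝ] E7).comp (chartD x₀ y))
      rw [← h4] at this
      intro h0
      have h7 : extDeriv (fun z => oneForm (S.thetaC x₀ z)) y =
        pull omega0 ((L : E7 →L[ℝ] E7).comp (chartD x₀ y)) := h5
      rw [h7, thetaC] at h0
      rw [h0] at this
      have h8 := det_toMat_ne_zero ((chartDEquiv hy).trans L)
      exact pow_ne_zero 4 h8 (by rw [← zero_pow (two_ne_zero), this]; rfl)
    · rw [← metricPow_eq ((chartDEquiv hy).trans L) hu]
      congr 1
      rw [chartForm_eq, hφ]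
      rfl
  obtain ⟨A₀, hd₀, hA₀, hm₀⟩ := key y₀ hy
  set c₀ : ℝ := (‖(A₀.symm : E7 →L[ℝ] E7)‖ + 1)⁻¹ with hc₀
  set C₀ : ℝ := ‖(A₀ : E7 →L[ℝ] E7)‖ + 1 with hC₀
  have hc₀p : 0 < c₀ := by positivity
  have hC₀p : 0 < C₀ := by positivity
  have hlow : ∀ u, ‖u‖ = 1 → c₀ ≤ ‖A₀ u‖ := by
    intro u hu
    have h1 : ‖u‖ ≤ ‖(A₀.symm : E7 →L[ℝ] E7)‖ * ‖A₀ u‖ := by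
      simpa using (A₀.symm : E7 →L[ℝ] E7).le_opNorm (A₀ u)
    rw [hu] at h1
    rw [hc₀, inv_le_iff_one_le_mul₀' (by positivity)]
    nlinarith [norm_nonneg (A₀ u)]
  have hup : ∀ u, ‖u‖ = 1 → ‖A₀ u‖ < C₀ := by
    intro u hu
    have := (A₀ : E7 →L[ℝ] E7).le_opNorm u
    rw [hu, mul_one] at this
    exact this.trans_lt (lt_add_one _)
  -- The bounds hold strictly at y₀ on the unit sphere, where the quotient is |A u|⁸. Joint
  -- continuity and compactness of the sphere extend them to all nearby y; homogeneity then covers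
  -- every vector.
  have hev : ∀ᶠ y in 𝓝 y₀, ∀ u ∈ Metric.sphere (0 : E7) 1,
      metricPow (chartForm S.phiOne x₀ y)
        (extDeriv (fun z => oneForm (S.thetaC x₀ z)) y) (S.thetaC x₀ y) u ∈
        Set.Ioo ((c₀ / 2) ^ 8) (C₀ ^ 8) := by
    refine (isCompact_sphere (0 : E7) 1).eventually_forall_of_forall_eventually fun u hu => ?_
    have hu1 : ‖u‖ = 1 := by simpa using hu
    have hu0 : u ≠ 0 := by rintro rfl; simp at hu1
    have hc : ContinuousAt (fun z : E7 × E7 => metricPow (chartForm S.phiOne x₀ z.1)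
        (extDeriv (fun z => oneForm (S.thetaC x₀ z)) z.1) (S.thetaC x₀ z.1) z.2) (y₀, u) :=
      continuousAt_metricPow
        (ContinuousAt.comp (g := chartForm S.phiOne x₀) (f := Prod.fst)
          (S.continuousAt_chartForm_phiOne hy) continuousAt_fst)
        (ContinuousAt.comp (g := extDeriv fun z => oneForm (S.thetaC x₀ z)) (f := Prod.fst)
          (contDiffAt_extDeriv (S.contDiffAt_thetaC hy)).continuousAt continuousAt_fst)
        (ContinuousAt.comp (g := S.thetaC x₀) (f := Prod.fst)
          (contDiffAt_oneForm_iff.1 (S.contDiffAt_thetaC hy)).continuousAt continuousAt_fst)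
        continuousAt_snd hd₀
    refine hc.eventually (Ioo_mem_nhds ?_ ?_)
    · dsimp only
      rw [hm₀ u hu0, hu1, one_pow, mul_one]
      have := hlow u hu1
      exact pow_lt_pow_left₀ (by linarith) (by positivity) (by norm_num)
    · dsimp only
      rw [hm₀ u hu0, hu1, one_pow, mul_one]
      exact pow_lt_pow_left₀ (hup u hu1) (norm_nonneg _) (by norm_num)
  refine ⟨c₀ / 2, by positivity, C₀, hC₀p, ?_⟩
  filter_upwards [hev, target_mem_nhds' hy] with y hy1 hy2 u
  obtain ⟨A, -, hA, hm⟩ := key y hy2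
  rw [hA]
  rcases eq_or_ne u 0 with rfl | hu
  · simp
  have hun : 0 < ‖u‖ := norm_pos_iff.2 hu
  set w : E7 := ‖u‖⁻¹ • u with hw
  have hw1 : ‖w‖ = 1 := by rw [hw, norm_smul, norm_inv, norm_norm, inv_mul_cancel₀ hun.ne']
  have hw0 : w ≠ 0 := by rintro h; rw [h, norm_zero] at hw1; exact zero_ne_one hw1
  have h1 := hy1 w (by simpa using hw1)
  rw [hm w hw0, hw1, one_pow, mul_one] at h1
  have h2 : c₀ / 2 < ‖A w‖ := lt_of_pow_lt_pow_left₀ 8 (norm_nonneg _) h1.1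
  have h3 : ‖A w‖ < C₀ := lt_of_pow_lt_pow_left₀ 8 hC₀p.le h1.2
  have h4 : ‖A u‖ = ‖A w‖ * ‖u‖ := by
    rw [hw, map_smul, norm_smul, norm_inv, norm_norm]
    field_simp
  rw [h4]
  exact ⟨by gcongr, by gcongr⟩

end ContactCalabiYau

end ContactG2

/-! ### The Riemannian distance in a chart. -/

namespace ContactG2

section Distance

open MeasureTheory Set

variable {M : Type*} [TopologicalSpace M] [ChartedSpace E7 M] [IsManifold (𝓡 7) ∞ M]
variable (φ : M → E7 [⋀^Fin 3]→L[ℝ] ℝ)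

/-- The norm of a `G₂`-form on the tangent spaces. -/
@[reducible] def tangentENorm (z : M) : ENorm (TangentSpace (𝓡 7) z) :=
  ⟨fun v => ENNReal.ofReal (vecNorm (φ z) v)⟩

theorem vecNorm_smul (β : E7 [⋀^Fin 3]→L[ℝ] ℝ) (r : ℝ) (v : E7) :
    vecNorm β (r • v) = |r| * vecNorm β v := by
  rw [vecNorm, map_smul, norm_smul, Real.norm_eq_abs, vecNorm]

theorem tangentENorm_smulClass (z : M) :
    @ENormSMulClass ℝ (TangentSpace (𝓡 7) z) _ (tangentENorm φ z) _ :=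
  let := tangentENorm φ z
  ⟨fun r v => by
    have h := vecNorm_smul (φ z) r v
    change ENNReal.ofReal (vecNorm (φ z) (r • v)) = ‖r‖ₑ * ENNReal.ofReal (vecNorm (φ z) v)
    rw [Real.enorm_eq_ofReal_abs, ← ENNReal.ofReal_mul (abs_nonneg r)]
    exact congrArg _ h⟩

theorem g2EDist_triangle (x y z : M) : g2EDist φ x z ≤ g2EDist φ x y + g2EDist φ y z := by
  let := fun z => tangentENorm φ z
  have : ∀ z : M, ENormSMulClass ℝ (TangentSpace (𝓡 7) z) := tangentENorm_smulClass φ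
  have : IsManifold (𝓡 7) 1 M := isManifold_one M
  exact Manifold.riemannianEDist_triangle

theorem g2EDist_comm (x y : M) : g2EDist φ x y = g2EDist φ y x := by
  let := fun z => tangentENorm φ z
  have : ∀ z : M, ENormSMulClass ℝ (TangentSpace (𝓡 7) z) := tangentENorm_smulClass φ
  have : IsManifold (𝓡 7) 1 M := isManifold_one M
  exact Manifold.riemannianEDist_comm

theorem g2EDist_self (x : M) : g2EDist φ x x = 0 := by
  let := fun z => tangentENorm φ z
  have : ∀ z : M, ENormSMulClass ℝ (TangentSpace (𝓡 7) z) := tangentENorm_smulClass φ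
  exact Manifold.riemannianEDist_self

theorem g2EDist_le {γ : ℝ → M} (hγ : ContMDiffOn 𝓘(ℝ, ℝ) (𝓡 7) 1 γ (Icc 0 1)) {g : ℝ → E7}
    (hg : ∀ t ∈ Icc (0 : ℝ) 1, (mfderivWithin 𝓘(ℝ, ℝ) (𝓡 7) γ (Icc 0 1) t : ℝ →L[ℝ] E7) 1 = g t)
    {B : ℝ} (hB : ∀ t ∈ Icc (0 : ℝ) 1, vecNorm (φ (γ t)) (g t) ≤ B) :
    g2EDist φ (γ 0) (γ 1) ≤ ENNReal.ofReal B := by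
  let := fun z => tangentENorm φ z
  have : ∀ z : M, ENormSMulClass ℝ (TangentSpace (𝓡 7) z) := tangentENorm_smulClass φ
  have h1 : g2EDist φ (γ 0) (γ 1) ≤ Manifold.pathELength (𝓡 7) γ 0 1 :=
    Manifold.riemannianEDist_le_pathELength hγ rfl rfl zero_le_one
  refine h1.trans ?_
  rw [Manifold.pathELength_eq_lintegral_mfderivWithin_Icc]
  have h2 : ∫⁻ _ in Icc (0 : ℝ) 1, ENNReal.ofReal B = ENNReal.ofReal B := by simp
  rw [← h2]
  refine setLIntegral_mono' measurableSet_Icc fun t ht => ?_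
  change ENNReal.ofReal (vecNorm (φ (γ t))
    ((mfderivWithin 𝓘(ℝ, ℝ) (𝓡 7) γ (Icc 0 1) t : ℝ →L[ℝ] E7) 1)) ≤ _
  rw [hg t ht]
  exact ENNReal.ofReal_le_ofReal (hB t ht)

/-- The length bound is recorded for every initial piece of the path, as needed to follow the path
until it might leave a chart. -/
theorem exists_path_of_g2EDist_lt {x y : M} {r : ℝ≥0∞} (h : g2EDist φ x y < r) :
    ∃ γ : ℝ → M, γ 0 = x ∧ γ 1 = y ∧ ContMDiff 𝓘(ℝ, ℝ) (𝓡 7) 1 γ ∧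
      ∀ t ∈ Icc (0 : ℝ) 1, ∫⁻ s in Icc 0 t, ENNReal.ofReal (vecNorm (φ (γ s))
        ((mfderivWithin 𝓘(ℝ, ℝ) (𝓡 7) γ (Icc 0 t) s : ℝ →L[ℝ] E7) 1)) < r := by
  let := fun z => tangentENorm φ z
  have : ∀ z : M, ENormSMulClass ℝ (TangentSpace (𝓡 7) z) := tangentENorm_smulClass φ
  obtain ⟨γ, h0, h1, hγ, hl, -⟩ :=
    Manifold.exists_lt_locally_constant_of_riemannianEDist_lt h zero_lt_one
  refine ⟨γ, h0, h1, hγ, fun t ht => ?_⟩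
  have h2 : Manifold.pathELength (𝓡 7) γ 0 t < r :=
    (Manifold.pathELength_mono le_rfl ht.2).trans_lt hl
  rwa [Manifold.pathELength_eq_lintegral_mfderivWithin_Icc] at h2

variable {φ} {x₀ : M} {ρ c C : ℝ}

/-- The distance is at most a multiple of the distance in a chart. -/
theorem g2EDist_chart_le {y₀ : E7} (hρ : Metric.ball y₀ ρ ⊆ (extChartAt (𝓡 7) x₀).target)
    (hC : ∀ y ∈ Metric.ball y₀ ρ, ∀ u : E7,
      vecNorm (φ ((extChartAt (𝓡 7) x₀).symm y)) (chartD x₀ y u) ≤ C * ‖u‖)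
    {y y' : E7} (hy : y ∈ Metric.ball y₀ ρ) (hy' : y' ∈ Metric.ball y₀ ρ) :
    g2EDist φ ((extChartAt (𝓡 7) x₀).symm y) ((extChartAt (𝓡 7) x₀).symm y') ≤
      ENNReal.ofReal (C * ‖y' - y‖) := by
  -- The competitor is the straight segment, which stays in the ball by convexity.
  set η : ℝ → E7 := fun t => y + t • (y' - y) with hη
  have hηd : ∀ t, HasDerivAt η (y' - y) t := fun t => by
    have h := ((hasDerivAt_id t).smul_const (y' - y)).const_add y
    rw [one_smul] at h
    exact h
  have hηs : ContDiff ℝ 1 η := by fun_prop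
  have hmem : ∀ t ∈ Icc (0 : ℝ) 1, η t ∈ Metric.ball y₀ ρ := fun t ht =>
    (convex_ball y₀ ρ).add_smul_sub_mem hy hy' ht
  have h0 : η 0 = y := by simp [hη]
  have h1 : η 1 = y' := by simp [hη]
  have hγ : ContMDiffOn 𝓘(ℝ, ℝ) (𝓡 7) 1 ((extChartAt (𝓡 7) x₀).symm ∘ η) (Icc 0 1) := by
    have : IsManifold (𝓡 7) 1 M := isManifold_one M
    exact (contMDiffOn_extChartAt_symm x₀).comp hηs.contMDiff.contMDiffOn
      fun t ht => hρ (hmem t ht)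
  have := g2EDist_le φ hγ (g := fun t => chartD x₀ (η t) (y' - y)) (B := C * ‖y' - y‖)
    (fun t ht => ?_) (fun t ht => hC _ (hmem t ht) _)
  · simpa only [Function.comp_apply, h0, h1] using this
  · have h2 := (mdifferentiableAt_chart_symm (hρ (hmem t ht))).hasMFDerivAt
    have h3 : HasMFDerivAt 𝓘(ℝ, ℝ) 𝓘(ℝ, E7) η t
      (ContinuousLinearMap.toSpanSingleton ℝ (y' - y)) := (hηd t).hasFDerivAt.hasMFDerivAt
    have h4 := (h2.comp t h3).hasMFDerivWithinAt (s := Icc 0 1)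
    rw [h4.mfderivWithin
      (uniqueMDiffWithinAt_iff_uniqueDiffWithinAt.2 (uniqueDiffOn_Icc zero_lt_one t ht))]
    change chartD x₀ (η t) ((1 : ℝ) • (y' - y)) = _
    rw [one_smul]

/-- A short path starting in a chart stays in the chart. -/
theorem g2EDist_chart_ge [T2Space M] {y₀ : E7} (hρ : Metric.ball y₀ ρ ⊆ (extChartAt (𝓡 7) x₀).target)
    (hc0 : 0 < c) (hc : ∀ y ∈ Metric.ball y₀ ρ, ∀ u : E7,
      c * ‖u‖ ≤ vecNorm (φ ((extChartAt (𝓡 7) x₀).symm y)) (chartD x₀ y u))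
    {y : E7} {δ : ℝ} (hδ : 0 < δ) (hy : Metric.closedBall y δ ⊆ Metric.ball y₀ ρ) {z : M}
    (hz : g2EDist φ ((extChartAt (𝓡 7) x₀).symm y) z < ENNReal.ofReal (c * δ)) :
    z ∈ (extChartAt (𝓡 7) x₀).source ∧ ‖extChartAt (𝓡 7) x₀ z - y‖ ≤ δ := by
  have : IsManifold (𝓡 7) 1 M := isManifold_one M
  set ψ := extChartAt (𝓡 7) x₀ with hψ
  obtain ⟨γ, hγ0, hγ1, hγ, hl⟩ := exists_path_of_g2EDist_lt φ hz
  set u : Set M := ψ.symm '' Metric.closedBall y δ with hu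
  have hut : Metric.closedBall y δ ⊆ ψ.target := hy.trans hρ
  -- The image of a compact ball is closed because M is Hausdorff. This is the closedness needed for
  -- the continuation argument in t.
  have hu_closed : IsClosed u :=
    ((isCompact_closedBall y δ).image_of_continuousOn fun w hw =>
      (continuousAt_chart_symm (hut hw)).continuousWithinAt).isClosed
  have hu_mem : ∀ x ∈ u, x ∈ ψ.source ∧ ψ x ∈ Metric.closedBall y δ := by
    rintro x ⟨w, hw, rfl⟩
    exact ⟨ψ.map_target (hut hw), by rwa [ψ.right_inv (hut hw)]⟩
  suffices Icc (0 : ℝ) 1 ⊆ γ ⁻¹' u by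
    have h1 := hu_mem _ (this (right_mem_Icc.2 zero_le_one))
    rw [hγ1] at h1
    exact ⟨h1.1, by simpa [dist_eq_norm] using h1.2⟩
  have hclosed : IsClosed (γ ⁻¹' u ∩ Icc 0 1) :=
    (hu_closed.preimage hγ.continuous).inter isClosed_Icc
  have hzero : (0 : ℝ) ∈ γ ⁻¹' u := by
    rw [mem_preimage, hγ0]
    exact mem_image_of_mem _ (Metric.mem_closedBall_self hδ.le)
  refine hclosed.Icc_subset_of_forall_mem_nhdsGT_of_Icc_subset hzero ?_
  rintro t₁ ⟨ht₁0, ht₁1⟩ ht₁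
  have hsrc : ∀ t ∈ Icc 0 t₁, γ t ∈ ψ.source := fun t ht => (hu_mem _ (ht₁ ht)).1
  have hsm : ContDiffOn ℝ 1 (ψ ∘ γ) (Icc 0 t₁) := by
    rw [← contMDiffOn_iff_contDiffOn]
    exact contMDiffOn_extChartAt.comp (I' := 𝓡 7) hγ.contMDiffOn
      fun t ht => by rw [← extChartAt_source (𝓡 7)]; exact hsrc t ht
  -- As long as the path has stayed in the ball, its Euclidean displacement is at most c⁻¹ times its
  -- length, hence strictly below δ. The strict inequality lets the path continue inside a little
  -- further.
  have hdist : ‖(ψ ∘ γ) t₁ - (ψ ∘ γ) 0‖ < δ := by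
    rcases ht₁0.eq_or_lt with rfl | ht₁p
    · simpa using hδ
    have h1 := enorm_sub_le_lintegral_derivWithin_Icc_of_contDiffOn_Icc hsm ht₁0
    have h2 : ∫⁻ t in Icc 0 t₁, ‖derivWithin (ψ ∘ γ) (Icc 0 t₁) t‖ₑ ≤
        ∫⁻ t in Icc 0 t₁, ENNReal.ofReal c⁻¹ * ENNReal.ofReal (vecNorm (φ (γ t))
        ((mfderivWithin 𝓘(ℝ, ℝ) (𝓡 7) γ (Icc 0 t₁) t : ℝ →L[ℝ] E7) 1)) := by
      refine setLIntegral_mono' measurableSet_Icc fun t ht => ?_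
      have hun := uniqueDiffOn_Icc ht₁p t ht
      set v : E7 := (mfderivWithin 𝓘(ℝ, ℝ) (𝓡 7) γ (Icc 0 t₁) t : ℝ →L[ℝ] E7) 1 with hv
      have h3 := ((hγ.mdifferentiable one_ne_zero) t).mdifferentiableWithinAt (s := Icc 0 t₁)
        |>.hasMFDerivWithinAt
      have h4 := (mdifferentiableAt_extChartAt (I := 𝓡 7) (x := x₀) (y := γ t)
        (by rw [← extChartAt_source (𝓡 7)]; exact hsrc t ht)).hasMFDerivAt
      have h5 : HasFDerivWithinAt (ψ ∘ γ) ((chartDInv x₀ (γ t)).comp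
          (mfderivWithin 𝓘(ℝ, ℝ) (𝓡 7) γ (Icc 0 t₁) t : ℝ →L[ℝ] E7)) (Icc 0 t₁) t :=
        (h4.comp_hasMFDerivWithinAt t h3).hasFDerivWithinAt
      have h6 : derivWithin (ψ ∘ γ) (Icc 0 t₁) t = chartDInv x₀ (γ t) v := h5.hasDerivWithinAt.derivWithin hun
      have h7 := hu_mem _ (ht₁ ht)
      have h8 : ψ.symm (ψ (γ t)) = γ t := ψ.left_inv h7.1
      have h9 := hc _ (hy h7.2) (chartDInv x₀ (γ t) v)
      have h10 := chartD_comp_mfderiv_chart (hut h7.2)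
      rw [h8] at h9
      rw [← hψ, h8] at h10
      have h11 : chartD x₀ (ψ (γ t)) (chartDInv x₀ (γ t) v) = v := DFunLike.congr_fun h10 v
      rw [h11] at h9
      rw [h6, ← ENNReal.ofReal_mul (by positivity), ← ofReal_norm]
      refine ENNReal.ofReal_le_ofReal ?_
      rw [inv_mul_eq_div, le_div_iff₀' hc0]
      exact h9
    have h3 := h1.trans h2
    rw [lintegral_const_mul' _ _ ENNReal.ofReal_ne_top] at h3
    have h4 := hl t₁ ⟨ht₁0, ht₁1.le⟩
    have h5 : ‖(ψ ∘ γ) t₁ - (ψ ∘ γ) 0‖ₑ < ENNReal.ofReal δ := by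
      refine h3.trans_lt ?_
      have h6 : ENNReal.ofReal δ = ENNReal.ofReal c⁻¹ * ENNReal.ofReal (c * δ) := by
        rw [← ENNReal.ofReal_mul (by positivity), ← mul_assoc, inv_mul_cancel₀ hc0.ne', one_mul]
      rw [h6]
      exact (ENNReal.mul_lt_mul_iff_right (by simpa using hc0) ENNReal.ofReal_ne_top).2 h4
    rw [← ofReal_norm] at h5
    exact (ENNReal.ofReal_lt_ofReal_iff hδ).1 h5
  have hv0 : (ψ ∘ γ) 0 = y := by
    rw [Function.comp_apply, hγ0, ψ.right_inv (hut (Metric.mem_closedBall_self hδ.le))]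
  rw [hv0] at hdist
  have hs1 : γ t₁ ∈ ψ.source := hsrc t₁ (right_mem_Icc.2 ht₁0)
  have hnear : ∀ᶠ x in 𝓝 (γ t₁), x ∈ u := by
    have e1 : ∀ᶠ x in 𝓝 (γ t₁), ψ x ∈ Metric.ball y δ :=
      (continuousAt_extChartAt' hs1).eventually (Metric.isOpen_ball.mem_nhds
        (by rw [Metric.mem_ball, dist_eq_norm]; exact hdist))
    filter_upwards [e1, extChartAt_source_mem_nhds' hs1] with x hx1 hx2
    exact ⟨ψ x, Metric.ball_subset_closedBall hx1, ψ.left_inv hx2⟩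
  exact nhdsWithin_le_nhds (hγ.continuous.continuousAt.eventually hnear)

end Distance

end ContactG2

/-! ### The distance to the Reeb orbit near p. -/

namespace ContactG2

open Set

/-- Secants of a curve with nonzero velocity are nearly parallel to the velocity, which l
annihilates. -/
theorem eventually_abs_le_of_hasDerivAt {f : ℝ → E7} {f' : E7} {τ ε : ℝ} (hf : HasDerivAt f f' τ)
    (h0 : f' ≠ 0) (l : E7 →L[ℝ] ℝ) (hl : l f' = 0) (hε : 0 < ε) :
    ∀ᶠ t in 𝓝 τ, |l (f t - f τ)| ≤ ε * ‖f t - f τ‖ := by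
  have hn : 0 < ‖f'‖ := norm_pos_iff.2 h0
  -- Solves ‖l‖η = ε(‖f'‖ − η): the left side bounds l of the displacement per unit time, and ‖f'‖ −
  -- η bounds the displacement itself from below.
  set η := ε * ‖f'‖ / (‖l‖ + ε) with hη
  have hlε : 0 < ‖l‖ + ε := by positivity
  have hη0 : 0 < η := by positivity
  have hη1 : ‖l‖ * η = ε * (‖f'‖ - η) := by
    rw [hη]; field_simp; ring
  filter_upwards [hf.isLittleO.def hη0] with t ht
  rw [Real.norm_eq_abs] at ht
  have h1 : l (f t - f τ) = l (f t - f τ - (t - τ) • f') := by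
    rw [map_sub l (f t - f τ), map_smul, hl, smul_zero, sub_zero]
  have h2 : |l (f t - f τ - (t - τ) • f')| ≤ ‖l‖ * (η * |t - τ|) :=
    (l.le_opNorm _).trans (by gcongr)
  have h3 : |t - τ| * ‖f'‖ ≤ ‖f t - f τ‖ + η * |t - τ| := by
    calc |t - τ| * ‖f'‖ = ‖(f t - f τ) - (f t - f τ - (t - τ) • f')‖ := by
          rw [sub_sub_cancel, norm_smul, Real.norm_eq_abs]
      _ ≤ _ := (norm_sub_le _ _).trans (by gcongr)
  rw [h1]
  refine h2.trans ?_
  rw [← mul_assoc, hη1, mul_assoc]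
  gcongr
  linarith

theorem exists_orthogonal (w : E7) : ∃ v : E7, ‖v‖ = 1 ∧ inner ℝ v w = 0 := by
  obtain ⟨u, hu, hw⟩ : ∃ u : E7, u ≠ 0 ∧ inner ℝ u w = 0 := by
    have : Fact (Module.finrank ℝ E7 = 6 + 1) := ⟨by simp⟩
    rcases eq_or_ne w 0 with rfl | hw
    · exact ⟨vec 0, by intro h; simpa [vec] using congrArg (fun u : E7 => u 0) h,
        inner_zero_right _⟩
    have h1 := Submodule.finrank_orthogonal_span_singleton (𝕜 := ℝ) (n := 6) hw
    have h2 : (ℝ ∙ w)ᗮ ≠ ⊥ := by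
      intro h
      rw [h, finrank_bot] at h1
      omega
    obtain ⟨u, hu, hu0⟩ := Submodule.exists_mem_ne_zero_of_ne_bot h2
    exact ⟨u, hu0, by rw [real_inner_comm]; exact Submodule.mem_orthogonal_singleton_iff_inner_right.1 hu⟩
  refine ⟨‖u‖⁻¹ • u, ?_, by rw [inner_smul_left, hw, mul_zero]⟩
  rw [norm_smul, norm_inv, norm_norm, inv_mul_cancel₀ (norm_ne_zero_iff.2 hu)]

namespace ContactCalabiYau

variable {M : Type*} [TopologicalSpace M] [ChartedSpace E7 M] [IsManifold (𝓡 7) ∞ M]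
  (S : ContactCalabiYau M)

theorem xi_ne_zero (x : M) : S.xi x ≠ 0 := by
  intro h
  have h1 := S.θ_ξ x
  change S.θ x (S.xi x) = 1 at h1
  rw [h, map_zero] at h1
  exact zero_ne_one h1

theorem mem_reebOrbit_self (hS : S.CompactReebOrbits) (p : M) : p ∈ S.reebOrbit p := by
  obtain ⟨γ, hγ, h0, -⟩ := hS p
  exact ⟨γ, hγ, h0, 0, h0⟩

theorem hasDerivAt_chart_integralCurve {γ : ℝ → M} (hγ : IsMIntegralCurve γ S.ξ) {p : M} {τ : ℝ}
    (hτ : γ τ = p) : HasDerivAt (extChartAt (𝓡 7) p ∘ γ) (S.xi p) τ := by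
  have : IsManifold (𝓡 7) 1 M := isManifold_one M
  have h1 : HasMFDerivAt (𝓡 7) 𝓘(ℝ, E7) (extChartAt (𝓡 7) p) (γ τ) (chartDInv p (γ τ)) :=
    (mdifferentiableAt_extChartAt (by rw [hτ]; exact mem_chart_source _ _)).hasMFDerivAt
  have h2 : HasFDerivAt (extChartAt (𝓡 7) p ∘ γ)
      ((chartDInv p (γ τ)).comp ((1 : ℝ →L[ℝ] ℝ).smulRight (S.xi (γ τ)))) τ :=
    (h1.comp τ (hγ τ)).hasFDerivAt
  rw [hτ, chartDInv_self] at h2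
  have h3 := h2.hasDerivAt
  simpa using h3

/-- Uniqueness of integral curves makes all parametrisations from p agree, and periodicity leaves a
compact time interval. -/
theorem exists_param_reebOrbit [T2Space M] (hS : S.CompactReebOrbits) (p : M) :
    ∃ γ : ℝ → M, IsMIntegralCurve γ S.ξ ∧ ∃ T, ∀ x ∈ S.reebOrbit p, ∃ t ∈ Icc 0 T, γ t = x := by
  have : IsManifold (𝓡 7) 1 M := isManifold_one M
  obtain ⟨γ, hγ, h0, T, hT, hper⟩ := hS p
  refine ⟨γ, hγ, T, ?_⟩
  rintro x ⟨γ', hγ', h0', t, rfl⟩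
  have h1 : γ' = γ := isMIntegralCurve_Ioo_eq_of_contMDiff_boundaryless (t₀ := 0)
    (S.smooth_ξ.of_le (by norm_cast)) hγ' hγ (h0'.trans h0.symm)
  obtain ⟨s, hs, hst⟩ := hper.exists_mem_Ico₀ hT t
  exact ⟨s, ⟨hs.1, hs.2.le⟩, by rw [h1, ← hst]⟩

/-- Near `p` the Reeb orbit through `p` lies in a thin cone around the Reeb direction. -/
theorem eventually_reebOrbit_cone [T2Space M] (hS : S.CompactReebOrbits) (p : M) (l : E7 →L[ℝ] ℝ)
    (hl : l (S.xi p) = 0) {ε : ℝ} (hε : 0 < ε) :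
    ∀ᶠ q in 𝓝 p, q ∈ S.reebOrbit p → |l (extChartAt (𝓡 7) p q - extChartAt (𝓡 7) p p)| ≤
      ε * ‖extChartAt (𝓡 7) p q - extChartAt (𝓡 7) p p‖ := by
  obtain ⟨γ, hγ, T, hT⟩ := S.exists_param_reebOrbit hS p
  have key : ∀ᶠ q in 𝓝 p, ∀ t ∈ Icc (0 : ℝ) T, γ t = q →
      |l (extChartAt (𝓡 7) p q - extChartAt (𝓡 7) p p)| ≤
      ε * ‖extChartAt (𝓡 7) p q - extChartAt (𝓡 7) p p‖ := by
    -- The parametrisation may meet p at several times. Near each of them the secant estimate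
    -- applies; near any other time the curve stays away from p. Compactness of the time interval
    -- combines these.
    refine isCompact_Icc.eventually_forall_of_forall_eventually fun τ _ => ?_
    by_cases hτ : γ τ = p
    · have h1 := eventually_abs_le_of_hasDerivAt (S.hasDerivAt_chart_integralCurve hγ hτ)
        (S.xi_ne_zero p) l hl hε
      have h2 := (continuousAt_snd (p := (p, τ))).eventually h1
      filter_upwards [h2] with z hz hzt
      rw [← hzt]
      simpa only [Function.comp_apply, hτ] using hz
    · have hne : ∀ᶠ z : M × M in 𝓝 (γ τ, p), z.1 ≠ z.2 :=
        (isClosed_diagonal.isOpen_compl.mem_nhds (x := (γ τ, p)) hτ)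
      have hcont : ContinuousAt (fun z : M × ℝ => (γ z.2, z.1)) (p, τ) :=
        (((hγ τ).continuousAt).comp (x := (p, τ)) (continuousAt_snd (p := (p, τ)))).prodMk continuousAt_fst
      filter_upwards [hcont.eventually hne] with z hz hzt
      exact absurd hzt hz
  filter_upwards [key] with q hq hqO
  obtain ⟨t, ht, htq⟩ := hT q hqO
  exact hq t ht htq

/-- A ball in a chart on which the metric is comparable to the Euclidean one. -/
theorem exists_metric_ball (p : M) : ∃ ρ > 0, ∃ c > 0, ∃ C > 0,
    Metric.ball (extChartAt (𝓡 7) p p) ρ ⊆ (extChartAt (𝓡 7) p).target ∧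
    (∀ y ∈ Metric.ball (extChartAt (𝓡 7) p p) ρ, ∀ u : E7,
      c * ‖u‖ ≤ vecNorm (S.phiOne ((extChartAt (𝓡 7) p).symm y)) (chartD p y u)) ∧
    (∀ y ∈ Metric.ball (extChartAt (𝓡 7) p p) ρ, ∀ u : E7,
      vecNorm (S.phiOne ((extChartAt (𝓡 7) p).symm y)) (chartD p y u) ≤ C * ‖u‖) := by
  obtain ⟨c, hc, C, hC, hev⟩ := S.exists_metric_bounds p
  obtain ⟨ρ, hρ, h⟩ := Metric.eventually_nhds_iff_ball.1
    (hev.and (target_mem_nhds' (mem_extChartAt_target (I := 𝓡 7) p)))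
  exact ⟨ρ, hρ, c, hc, C, hC, fun y hy => (h y hy).2, fun y hy u => ((h y hy).1 u).1,
    fun y hy u => ((h y hy).1 u).2⟩

section LeafDist

variable {S} {p : M} {ρ c C : ℝ}
  (hρ : Metric.ball (extChartAt (𝓡 7) p p) ρ ⊆ (extChartAt (𝓡 7) p).target)
  (hC : ∀ y ∈ Metric.ball (extChartAt (𝓡 7) p p) ρ, ∀ u : E7,
      vecNorm (S.phiOne ((extChartAt (𝓡 7) p).symm y)) (chartD p y u) ≤ C * ‖u‖)

include hρ hC

/-- `leafDist` is a `toReal`, which sends ⊤ to 0, so finiteness is needed before inequalities of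
extended distances can be transferred. -/
theorem leafEDist_ne_top (hS : S.CompactReebOrbits) (hρ0 : 0 < ρ) {y : E7}
    (hy : y ∈ Metric.ball (extChartAt (𝓡 7) p p) ρ) :
    (⨅ q ∈ S.reebOrbit p, g2EDist S.phiOne q ((extChartAt (𝓡 7) p).symm y)) ≠ ⊤ := by
  refine ne_top_of_le_ne_top (b := ENNReal.ofReal (C * ‖y - extChartAt (𝓡 7) p p‖))
    ENNReal.ofReal_ne_top (iInf₂_le_of_le p (S.mem_reebOrbit_self hS p) ?_)
  · have := g2EDist_chart_le hρ hC (Metric.mem_ball_self hρ0) hy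
    rwa [extChartAt_to_inv] at this

theorem leafDist_le_add (hS : S.CompactReebOrbits) (hC0 : 0 < C) (hρ0 : 0 < ρ) {y y' : E7}
    (hy : y ∈ Metric.ball (extChartAt (𝓡 7) p p) ρ)
    (hy' : y' ∈ Metric.ball (extChartAt (𝓡 7) p p) ρ) :
    S.leafDist p ((extChartAt (𝓡 7) p).symm y') ≤
      S.leafDist p ((extChartAt (𝓡 7) p).symm y) + C * ‖y' - y‖ := by
  have h1 := g2EDist_chart_le hρ hC hy hy'
  have h2 : (⨅ q ∈ S.reebOrbit p, g2EDist S.phiOne q ((extChartAt (𝓡 7) p).symm y')) ≤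
      (⨅ q ∈ S.reebOrbit p, g2EDist S.phiOne q ((extChartAt (𝓡 7) p).symm y)) +
        ENNReal.ofReal (C * ‖y' - y‖) := by
    simp only [ENNReal.iInf_add]
    refine le_iInf₂ fun q hq => iInf₂_le_of_le q hq ?_
    exact (g2EDist_triangle S.phiOne q _ _).trans (by gcongr)
  have h3 := leafEDist_ne_top hρ hC hS hρ0 hy
  have h4 := ENNReal.toReal_mono (ENNReal.add_ne_top.2 ⟨h3, ENNReal.ofReal_ne_top⟩) h2
  rw [ENNReal.toReal_add h3 ENNReal.ofReal_ne_top, ENNReal.toReal_ofReal (by positivity)] at h4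
  exact h4

theorem leafDist_le (hS : S.CompactReebOrbits) (hC0 : 0 < C) (hρ0 : 0 < ρ) {y : E7}
    (hy : y ∈ Metric.ball (extChartAt (𝓡 7) p p) ρ) :
    S.leafDist p ((extChartAt (𝓡 7) p).symm y) ≤ C * ‖y - extChartAt (𝓡 7) p p‖ := by
  have h1 := leafDist_le_add hρ hC hS hC0 hρ0 (Metric.mem_ball_self hρ0) hy
  have h2 : S.leafDist p p = 0 := by
    have h3 : (⨅ q ∈ S.reebOrbit p, g2EDist S.phiOne q p) = 0 :=
      le_antisymm (iInf₂_le_of_le p (S.mem_reebOrbit_self hS p) (g2EDist_self _ p).le) zero_le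
    rw [leafDist, h3, ENNReal.toReal_zero]
  rwa [extChartAt_to_inv, h2, zero_add] at h1

theorem exists_mem_reebOrbit_of_leafDist_lt [T2Space M] (hS : S.CompactReebOrbits) (hρ0 : 0 < ρ)
    (hc0 : 0 < c)
    (hc : ∀ y ∈ Metric.ball (extChartAt (𝓡 7) p p) ρ, ∀ u : E7,
      c * ‖u‖ ≤ vecNorm (S.phiOne ((extChartAt (𝓡 7) p).symm y)) (chartD p y u))
    {y : E7} {δ : ℝ} (hδ : 0 < δ)
    (hy : Metric.closedBall y δ ⊆ Metric.ball (extChartAt (𝓡 7) p p) ρ)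
    (h : S.leafDist p ((extChartAt (𝓡 7) p).symm y) < c * δ) :
    ∃ q ∈ S.reebOrbit p, q ∈ (extChartAt (𝓡 7) p).source ∧ ‖extChartAt (𝓡 7) p q - y‖ ≤ δ := by
  have h1 := leafEDist_ne_top hρ hC hS hρ0 (hy (Metric.mem_closedBall_self hδ.le))
  have h2 : (⨅ q ∈ S.reebOrbit p, g2EDist S.phiOne q ((extChartAt (𝓡 7) p).symm y)) <
      ENNReal.ofReal (c * δ) := by
    rw [← ENNReal.ofReal_toReal h1]
    exact (ENNReal.ofReal_lt_ofReal_iff (by positivity)).2 h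
  simp only [iInf_lt_iff] at h2
  obtain ⟨q, hq, h3⟩ := h2
  rw [g2EDist_comm] at h3
  exact ⟨q, hq, g2EDist_chart_ge hρ hc0 hc hδ hy h3⟩

end LeafDist

/-- Along a ray transverse to the Reeb field the distance to the orbit grows linearly. -/
theorem exists_transverse_ray [T2Space M] (hS : S.CompactReebOrbits) (p : M) :
    ∃ v : E7, ‖v‖ = 1 ∧ ∃ a > 0, ∀ᶠ t in 𝓝[>] (0 : ℝ),
      (extChartAt (𝓡 7) p).symm (extChartAt (𝓡 7) p p + t • v) ∉ S.reebOrbit p ∧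
      a * t ≤ S.leafDist p ((extChartAt (𝓡 7) p).symm (extChartAt (𝓡 7) p p + t • v)) := by
  obtain ⟨ρ, hρ0, c, hc0, C, hC0, hρ, hc, hC⟩ := S.exists_metric_ball p
  set ψ := extChartAt (𝓡 7) p with hψ
  set y₀ : E7 := ψ p with hy₀
  -- Orthogonality is Euclidean in the chart; only transversality to ξ matters.
  obtain ⟨v, hv, hvξ⟩ := exists_orthogonal (S.xi p)
  set l : E7 →L[ℝ] ℝ := innerSL ℝ v with hl
  have hlv : l v = 1 := by
    rw [hl, innerSL_apply_apply, real_inner_self_eq_norm_sq, hv, one_pow]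
  have hln : ∀ w, |l w| ≤ ‖w‖ := fun w => by
    have := abs_real_inner_le_norm v w
    rwa [hv, one_mul] at this
  have hcone := S.eventually_reebOrbit_cone hS p l hvξ (ε := 1 / 2) (by norm_num)
  have hcone' : ∀ᶠ y in 𝓝 y₀, ψ.symm y ∈ S.reebOrbit p →
      |l (ψ (ψ.symm y) - y₀)| ≤ 1 / 2 * ‖ψ (ψ.symm y) - y₀‖ := by
    have hcs : Filter.Tendsto ψ.symm (𝓝 y₀) (𝓝 p) := by
      have := continuousAt_chart_symm (x₀ := p) (mem_extChartAt_target (I := 𝓡 7) p)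
      rw [ContinuousAt, extChartAt_to_inv] at this
      exact this
    exact hcs.eventually hcone
  obtain ⟨r, hr0, hr⟩ := Metric.eventually_nhds_iff_ball.1 hcone'
  -- An orbit point within t/4 of the ray point would have displacement of length at most 5t/4 and
  -- v-component at least 3t/4. The cone condition with ε = 1/2 would force 3t/4 ≤ 5t/8.
  have hno : ∀ t : ℝ, 0 < t → 2 * t < r → ∀ q ∈ S.reebOrbit p, q ∈ ψ.source →
      ‖ψ q - (y₀ + t • v)‖ ≤ t / 4 → False := by
    intro t ht htr q hq hqs hqd
    have h1 : ‖ψ q - y₀‖ ≤ 5 / 4 * t := by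
      have : ψ q - y₀ = (ψ q - (y₀ + t • v)) + t • v := by abel
      rw [this]
      refine (norm_add_le _ _).trans ?_
      rw [norm_smul, hv, Real.norm_eq_abs, abs_of_pos ht]
      linarith
    have h2 : 3 / 4 * t ≤ l (ψ q - y₀) := by
      have h3 : l (ψ q - y₀) = l (ψ q - (y₀ + t • v)) + t := by
        have : ψ q - y₀ = (ψ q - (y₀ + t • v)) + t • v := by abel
        rw [this, map_add, map_smul, hlv, smul_eq_mul, mul_one]
      have h4 := (abs_le.1 ((hln (ψ q - (y₀ + t • v))).trans hqd)).1
      linarith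
    have h5 := hr (ψ q) (by rw [Metric.mem_ball, dist_eq_norm]; linarith)
    rw [ψ.left_inv hqs] at h5
    have h6 := (le_abs_self _).trans (h5 hq)
    linarith
  refine ⟨v, hv, c / 4, by positivity, ?_⟩
  have hsmall : ∀ᶠ t in 𝓝[>] (0 : ℝ), 2 * t < r ∧ 2 * t < ρ := by
    have h1 : ∀ᶠ t in 𝓝 (0 : ℝ), t < r / 2 ∧ t < ρ / 2 :=
      (eventually_lt_nhds (by positivity)).and (eventually_lt_nhds (by positivity))
    filter_upwards [nhdsWithin_le_nhds h1] with t ht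
    exact ⟨by linarith [ht.1], by linarith [ht.2]⟩
  filter_upwards [hsmall, self_mem_nhdsWithin] with t ⟨htr, htρ⟩ ht
  have ht0 : (0 : ℝ) < t := ht
  have hball : Metric.closedBall (y₀ + t • v) (t / 4) ⊆ Metric.ball y₀ ρ := by
    intro w hw
    rw [Metric.mem_closedBall, dist_eq_norm] at hw
    rw [Metric.mem_ball, dist_eq_norm]
    have : w - y₀ = (w - (y₀ + t • v)) + t • v := by abel
    rw [this]
    refine (norm_add_le _ _).trans_lt ?_
    rw [norm_smul, hv, Real.norm_eq_abs, abs_of_pos ht0]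
    linarith
  have hyt := hρ (hball (Metric.mem_closedBall_self (by positivity)))
  constructor
  · intro hO
    refine hno t ht0 htr _ hO (ψ.map_target hyt) ?_
    rw [ψ.right_inv hyt, sub_self, norm_zero]
    positivity
  · by_contra hlt
    rw [not_le] at hlt
    -- A distance below c · t/4 would produce an orbit point within Euclidean distance t/4, which
    -- `hno` excludes.
    obtain ⟨q, hq, hqs, hqd⟩ := exists_mem_reebOrbit_of_leafDist_lt hρ hC hS hρ0 hc0 hc
      (δ := t / 4) (by positivity) hball (by rw [← mul_div_assoc]; linarith)
    exact hno t ht0 htr q hq hqs hqd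

end ContactCalabiYau

end ContactG2

/-! ### The differential of ln h in a chart. -/

namespace ContactG2

namespace ContactCalabiYau

variable {M : Type*} [TopologicalSpace M] [ChartedSpace E7 M] [IsManifold (𝓡 7) ∞ M]
  (S : ContactCalabiYau M) {h : M → ℝ}

/-- Near a point `|d ln h|` is comparable to the norm of the differential of `ln h` in a chart. -/
theorem exists_dLogNorm_chart (hS : S.CompactReebOrbits) (h_inv : S.ReebInvariant h) (p : M) :
    ∃ c > 0, ∃ C > 0, ∀ᶠ y in 𝓝 (extChartAt (𝓡 7) p p),
      0 < h ((extChartAt (𝓡 7) p).symm y) →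
      MDifferentiableAt (𝓡 7) 𝓘(ℝ, ℝ) h ((extChartAt (𝓡 7) p).symm y) →
      ∃ D : E7 →L[ℝ] ℝ,
        HasFDerivAt (fun z => Real.log (h ((extChartAt (𝓡 7) p).symm z))) D y ∧
        c * dLogNorm (S.ansatz h) h ((extChartAt (𝓡 7) p).symm y) ≤ ‖D‖ ∧
        ‖D‖ ≤ C * dLogNorm (S.ansatz h) h ((extChartAt (𝓡 7) p).symm y) := by
  obtain ⟨c, hc, C, hC, hev⟩ := S.exists_metric_bounds p
  refine ⟨c, hc, C, hC, ?_⟩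
  filter_upwards [hev, target_mem_nhds' (mem_extChartAt_target (I := 𝓡 7) p)] with y hy hyt hx hd
  set x := (extChartAt (𝓡 7) p).symm y with hxdef
  obtain ⟨L, hθ, hω, hΥ, -⟩ := S.exists_frame_chart hyt
  rw [← hxdef] at hθ hω hΥ
  have hφ := S.ansatz_eq_pull (h := h) hθ hω hΥ
  have hφ1 := S.phiOne_eq_pull hθ hω hΥ
  have hmd := mfderiv_log hx hd
  set a : E7 →L[ℝ] ℝ := (h x)⁻¹ • dM h x with ha
  have hlog : dLogNorm (S.ansatz h) h x = formNorm (S.ansatz h x) (oneForm a) := by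
    rw [dLogNorm, hmd.mfderiv]
  rw [formNorm_oneForm hx.ne' hφ] at hlog
  have haξ : a (L.symm (vec 0)) = 0 := by
    rw [← S.frame_reeb hθ hω, L.symm_apply_apply, ha]
    have := S.mfderiv_reeb hS h_inv hd
    rw [_root_.smul_apply, this, smul_zero]
  -- As d ln h kills ξ, stretching e₀ by h does not change its norm. So |d ln h| for φ equals the
  -- norm for h = 1, whose metric does not degenerate at p.
  have hη : a.comp ((L.symm : E7 →L[ℝ] E7).comp (scaleMap (h x)⁻¹)) =
      a.comp (L.symm : E7 →L[ℝ] E7) := by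
    ext1 v
    have h1 : scaleMap (h x)⁻¹ v = v + (((h x)⁻¹ - 1) * v 0) • vec 0 := by
      simp [scaleMap, cov, mul_smul]
    change a (L.symm (scaleMap (h x)⁻¹ v)) = a (L.symm v)
    rw [h1, map_add, map_smul, map_add, map_smul, haξ, smul_zero, add_zero]
  rw [hη] at hlog
  set η : E7 →L[ℝ] ℝ := a.comp (L.symm : E7 →L[ℝ] E7) with hηdef
  have haη : ∀ v, a v = η (L v) := fun v => by simp [hηdef]
  refine ⟨a.comp (chartD p y), ?_, ?_, ?_⟩
  · have := hasFDerivAt_comp_chart_symm (h := fun x => Real.log (h x)) hyt hmd.mdifferentiableAt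
    have h2 : dM (fun x => Real.log (h x)) x = a := hmd.mfderiv
    rw [← hxdef, h2] at this
    exact this
  · rw [hlog, mul_comm, ← le_div_iff₀ hc]
    refine ContinuousLinearMap.opNorm_le_bound _ (by positivity) fun w => ?_
    set u := (chartDEquiv hyt).symm (L.symm w) with hu
    have hu1 : chartD p y u = L.symm w := (chartDEquiv hyt).apply_symm_apply _
    have h1 := (hy u).1
    rw [hu1, vecNorm_eq hφ1, L.apply_symm_apply] at h1
    have h2 : η w = (a.comp (chartD p y)) u := (congrArg a hu1).symm
    rw [h2, div_mul_eq_mul_div, le_div_iff₀ hc]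
    calc ‖(a.comp (chartD p y)) u‖ * c ≤ ‖a.comp (chartD p y)‖ * ‖u‖ * c := by
          gcongr; exact ContinuousLinearMap.le_opNorm _ _
      _ = ‖a.comp (chartD p y)‖ * (c * ‖u‖) := by ring
      _ ≤ _ := by gcongr
  · rw [hlog]
    refine ContinuousLinearMap.opNorm_le_bound _ (by positivity) fun u => ?_
    have h1 := (hy u).2
    rw [vecNorm_eq hφ1] at h1
    rw [ContinuousLinearMap.comp_apply, haη]
    calc ‖η (L (chartD p y u))‖ ≤ ‖η‖ * ‖L (chartD p y u)‖ := η.le_opNorm _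
      _ ≤ ‖η‖ * (C * ‖u‖) := by gcongr
      _ = _ := by ring

end ContactCalabiYau

end ContactG2

/-! ### Logarithmic derivatives and Taylor estimates. -/

namespace ContactG2

section Analysis

open Set

theorem antitoneOn_of_hasDerivAt_nonpos {G G' : ℝ → ℝ} {t₀ : ℝ}
    (hG : ∀ t ∈ Ioo 0 t₀, HasDerivAt G (G' t) t) (h : ∀ t ∈ Ioo 0 t₀, G' t ≤ 0) :
    AntitoneOn G (Ioo 0 t₀) := by
  refine antitoneOn_of_deriv_nonpos (convex_Ioo 0 t₀)
    (fun t ht => (hG t ht).continuousAt.continuousWithinAt) ?_ ?_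
  · rw [interior_Ioo]
    exact fun t ht => (hG t ht).differentiableAt.differentiableWithinAt
  · rw [interior_Ioo]
    intro t ht
    rw [(hG t ht).deriv]
    exact h t ht

/-- A positive function with bounded logarithmic derivative does not tend to zero. -/
theorem not_tendsto_zero_of_logDeriv_bounded {f g' : ℝ → ℝ} {C : ℝ}
    (hpos : ∀ᶠ t in 𝓝[>] (0 : ℝ), 0 < f t)
    (hd : ∀ᶠ t in 𝓝[>] (0 : ℝ), HasDerivAt (fun t => Real.log (f t)) (g' t) t)
    (hC : ∀ᶠ t in 𝓝[>] (0 : ℝ), |g' t| ≤ C)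
    (h0 : Filter.Tendsto f (𝓝[>] 0) (𝓝 0)) : False := by
  obtain ⟨t₀, ht₀, ht⟩ := mem_nhdsGT_iff_exists_Ioo_subset.1 (hpos.and (hd.and hC))
  have ht₀' : (0 : ℝ) < t₀ := ht₀
  -- Monotonicity gives ln f(t) ≥ ln f(s) − C s for all t < s, a positive lower bound for f near 0.
  have hanti : AntitoneOn (fun t => Real.log (f t) - C * t) (Ioo 0 t₀) := by
    refine antitoneOn_of_hasDerivAt_nonpos (G' := fun t => g' t - C * 1)
      (fun t h => (ht h).2.1.sub ((hasDerivAt_id t).const_mul C)) fun t h => ?_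
    have := (abs_le.1 (ht h).2.2).2
    linarith
  set s := t₀ / 2 with hs
  have hsm : s ∈ Ioo 0 t₀ := ⟨by positivity, by linarith⟩
  have hC0 : 0 ≤ C := (abs_nonneg _).trans (ht hsm).2.2
  have hlow : ∀ᶠ t in 𝓝[>] (0 : ℝ), Real.exp (Real.log (f s) - C * s) ≤ f t := by
    filter_upwards [Ioo_mem_nhdsGT hsm.1] with t hts
    have htm : t ∈ Ioo 0 t₀ := ⟨hts.1, hts.2.trans hsm.2⟩
    have h1 := hanti htm hsm hts.2.le
    dsimp only at h1
    rw [← Real.le_log_iff_exp_le (ht htm).1]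
    nlinarith [hts.1]
  have := ge_of_tendsto h0 hlow
  exact absurd this (not_le.2 (Real.exp_pos _))

/-- A positive function that is `O(t^k)` has logarithmic derivative at least `m / t` somewhere. -/
theorem not_le_rpow_of_logDeriv {f g' : ℝ → ℝ} {b k m : ℝ} (hm : m < k)
    (hpos : ∀ᶠ t in 𝓝[>] (0 : ℝ), 0 < f t)
    (hd : ∀ᶠ t in 𝓝[>] (0 : ℝ), HasDerivAt (fun t => Real.log (f t)) (g' t) t)
    (hC : ∀ᶠ t in 𝓝[>] (0 : ℝ), |g' t| ≤ m * t⁻¹)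
    (hb : ∀ᶠ t in 𝓝[>] (0 : ℝ), f t ≤ b * t ^ k) : False := by
  obtain ⟨t₀, ht₀, ht⟩ := mem_nhdsGT_iff_exists_Ioo_subset.1 (hpos.and (hd.and (hC.and hb)))
  have ht₀' : (0 : ℝ) < t₀ := ht₀
  -- Monotonicity gives f(t) ≥ const · t^m for small t; with f ≤ b t^k this bounds b t^(k−m) below
  -- by a positive constant, although it tends to 0.
  have hanti : AntitoneOn (fun t => Real.log (f t) - m * Real.log t) (Ioo 0 t₀) := by
    refine antitoneOn_of_hasDerivAt_nonpos (G' := fun t => g' t - m * t⁻¹)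
      (fun t h => (ht h).2.1.sub ((Real.hasDerivAt_log h.1.ne').const_mul m)) fun t h => ?_
    have := (abs_le.1 (ht h).2.2.1).2
    linarith
  set s := t₀ / 2 with hs
  have hsm : s ∈ Ioo 0 t₀ := ⟨by positivity, by linarith⟩
  have hlow : ∀ᶠ t in 𝓝[>] (0 : ℝ),
      Real.exp (Real.log (f s) - m * Real.log s) ≤ b * t ^ (k - m) := by
    filter_upwards [Ioo_mem_nhdsGT hsm.1] with t hts
    have htm : t ∈ Ioo 0 t₀ := ⟨hts.1, hts.2.trans hsm.2⟩
    have h1 := hanti htm hsm hts.2.le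
    dsimp only at h1
    have h2 : Real.exp (Real.log (f s) - m * Real.log s) ≤ f t / t ^ m := by
      rw [← Real.exp_log (ht htm).1, Real.rpow_def_of_pos hts.1, ← Real.exp_sub, mul_comm _ m]
      simpa using h1
    refine h2.trans ?_
    have h3 : 0 < t ^ m := Real.rpow_pos_of_pos hts.1 m
    rw [div_le_iff₀ h3, mul_assoc, ← Real.rpow_add hts.1, sub_add_cancel]
    exact (ht htm).2.2.2
  have hlim : Filter.Tendsto (fun t : ℝ => b * t ^ (k - m)) (𝓝[>] 0) (𝓝 0) := by
    have h1 : ContinuousAt (fun t : ℝ => b * t ^ (k - m)) 0 :=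
      (Real.continuousAt_rpow_const 0 (k - m) (Or.inr (by linarith))).const_mul b
    have h2 := h1.tendsto
    rw [Real.zero_rpow (by linarith), mul_zero] at h2
    exact h2.mono_left nhdsWithin_le_nhds
  have := ge_of_tendsto hlim hlow
  exact absurd this (not_le.2 (Real.exp_pos _))

open Polynomial in
/-- The linear coefficient of a polynomial is controlled by its size on `[0, 1]`. -/
theorem exists_coeff_one_le (n : ℕ) (hn : 1 ≤ n) : ∃ W : ℝ, 0 ≤ W ∧ ∀ (c : ℕ → ℝ) (B : ℝ),
    (∀ t ∈ Icc (0 : ℝ) 1, |∑ i ∈ Finset.range (n + 1), c i * t ^ i| ≤ B) → |c 1| ≤ W * B := by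
  set s := Finset.range (n + 1) with hs
  -- Interpolation nodes j/(n+1) in [0, 1]. The Lagrange formula writes the linear coefficient as a
  -- fixed combination of the values there, and W is the sum of the absolute weights.
  set v : ℕ → ℝ := fun j => j / (n + 1) with hv
  refine ⟨∑ j ∈ s, |(Lagrange.basis s v j).coeff 1|, Finset.sum_nonneg fun _ _ => abs_nonneg _,
    fun c B hB => ?_⟩
  set P : ℝ[X] := ∑ i ∈ s, C (c i) * X ^ i with hP
  have heval : ∀ t, P.eval t = ∑ i ∈ s, c i * t ^ i := fun t => by
    simp [hP, eval_finsetSum]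
  have hdeg : P.degree < (s.card : WithBot ℕ) := by
    rw [hs, Finset.card_range]
    refine (degree_sum_le _ _).trans_lt ?_
    rw [Finset.sup_lt_iff (WithBot.bot_lt_coe _)]
    intro i hi
    refine (degree_C_mul_X_pow_le i (c i)).trans_lt ?_
    exact_mod_cast Finset.mem_range.1 hi
  have hinj : Set.InjOn v s := by
    intro i _ j _ hij
    have h1 : ((n : ℝ) + 1) ≠ 0 := by positivity
    simp only [hv] at hij
    rw [div_left_inj' h1] at hij
    exact_mod_cast hij
  have hcoeff : P.coeff 1 = c 1 := by
    simp only [hP, finsetSum_coeff, coeff_C_mul, coeff_X_pow]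
    rw [Finset.sum_eq_single 1]
    · simp
    · intro i _ hi
      simp [hi.symm]
    · intro h
      exact absurd (Finset.mem_range.2 (by omega)) h
  have hinterp := Lagrange.eq_interpolate hinj hdeg
  rw [← hcoeff, hinterp, Lagrange.interpolate_apply, finsetSum_coeff, Finset.sum_mul]
  refine (Finset.abs_sum_le_sum_abs _ _).trans (Finset.sum_le_sum fun j hj => ?_)
  rw [coeff_C_mul, abs_mul, mul_comm]
  refine mul_le_mul_of_nonneg_left ?_ (abs_nonneg _)
  rw [heval]
  have hj' := Finset.mem_range.1 hj
  refine hB _ ⟨by positivity, ?_⟩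
  simp only [hv]
  rw [div_le_one (by positivity)]
  exact_mod_cast hj'.le

theorem iteratedDeriv_line {f : E7 → ℝ} {y e : E7} {n : ℕ} {U : Set ℝ} (hU : IsOpen U)
    (hf : ∀ s ∈ U, ContDiffAt ℝ n f (y + s • e)) :
    ∀ j ≤ n, ∀ s ∈ U, iteratedDeriv j (fun s : ℝ => f (y + s • e)) s =
      iteratedFDeriv ℝ j f (y + s • e) fun _ => e := by
  intro j
  induction j with
  | zero => intro _ s _; simp
  | succ j ih =>
    intro hj s hs
    have h1 : iteratedDeriv j (fun s : ℝ => f (y + s • e)) =ᶠ[𝓝 s]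
        fun s => iteratedFDeriv ℝ j f (y + s • e) fun _ => e := by
      filter_upwards [hU.mem_nhds hs] with t ht
      exact ih (by omega) t ht
    have h2 : HasFDerivAt (iteratedFDeriv ℝ j f) (fderiv ℝ (iteratedFDeriv ℝ j f) (y + s • e))
        (y + s • e) :=
      ((hf s hs).differentiableAt_iteratedFDeriv (by exact_mod_cast hj)).hasFDerivAt
    have h3 : HasDerivAt (fun s : ℝ => y + s • e) e s := by
      have h := ((hasDerivAt_id s).smul_const e).const_add y
      rw [one_smul] at h
      exact h
    have h4 := h2.comp_hasDerivAt s h3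
    let l := ContinuousMultilinearMap.apply ℝ (fun _ : Fin j => E7) ℝ fun _ => e
    have h5 : HasDerivAt (fun s => iteratedFDeriv ℝ j f (y + s • e) fun _ => e)
        (fderiv ℝ (iteratedFDeriv ℝ j f) (y + s • e) e fun _ => e) s :=
      l.hasFDerivAt.comp_hasDerivAt s h4
    rw [iteratedDeriv_succ, h1.deriv_eq, h5.deriv, iteratedFDeriv_succ_apply_left]
    rfl

/-- A smooth function of size `O(r^k)` on a ball of radius `r` has differential `O(r^{k-1})` at the
centre. -/
theorem exists_fderiv_le_rpow {f : E7 → ℝ} {y₀ : E7} (hf : ContDiffAt ℝ ∞ f y₀) {k : ℝ}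
    (hk : 0 < k) : ∃ K : ℝ, 0 ≤ K ∧ ∃ ρ > 0, ∀ y ∈ Metric.ball y₀ ρ, ∀ r, 0 < r → r < ρ →
      ∀ A : ℝ, 0 ≤ A → (∀ z ∈ Metric.closedBall y r, |f z| ≤ A * r ^ k) →
      ‖fderiv ℝ f y‖ ≤ K * (A + 1) * r ^ (k - 1) := by
  -- With n ≥ k the Taylor remainder of order r^(n+1) is at most r^k for r < 1, also when k is not
  -- an integer.
  set n := ⌈k⌉₊ with hn
  have hn1 : 1 ≤ n := Nat.ceil_pos.2 hk
  have hkn : k ≤ n := Nat.le_ceil k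
  obtain ⟨W, hW, hWle⟩ := exists_coeff_one_le n hn1
  have hf' : ContDiffAt ℝ ((n + 2 : ℕ) : WithTop ℕ∞) f y₀ := hf.of_le (WithTop.coe_le_coe.2 (le_top (a := ((n + 2 : ℕ) : ℕ∞))))
  have hcd := hf'.eventually (ne_of_lt (WithTop.coe_lt_coe.2 (ENat.natCast_lt_top (n + 2))))
  have hcont : ContinuousAt (iteratedFDeriv ℝ (n + 1) f) y₀ :=
    (hf'.iteratedFDeriv_right (m := 1) (i := n + 1) (by norm_cast; omega)).continuousAt
  set N := ‖iteratedFDeriv ℝ (n + 1) f y₀‖ + 1 with hN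
  have hN0 : 0 ≤ N := by positivity
  have hbd : ∀ᶠ z in 𝓝 y₀, ‖iteratedFDeriv ℝ (n + 1) f z‖ < N :=
    hcont.norm.eventually (gt_mem_nhds (lt_add_one _))
  obtain ⟨δ, hδ, hball⟩ := Metric.eventually_nhds_iff_ball.1 (hcd.and hbd)
  refine ⟨W * (N + 1), by positivity, min 1 (δ / 2), by positivity, fun y hy r hr hrρ A hA hfA => ?_⟩
  have hr1 : r < 1 := hrρ.trans_le (min_le_left _ _)
  have hrδ : r < δ / 2 := hrρ.trans_le (min_le_right _ _)
  have hyδ : dist y y₀ < δ / 2 := (Metric.mem_ball.1 hy).trans_le (min_le_right _ _)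
  refine ContinuousLinearMap.opNorm_le_of_unit_norm (by positivity) fun e he => ?_
  set g : ℝ → ℝ := fun s => f (y + s • e) with hg
  set U : Set ℝ := Ioo (-(δ / 2)) (δ / 2) with hU
  have hmem : ∀ s ∈ U, y + s • e ∈ Metric.ball y₀ δ := by
    intro s hs
    have h1 : ‖s • e‖ < δ / 2 := by
      rw [norm_smul, he, mul_one, Real.norm_eq_abs]
      exact abs_lt.2 hs
    rw [Metric.mem_ball, dist_eq_norm] at *
    have : y + s • e - y₀ = (y - y₀) + s • e := by abel
    rw [this]
    exact (norm_add_le _ _).trans_lt (by linarith)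
  have hsub : Icc 0 r ⊆ U := fun s hs => ⟨by linarith [hs.1], hs.2.trans_lt hrδ⟩
  have hline : ContDiff ℝ ((n + 2 : ℕ) : WithTop ℕ∞) fun s : ℝ => y + s • e := by fun_prop
  have hgU : ∀ s ∈ U, ContDiffAt ℝ ((n + 2 : ℕ) : WithTop ℕ∞) g s := fun s hs =>
    ((hball _ (hmem s hs)).1).comp s hline.contDiffAt
  have hit := iteratedDeriv_line (y := y) (e := e) isOpen_Ioo fun s hs => (hball _ (hmem s hs)).1
  have huniq : UniqueDiffOn ℝ (Icc 0 r) := uniqueDiffOn_Icc hr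
  have hwithin : ∀ j ≤ n + 2, ∀ s ∈ Icc 0 r, iteratedDerivWithin j g (Icc 0 r) s =
      iteratedFDeriv ℝ j f (y + s • e) fun _ => e := fun j hj s hs => by
    rw [iteratedDerivWithin_eq_iteratedDeriv huniq
      ((hgU s (hsub hs)).of_le (by exact_mod_cast hj)) hs]
    exact hit j hj s (hsub hs)
  have htay : ∀ s ∈ Icc 0 r, ‖g s - taylorWithinEval g n (Icc 0 r) 0 s‖ ≤
      N * (s - 0) ^ (n + 1) / n.factorial := fun s hs => by
    refine taylor_mean_remainder_bound hr.le
      (fun s hs => ((hgU s (hsub hs)).of_le (by norm_cast; omega)).contDiffWithinAt) hs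
      fun t ht => ?_
    rw [hwithin (n + 1) (by omega) t ht]
    refine (ContinuousMultilinearMap.le_opNorm _ _).trans ?_
    simp only [he, Finset.prod_const_one, mul_one]
    exact (hball _ (hmem t (hsub ht))).2.le
  -- Taylor coefficients along the segment of length r in direction e, rescaled to [0, 1]. The
  -- linear one is r · df(e), so a bound O(r^k) on the polynomial yields |df(e)| = O(r^(k−1)).
  set c : ℕ → ℝ := fun i => ((i.factorial : ℝ)⁻¹ * r ^ i) * iteratedDerivWithin i g (Icc 0 r) 0
    with hc
  have hrk : r ^ (n + 1) ≤ r ^ k := by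
    rw [← Real.rpow_natCast]
    exact Real.rpow_le_rpow_of_exponent_ge hr hr1.le (by push_cast; linarith)
  have hrk0 : 0 < r ^ k := Real.rpow_pos_of_pos hr k
  have hpoly : ∀ t ∈ Icc (0 : ℝ) 1, |∑ i ∈ Finset.range (n + 1), c i * t ^ i| ≤
      (A + N) * r ^ k := by
    intro t ht
    have hrt : r * t ∈ Icc 0 r := ⟨mul_nonneg hr.le ht.1, by nlinarith [ht.2]⟩
    have h1 : ∑ i ∈ Finset.range (n + 1), c i * t ^ i =
        taylorWithinEval g n (Icc 0 r) 0 (r * t) := by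
      rw [taylor_within_apply]
      refine Finset.sum_congr rfl fun i _ => ?_
      simp only [hc, sub_zero, smul_eq_mul, mul_pow]
      ring
    have h2 := htay _ hrt
    have h3 : |g (r * t)| ≤ A * r ^ k := hfA _ (by
      rw [Metric.mem_closedBall, dist_eq_norm, add_sub_cancel_left, norm_smul, he, mul_one,
        Real.norm_eq_abs, abs_of_nonneg hrt.1]
      exact hrt.2)
    have h4 : N * (r * t - 0) ^ (n + 1) / n.factorial ≤ N * r ^ k := by
      have h5 : (1 : ℝ) ≤ n.factorial := by exact_mod_cast Nat.factorial_pos n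
      have h6 : (r * t) ^ (n + 1) ≤ r ^ (n + 1) := pow_le_pow_left₀ hrt.1 hrt.2 _
      rw [sub_zero]
      refine (div_le_self (mul_nonneg hN0 (pow_nonneg hrt.1 _)) h5).trans ?_
      exact mul_le_mul_of_nonneg_left (h6.trans hrk) hN0
    rw [h1]
    rw [Real.norm_eq_abs] at h2
    have h7 := abs_sub_abs_le_abs_sub (taylorWithinEval g n (Icc 0 r) 0 (r * t)) (g (r * t))
    rw [abs_sub_comm] at h7
    linarith
  have hc1 := hWle c _ hpoly
  have hc1' : c 1 = r * fderiv ℝ f y e := by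
    simp only [hc]
    rw [hwithin 1 (by omega) 0 (left_mem_Icc.2 hr.le), iteratedFDeriv_one_apply]
    simp
  rw [hc1', abs_mul, abs_of_pos hr] at hc1
  rw [Real.norm_eq_abs, Real.rpow_sub_one hr.ne', mul_div_assoc', le_div_iff₀ hr, mul_comm]
  refine hc1.trans ?_
  have : (A + N) ≤ (N + 1) * (A + 1) := by nlinarith
  calc W * ((A + N) * r ^ k) ≤ W * (((N + 1) * (A + 1)) * r ^ k) := by gcongr
    _ = _ := by ring

end Analysis

end ContactG2

/-! ### Upper bounds of order 1/r for d ln f. -/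

namespace ContactG2

section LogBounds

open Set

variable {f r : E7 → ℝ} {y₀ : E7} {ρ C k : ℝ}

theorem eventually_lt_of_le_mul_norm (hρ : 0 < ρ)
    (hr : ∀ y ∈ Metric.ball y₀ ρ, r y ≤ C * ‖y - y₀‖) {ε : ℝ} (hε : 0 < ε) :
    ∀ᶠ y in 𝓝 y₀, r y < ε := by
  have h1 : Filter.Tendsto (fun y => C * ‖y - y₀‖) (𝓝 y₀) (𝓝 0) := by
    have : Continuous fun y : E7 => C * ‖y - y₀‖ := by fun_prop
    simpa using this.tendsto y₀
  filter_upwards [Metric.ball_mem_nhds y₀ hρ, h1.eventually (gt_mem_nhds hε)] with y hy hy2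
  exact (hr y hy).trans_lt hy2

/-- A smooth function comparable to `r^k`, with `r` Lipschitz, has `|d ln f| = O(1/r)`. -/
theorem exists_norm_dlog_le_of_smooth (hρ : 0 < ρ) (hC : 0 < C) (hr0 : ∀ y, 0 ≤ r y)
    (hr : ∀ y ∈ Metric.ball y₀ ρ, r y ≤ C * ‖y - y₀‖)
    (hlip : ∀ y ∈ Metric.ball y₀ ρ, ∀ z ∈ Metric.ball y₀ ρ, r z ≤ r y + C * ‖z - y‖)
    (hf : ContDiffAt ℝ ∞ f y₀) (hk : 0 < k) {a b : ℝ} (ha : 0 < a)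
    (hab : ∀ᶠ y in 𝓝 y₀, a * r y ^ k ≤ f y ∧ f y ≤ b * r y ^ k) :
    ∃ K, 0 ≤ K ∧ ∀ᶠ y in 𝓝 y₀, 0 < f y → 0 < r y ∧ ∀ D : E7 →L[ℝ] ℝ,
      HasFDerivAt (fun z => Real.log (f z)) D y → ‖D‖ ≤ K * (r y)⁻¹ := by
  obtain ⟨K₀, hK₀, ρ₀, hρ₀, hK⟩ := exists_fderiv_le_rpow hf hk
  obtain ⟨ρ₁, hρ₁, hball⟩ := Metric.eventually_nhds_iff_ball.1 hab
  -- On the ball of radius r(y) about y the Lipschitz bound gives r ≤ (1 + C) r(y), hence f ≤ A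
  -- r(y)^k there.
  set A := |b| * (1 + C) ^ k with hA
  have hA0 : 0 ≤ A := by positivity
  have hdiff : ∀ᶠ y in 𝓝 y₀, ContDiffAt ℝ 1 f y :=
    (hf.of_le (m := 1) (by norm_cast)).eventually (by norm_cast)
  refine ⟨K₀ * (A + 1) / a, by positivity, ?_⟩
  filter_upwards [hdiff, Metric.ball_mem_nhds y₀ hρ₀,
    Metric.ball_mem_nhds y₀ (show 0 < min ρ ρ₁ / 2 by positivity),
    eventually_lt_of_le_mul_norm hρ hr (show 0 < min ρ₀ (min ρ ρ₁ / 2) by positivity)]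
    with y hy1 hy2 hy3 hy4 hfy
  have hρm : min ρ ρ₁ / 2 < min ρ ρ₁ := half_lt_self (by positivity)
  have hyρ : y ∈ Metric.ball y₀ ρ :=
    Metric.ball_subset_ball (hρm.le.trans (min_le_left _ _)) hy3
  have hyρ₁ : y ∈ Metric.ball y₀ ρ₁ :=
    Metric.ball_subset_ball (hρm.le.trans (min_le_right _ _)) hy3
  -- Positivity of r is a consequence of f > 0: at r = 0 the bound reads f ≤ b · 0^k = 0.
  have hry : 0 < r y := by
    rcases (hr0 y).eq_or_lt with h | h
    · have h1 := (hball y hyρ₁).2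
      rw [← h, Real.zero_rpow hk.ne', mul_zero] at h1
      exact absurd h1 (not_le.2 hfy)
    · exact h
  refine ⟨hry, fun D hD => ?_⟩
  have hbd : ∀ z ∈ Metric.closedBall y (r y), |f z| ≤ A * r y ^ k := by
    intro z hz
    have hzm : z ∈ Metric.ball y₀ (min ρ ρ₁) := by
      rw [Metric.mem_ball] at *
      rw [Metric.mem_closedBall] at hz
      have := dist_triangle z y y₀
      have := hy4.trans_le (min_le_right _ _)
      linarith
    have hzρ : z ∈ Metric.ball y₀ ρ := Metric.ball_subset_ball (min_le_left _ _) hzm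
    have h1 := hball z (Metric.ball_subset_ball (min_le_right _ _) hzm)
    have hrz : r z ≤ (1 + C) * r y := by
      have h2 := hlip y hyρ z hzρ
      rw [Metric.mem_closedBall, dist_eq_norm] at hz
      nlinarith
    have h3 : 0 ≤ f z := le_trans (mul_nonneg ha.le (Real.rpow_nonneg (hr0 z) k)) h1.1
    rw [abs_of_nonneg h3, hA, mul_assoc, ← Real.mul_rpow (by positivity) hry.le]
    calc f z ≤ b * r z ^ k := h1.2
      _ ≤ |b| * r z ^ k := mul_le_mul_of_nonneg_right (le_abs_self b) (Real.rpow_nonneg (hr0 z) k)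
      _ ≤ _ := by
        gcongr
        exact hr0 z
  have h1 := hK y hy2 (r y) hry (hy4.trans_le (min_le_left _ _)) A hA0 hbd
  have h2 : HasFDerivAt (fun z => Real.log (f z)) ((f y)⁻¹ • fderiv ℝ f y) y :=
    (hy1.differentiableAt one_ne_zero).hasFDerivAt.log hfy.ne'
  rw [hD.unique h2, norm_smul, norm_inv, Real.norm_eq_abs, abs_of_pos hfy]
  have h3 := (hball y hyρ₁).1
  have hrk := Real.rpow_pos_of_pos hry k
  have h4 : 0 < a * r y ^ k := mul_pos ha hrk
  calc (f y)⁻¹ * ‖fderiv ℝ f y‖ ≤ (a * r y ^ k)⁻¹ * (K₀ * (A + 1) * r y ^ (k - 1)) := by gcongr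
    _ = K₀ * (A + 1) / a * (r y)⁻¹ := by
      rw [Real.rpow_sub_one hry.ne']
      field_simp

/-- The same for `f = u r^k` with `u` of class `C¹`. -/
theorem exists_norm_dlog_le_of_eq_mul (hρ : 0 < ρ) (hC : 0 < C) (hr0 : ∀ y, 0 ≤ r y)
    (hr : ∀ y ∈ Metric.ball y₀ ρ, r y ≤ C * ‖y - y₀‖)
    (hlip : ∀ y ∈ Metric.ball y₀ ρ, ∀ z ∈ Metric.ball y₀ ρ, r z ≤ r y + C * ‖z - y‖)
    {u : E7 → ℝ} (hu : ContDiffAt ℝ 1 u y₀) (hu0 : 0 < u y₀) (hk : 0 < k)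
    (hfu : ∀ᶠ y in 𝓝 y₀, f y = u y * r y ^ k) :
    ∃ K, 0 ≤ K ∧ ∀ᶠ y in 𝓝 y₀, 0 < f y → 0 < r y ∧ ∀ D : E7 →L[ℝ] ℝ,
      HasFDerivAt (fun z => Real.log (f z)) D y → ‖D‖ ≤ K * (r y)⁻¹ := by
  obtain ⟨L, t, ht, hL⟩ := (hu.log hu0.ne').exists_lipschitzOnWith
  have hupos : ∀ᶠ y in 𝓝 y₀, 0 < u y := hu.continuousAt.eventually (lt_mem_nhds hu0)
  have hall : ∀ᶠ y in 𝓝 y₀, y ∈ t ∧ 0 < u y ∧ f y = u y * r y ^ k ∧ y ∈ Metric.ball y₀ ρ :=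
    (Filter.eventually_mem_set.2 ht).and (hupos.and (hfu.and (Metric.ball_mem_nhds y₀ hρ)))
  refine ⟨L + 2 * k * C, by positivity, ?_⟩
  filter_upwards [hall.eventually_nhds, eventually_lt_of_le_mul_norm hρ hr one_pos]
    with y hy1 hy2 hfy
  obtain ⟨hyt, huy, hfy', hyρ⟩ := hy1.self_of_nhds
  have hry : 0 < r y := by
    rcases (hr0 y).eq_or_lt with h | h
    · rw [hfy', ← h, Real.zero_rpow hk.ne', mul_zero] at hfy
      exact absurd hfy (lt_irrefl 0)
    · exact h
  refine ⟨hry, fun D hD => ?_⟩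
  have hlim : (L : ℝ) + k * (C * (2 * (r y)⁻¹)) ≤ (L + 2 * k * C) * (r y)⁻¹ := by
    have : 1 ≤ (r y)⁻¹ := (one_le_inv₀ hry).2 hy2.le
    nlinarith [L.coe_nonneg]
  -- The function r need not be differentiable, so D is bounded by a Lipschitz estimate at y for ln
  -- u + k ln r. Near y one has r > r(y)/2, so ln r contributes 2C/r(y); the constant L is absorbed
  -- because r(y) < 1.
  refine (hD.le_of_lip' (C := L + k * (C * (2 * (r y)⁻¹))) (by positivity) ?_).trans hlim
  filter_upwards [hy1, Metric.ball_mem_nhds y (show 0 < r y / 2 / C by positivity)] with z hz hzb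
  obtain ⟨hzt, huz, hfz, hzρ⟩ := hz
  have hzy : C * ‖z - y‖ < r y / 2 := by
    rw [Metric.mem_ball, dist_eq_norm, lt_div_iff₀ hC] at hzb
    linarith
  have hrz' : r y ≤ r z + C * ‖z - y‖ := by
    have := hlip z hzρ y hyρ
    rwa [norm_sub_rev] at this
  have hrz2 : r z ≤ r y + C * ‖z - y‖ := hlip y hyρ z hzρ
  have hrz1 : r y / 2 < r z := by linarith
  have hrz : 0 < r z := by linarith
  have hlog : ∀ {s t : ℝ}, 0 < s → 0 < t → Real.log s - Real.log t ≤ (s - t) / t := by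
    intro s t hs ht
    rw [← Real.log_div hs.ne' ht.ne', sub_div, div_self ht.ne']
    exact Real.log_le_sub_one_of_pos (div_pos hs ht)
  have hlr : |Real.log (r z) - Real.log (r y)| ≤ C * (2 * (r y)⁻¹) * ‖z - y‖ := by
    have hn := norm_nonneg (z - y)
    have hCn : 0 ≤ C * ‖z - y‖ := by positivity
    have hrhs : C * (2 * (r y)⁻¹) * ‖z - y‖ = 2 * (C * ‖z - y‖) / r y := by
      field_simp
    rw [hrhs, abs_le']
    constructor
    · refine (hlog hrz hry).trans ?_
      gcongr
      linarith
    · rw [neg_sub]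
      refine (hlog hry hrz).trans ?_
      rw [div_le_div_iff₀ hrz hry]
      nlinarith
  have hl : ∀ w, 0 < u w → 0 < r w → Real.log (u w * r w ^ k) =
      Real.log (u w) + k * Real.log (r w) := fun w h1 h2 => by
    rw [Real.log_mul h1.ne' (Real.rpow_pos_of_pos h2 k).ne', Real.log_rpow h2]
  rw [hfz, hfy', hl z huz hrz, hl y huy hry, Real.norm_eq_abs]
  have h1 := hL.dist_le_mul z hzt y hyt
  rw [Real.dist_eq, dist_eq_norm] at h1
  have h2 : Real.log (u z) + k * Real.log (r z) - (Real.log (u y) + k * Real.log (r y)) =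
      (Real.log (u z) - Real.log (u y)) + k * (Real.log (r z) - Real.log (r y)) := by ring
  rw [h2, add_mul, mul_assoc k]
  refine (abs_add_le _ _).trans (add_le_add h1 ?_)
  rw [abs_mul, abs_of_pos hk]
  gcongr

end LogBounds

/-! ### Back to the manifold: unboundedness and growth of the torsion. -/

section Transfer

variable {M : Type*} [TopologicalSpace M] [ChartedSpace E7 M] [IsManifold (𝓡 7) ∞ M] {p : M}

theorem tendsto_chart_symm (p : M) : Filter.Tendsto (extChartAt (𝓡 7) p).symm
    (𝓝 (extChartAt (𝓡 7) p p)) (𝓝 p) := by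
  have := continuousAt_chart_symm (x₀ := p) (mem_extChartAt_target (I := 𝓡 7) p)
  rwa [ContinuousAt, extChartAt_to_inv] at this

theorem eventually_of_chart {P : M → Prop}
    (h : ∀ᶠ y in 𝓝 (extChartAt (𝓡 7) p p), P ((extChartAt (𝓡 7) p).symm y)) :
    ∀ᶠ x in 𝓝 p, P x := by
  filter_upwards [(continuousAt_extChartAt (I := 𝓡 7) p).eventually h,
    extChartAt_source_mem_nhds (I := 𝓡 7) p] with x hx hxs
  rwa [(extChartAt (𝓡 7) p).left_inv hxs] at hx

theorem tendsto_ray (p : M) (v : E7) :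
    Filter.Tendsto (fun t : ℝ => extChartAt (𝓡 7) p p + t • v) (𝓝[>] 0)
      (𝓝 (extChartAt (𝓡 7) p p)) := by
  have h : Continuous fun t : ℝ => (extChartAt (𝓡 7) p p : E7) + t • v := by fun_prop
  have h1 := h.tendsto 0
  rw [zero_smul, add_zero] at h1
  exact h1.mono_left nhdsWithin_le_nhds

theorem contDiffAt_comp_chart_symm {f : M → ℝ} {n : WithTop ℕ∞} (hn : n ≤ (∞ : WithTop ℕ∞))
    (hf : ContMDiffAt (𝓡 7) 𝓘(ℝ, ℝ) n f p) :
    ContDiffAt ℝ n (fun y => f ((extChartAt (𝓡 7) p).symm y)) (extChartAt (𝓡 7) p p) := by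
  have h1 : ContMDiffAt 𝓘(ℝ, E7) (𝓡 7) n (extChartAt (𝓡 7) p).symm (extChartAt (𝓡 7) p p) :=
    ((contMDiffOn_extChartAt_symm (n := ∞) p).contMDiffAt
      (target_mem_nhds' (mem_extChartAt_target (I := 𝓡 7) p))).of_le hn
  have h2 : ContMDiffAt (𝓡 7) 𝓘(ℝ, ℝ) n f
      ((extChartAt (𝓡 7) p).symm (extChartAt (𝓡 7) p p)) := by rwa [extChartAt_to_inv]
  exact (h2.comp _ h1).contDiffAt

end Transfer

theorem codiffNorm_le_torsionNorm {M : Type*} [TopologicalSpace M] [ChartedSpace E7 M]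
    (φ : M → E7 [⋀^Fin 3]→L[ℝ] ℝ) (x : M) : codiffNorm φ x ≤ torsionNorm φ x :=
  Real.le_sqrt_of_sq_le (by nlinarith [sq_nonneg (formNorm (φ x) (extD φ x))])

namespace ContactCalabiYau

variable {M : Type*} [TopologicalSpace M] [ChartedSpace E7 M] [IsManifold (𝓡 7) ∞ M]
  (S : ContactCalabiYau M) {h : M → ℝ} {p : M}

/-- The behaviour of `ln h` along a ray transverse to the orbit. -/
theorem exists_ray_data [T2Space M] (hS : S.CompactReebOrbits) (h_inv : S.ReebInvariant h)
    (hd : ∀ᶠ x in 𝓝 p, x ∉ S.reebOrbit p → 0 < h x ∧ MDifferentiableAt (𝓡 7) 𝓘(ℝ, ℝ) h x) :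
    ∃ (x : ℝ → M) (g' : ℝ → ℝ), Filter.Tendsto x (𝓝[>] 0) (𝓝 p) ∧ ∃ a > 0, ∃ C > 0, ∃ B > 0,
      ∀ᶠ t in 𝓝[>] (0 : ℝ), x t ∉ S.reebOrbit p ∧ a * t ≤ S.leafDist p (x t) ∧
        S.leafDist p (x t) ≤ C * t ∧ HasDerivAt (fun t => Real.log (h (x t))) (g' t) t ∧
        |g' t| ≤ B * dLogNorm (S.ansatz h) h (x t) := by
  obtain ⟨v, hv, a, ha, hray⟩ := S.exists_transverse_ray hS p
  obtain ⟨ρ, hρ0, c, hc0, C, hC0, hρ, hc, hC⟩ := S.exists_metric_ball p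
  obtain ⟨c', hc', B, hB, hlog⟩ := S.exists_dLogNorm_chart hS h_inv p
  have hty := tendsto_ray p v
  set y : ℝ → E7 := fun t => extChartAt (𝓡 7) p p + t • v with hy
  have hyd : ∀ t, HasDerivAt y v t := fun t => by
    have h := ((hasDerivAt_id t).smul_const v).const_add (extChartAt (𝓡 7) p p : E7)
    rw [one_smul] at h
    exact h
  have hex : ∀ t : ℝ, ∃ d : ℝ, (∃ D : E7 →L[ℝ] ℝ,
        HasFDerivAt (fun z => Real.log (h ((extChartAt (𝓡 7) p).symm z))) D (y t) ∧
        ‖D‖ ≤ B * dLogNorm (S.ansatz h) h ((extChartAt (𝓡 7) p).symm (y t))) →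
      HasDerivAt (fun t => Real.log (h ((extChartAt (𝓡 7) p).symm (y t)))) d t ∧
        |d| ≤ B * dLogNorm (S.ansatz h) h ((extChartAt (𝓡 7) p).symm (y t)) := by
    intro t
    by_cases hD : ∃ D : E7 →L[ℝ] ℝ,
        HasFDerivAt (fun z => Real.log (h ((extChartAt (𝓡 7) p).symm z))) D (y t) ∧
        ‖D‖ ≤ B * dLogNorm (S.ansatz h) h ((extChartAt (𝓡 7) p).symm (y t))
    · obtain ⟨D, hD1, hD2⟩ := hD
      refine ⟨D v, fun _ => ⟨hD1.comp_hasDerivAt t (hyd t), ?_⟩⟩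
      have := D.le_opNorm v
      rw [hv, mul_one, Real.norm_eq_abs] at this
      exact this.trans hD2
    · exact ⟨0, fun h => absurd h hD⟩
  choose g' hg' using hex
  refine ⟨fun t => (extChartAt (𝓡 7) p).symm (y t), g', (tendsto_chart_symm p).comp hty,
    a, ha, C, hC0, B, hB, ?_⟩
  have hd' := ((tendsto_chart_symm p).comp hty).eventually hd
  filter_upwards [hray, hty.eventually hlog, hd', hty.eventually (Metric.ball_mem_nhds _ hρ0),
    self_mem_nhdsWithin] with t ht1 ht2 ht3 ht4 ht5
  have ht0 : (0 : ℝ) < t := ht5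
  obtain ⟨hpos, hmd⟩ := ht3 ht1.1
  obtain ⟨D, hD1, -, hD2⟩ := ht2 hpos hmd
  refine ⟨ht1.1, ht1.2, ?_, hg' t ⟨D, hD1, hD2⟩⟩
  have h1 := leafDist_le hρ hC hS hC0 hρ0 ht4
  have h2 : ‖y t - extChartAt (𝓡 7) p p‖ = t := by
    rw [hy]
    simp only [add_sub_cancel_left]
    rw [norm_smul, hv, mul_one, Real.norm_eq_abs, abs_of_pos ht0]
  rwa [h2] at h1

theorem dLogNorm_unbounded [T2Space M] (hS : S.CompactReebOrbits) (h_inv : S.ReebInvariant h)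
    (hd : ∀ᶠ x in 𝓝 p, x ∉ S.reebOrbit p → 0 < h x ∧ MDifferentiableAt (𝓡 7) 𝓘(ℝ, ℝ) h x)
    (hp : h p = 0) (hcont : ContinuousAt h p) {C : ℝ}
    (hC : ∀ᶠ x in 𝓝 p, x ∉ S.reebOrbit p → dLogNorm (S.ansatz h) h x ≤ C) : False := by
  obtain ⟨x, g', hx, a, ha, C', hC', B, hB, hev⟩ := S.exists_ray_data hS h_inv hd
  have hlim : Filter.Tendsto (fun t => h (x t)) (𝓝[>] 0) (𝓝 0) := by
    have h0 := hcont.tendsto.comp hx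
    rwa [hp] at h0
  refine not_tendsto_zero_of_logDeriv_bounded (f := fun t => h (x t)) (g' := g') (C := B * C)
    ?_ ?_ ?_ hlim
  · filter_upwards [hev, hx.eventually hd] with t h1 h2
    exact (h2 h1.1).1
  · filter_upwards [hev] with t h1
    exact h1.2.2.2.1
  · filter_upwards [hev, hx.eventually hC] with t h1 h2
    exact h1.2.2.2.2.trans (by have := h2 h1.1; gcongr)

theorem exists_le_codiffNorm [T2Space M] (hS : S.CompactReebOrbits) (h_inv : S.ReebInvariant h)
    (hd : ∀ᶠ x in 𝓝 p, x ∉ S.reebOrbit p → 0 < h x ∧ MDifferentiableAt (𝓡 7) 𝓘(ℝ, ℝ) h x)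
    {k b : ℝ} (hk : 0 < k) (hb : ∀ᶠ x in 𝓝 p, h x ≤ b * S.leafDist p x ^ k) :
    ∃ c > 0, ∀ U ∈ 𝓝 p, ∃ x ∈ U \ S.reebOrbit p,
      c * (S.leafDist p x)⁻¹ ≤ codiffNorm (S.ansatz h) x := by
  obtain ⟨x, g', hx, a, ha, C, hC, B, hB, hev⟩ := S.exists_ray_data hS h_inv hd
  obtain ⟨K, hK, hpt⟩ := S.exists_pointwise_bounds hS h_inv
  -- Chosen so that the opposite inequality on all of U would give |(ln h)'| ≤ (k/2)/t along the
  -- ray, which is incompatible with h = O(t^k).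
  refine ⟨k * a / (2 * B * K), by positivity, fun U hU => ?_⟩
  by_contra hno
  push Not at hno
  refine not_le_rpow_of_logDeriv (f := fun t => h (x t)) (g' := g') (b := |b| * C ^ k) (k := k)
    (m := k / 2) (by linarith) ?_ ?_ ?_ ?_
  · filter_upwards [hev, hx.eventually hd] with t h1 h2
    exact (h2 h1.1).1
  · filter_upwards [hev] with t h1
    exact h1.2.2.2.1
  · filter_upwards [hev, hx.eventually hd, hx.eventually hU, self_mem_nhdsWithin]
      with t ht1 hd hxU ht
    obtain ⟨h1, h2, -, -, h5⟩ := ht1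
    have ht0 : (0 : ℝ) < t := ht
    have h6 := (hno (x t) ⟨hxU, h1⟩).le
    have h7 := (hpt (x t) (hd h1).1 (hd h1).2).1
    have hat : 0 < a * t := by positivity
    have h8 : (S.leafDist p (x t))⁻¹ ≤ (a * t)⁻¹ := inv_anti₀ hat h2
    calc |g' t| ≤ B * dLogNorm (S.ansatz h) h (x t) := h5
      _ ≤ B * (K * codiffNorm (S.ansatz h) (x t)) := by gcongr
      _ ≤ B * (K * (k * a / (2 * B * K) * (S.leafDist p (x t))⁻¹)) := by gcongr
      _ ≤ B * (K * (k * a / (2 * B * K) * (a * t)⁻¹)) := by gcongr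
      _ = k / 2 * t⁻¹ := by field_simp
  · filter_upwards [hev, hx.eventually hb, self_mem_nhdsWithin] with t ht1 hbt ht
    obtain ⟨-, -, h3, -, -⟩ := ht1
    have ht0 : (0 : ℝ) < t := ht
    have hr : 0 ≤ S.leafDist p (x t) := ENNReal.toReal_nonneg
    rw [mul_assoc, ← Real.mul_rpow hC.le ht0.le]
    calc h (x t) ≤ b * S.leafDist p (x t) ^ k := hbt
      _ ≤ |b| * S.leafDist p (x t) ^ k :=
        mul_le_mul_of_nonneg_right (le_abs_self b) (Real.rpow_nonneg hr k)
      _ ≤ _ := by gcongr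

theorem exists_dLogNorm_le_inv (hS : S.CompactReebOrbits) (h_inv : S.ReebInvariant h)
    (hd : ∀ᶠ x in 𝓝 p, x ∉ S.reebOrbit p → 0 < h x ∧ MDifferentiableAt (𝓡 7) 𝓘(ℝ, ℝ) h x)
    {k : ℝ} (hk : 0 < k)
    (hcase : (ContMDiffAt (𝓡 7) 𝓘(ℝ, ℝ) ∞ h p ∧
              ∃ a > 0, ∃ b : ℝ, ∀ᶠ x in 𝓝 p,
                a * S.leafDist p x ^ k ≤ h x ∧ h x ≤ b * S.leafDist p x ^ k) ∨
            (∃ u : M → ℝ, ContMDiffAt (𝓡 7) 𝓘(ℝ, ℝ) 1 u p ∧ 0 < u p ∧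
              ∀ᶠ x in 𝓝 p, h x = u x * S.leafDist p x ^ k)) :
    ∃ K, 0 ≤ K ∧ ∀ᶠ x in 𝓝 p, x ∉ S.reebOrbit p → 0 < S.leafDist p x ∧ S.leafDist p x ≤ 1 ∧
      dLogNorm (S.ansatz h) h x ≤ K * (S.leafDist p x)⁻¹ := by
  obtain ⟨ρ, hρ0, c, hc0, C, hC0, hρ, hc, hC⟩ := S.exists_metric_ball p
  obtain ⟨c', hc', B, hB, hlog⟩ := S.exists_dLogNorm_chart hS h_inv p
  set r : E7 → ℝ := fun y => S.leafDist p ((extChartAt (𝓡 7) p).symm y) with hrdef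
  set f : E7 → ℝ := fun y => h ((extChartAt (𝓡 7) p).symm y) with hfdef
  have hr0 : ∀ y, 0 ≤ r y := fun y => ENNReal.toReal_nonneg
  have hr : ∀ y ∈ Metric.ball (extChartAt (𝓡 7) p p) ρ, r y ≤ C * ‖y - extChartAt (𝓡 7) p p‖ :=
    fun y hy => leafDist_le hρ hC hS hC0 hρ0 hy
  have hlip : ∀ y ∈ Metric.ball (extChartAt (𝓡 7) p p) ρ,
      ∀ z ∈ Metric.ball (extChartAt (𝓡 7) p p) ρ, r z ≤ r y + C * ‖z - y‖ :=
    fun y hy z hz => leafDist_le_add hρ hC hS hC0 hρ0 hy hz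
  obtain ⟨K, hK, hKev⟩ : ∃ K, 0 ≤ K ∧ ∀ᶠ y in 𝓝 (extChartAt (𝓡 7) p p : E7), 0 < f y → 0 < r y ∧
      ∀ D : E7 →L[ℝ] ℝ, HasFDerivAt (fun z => Real.log (f z)) D y → ‖D‖ ≤ K * (r y)⁻¹ := by
    rcases hcase with ⟨hsm, a, ha, b, hab⟩ | ⟨u, hu, hup, hfu⟩
    · exact exists_norm_dlog_le_of_smooth hρ0 hC0 hr0 hr hlip
        (contDiffAt_comp_chart_symm le_rfl hsm) hk ha ((tendsto_chart_symm p).eventually hab)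
    · exact exists_norm_dlog_le_of_eq_mul hρ0 hC0 hr0 hr hlip
        (contDiffAt_comp_chart_symm (WithTop.coe_le_coe.2 (le_top (a := (1 : ℕ∞)))) hu) (by rwa [extChartAt_to_inv]) hk
        ((tendsto_chart_symm p).eventually hfu)
  refine ⟨K / c', by positivity, eventually_of_chart ?_⟩
  filter_upwards [hKev, hlog, (tendsto_chart_symm p).eventually hd,
    eventually_lt_of_le_mul_norm hρ0 hr one_pos] with y h1 h2 h3 h4 hO
  obtain ⟨hpos, hmd⟩ := h3 hO
  obtain ⟨hrp, hDle⟩ := h1 hpos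
  obtain ⟨D, hD, hD1, -⟩ := h2 hpos hmd
  refine ⟨hrp, h4.le, ?_⟩
  rw [div_mul_eq_mul_div, le_div_iff₀' hc']
  exact hD1.trans (hDle D hD)

end ContactCalabiYau

end ContactG2

end

theorem mainTheorem2 {M : Type*} [TopologicalSpace M] [T2Space M] [SecondCountableTopology M]
    [ChartedSpace ContactG2.E7 M] [IsManifold (𝓡 7) ∞ M]
    (S : ContactG2.ContactCalabiYau M) (hS : S.CompactReebOrbits)
    (h : M → ℝ) (h_nonneg : ∀ x, 0 ≤ h x) (h_inv : S.ReebInvariant h) :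
    -- `|d^*φ|` is bounded iff `|d ln h|` is, on any set where `h` is positive and differentiable
    (∀ A : Set M, (∀ x ∈ A, 0 < h x ∧ MDifferentiableAt (𝓡 7) 𝓘(ℝ, ℝ) h x) →
      ((∃ C : ℝ, ∀ x ∈ A, ContactG2.codiffNorm (S.ansatz h) x ≤ C) ↔
        (∃ C : ℝ, ∀ x ∈ A, ContactG2.dLogNorm (S.ansatz h) h x ≤ C))) ∧
    -- at an isolated zero of `h` in the leaf space
    (∀ p : M, h p = 0 → ContinuousAt h p →
      (∀ᶠ x in 𝓝 p, x ∉ S.reebOrbit p →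
        0 < h x ∧ MDifferentiableAt (𝓡 7) 𝓘(ℝ, ℝ) h x) →
      -- `|d ln h|`, `|d^*φ|` and the torsion are unbounded near `p`
      (∀ U ∈ 𝓝 p,
        (¬ ∃ C : ℝ, ∀ x ∈ U \ S.reebOrbit p, ContactG2.dLogNorm (S.ansatz h) h x ≤ C) ∧
        (¬ ∃ C : ℝ, ∀ x ∈ U \ S.reebOrbit p, ContactG2.codiffNorm (S.ansatz h) x ≤ C) ∧
        (¬ ∃ C : ℝ, ∀ x ∈ U \ S.reebOrbit p, ContactG2.torsionNorm (S.ansatz h) x ≤ C)) ∧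
      -- polynomial vanishing, `r = S.leafDist p`
      (∀ k : ℝ, 0 < k →
        -- if `h = O(r^k)`, then `|d^*φ|` grows at least at the rate `1/r`
        ((∃ b : ℝ, ∀ᶠ x in 𝓝 p, h x ≤ b * S.leafDist p x ^ k) →
          ∃ c > 0, ∀ U ∈ 𝓝 p, ∃ x ∈ U \ S.reebOrbit p,
            c * (S.leafDist p x)⁻¹ ≤ ContactG2.codiffNorm (S.ansatz h) x) ∧
        -- if `h` is smooth and comparable to `r^k`, or `h = u r^k` with `u > 0` of class `C¹`,
        -- then the torsion is `O(1/r)`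
        (((ContMDiffAt (𝓡 7) 𝓘(ℝ, ℝ) ∞ h p ∧
              ∃ a > 0, ∃ b : ℝ, ∀ᶠ x in 𝓝 p,
                a * S.leafDist p x ^ k ≤ h x ∧ h x ≤ b * S.leafDist p x ^ k) ∨
            (∃ u : M → ℝ, ContMDiffAt (𝓡 7) 𝓘(ℝ, ℝ) 1 u p ∧ 0 < u p ∧
              ∀ᶠ x in 𝓝 p, h x = u x * S.leafDist p x ^ k)) →
          ∃ C : ℝ, ∀ᶠ x in 𝓝 p, x ∉ S.reebOrbit p →
            ContactG2.codiffNorm (S.ansatz h) x ≤ C * (S.leafDist p x)⁻¹ ∧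
            ContactG2.torsionNorm (S.ansatz h) x ≤ C * (S.leafDist p x)⁻¹))) := by
  obtain ⟨K, hK, hpt⟩ := S.exists_pointwise_bounds hS h_inv
  refine ⟨fun A hA => ⟨?_, ?_⟩, fun p hp hcont hd => ⟨fun U hU => ?_, fun k hk => ⟨?_, ?_⟩⟩⟩
  · rintro ⟨C, hC⟩
    exact ⟨K * C, fun x hx => (hpt x (hA x hx).1 (hA x hx).2).1.trans
      (mul_le_mul_of_nonneg_left (hC x hx) hK.le)⟩
  · rintro ⟨C, hC⟩
    exact ⟨K * C, fun x hx => (hpt x (hA x hx).1 (hA x hx).2).2.1.trans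
      (mul_le_mul_of_nonneg_left (hC x hx) hK.le)⟩
  · have hlog : ¬ ∃ C : ℝ, ∀ᶠ x in 𝓝 p, x ∉ S.reebOrbit p →
        ContactG2.dLogNorm (S.ansatz h) h x ≤ C :=
      fun ⟨C, hC⟩ => S.dLogNorm_unbounded hS h_inv hd hp hcont hC
    have hcod : ¬ ∃ C : ℝ, ∀ x ∈ U \ S.reebOrbit p, ContactG2.codiffNorm (S.ansatz h) x ≤ C := by
      rintro ⟨C, hC⟩
      refine hlog ⟨K * C, ?_⟩
      filter_upwards [hU, hd] with x hxU hx hxO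
      exact (hpt x (hx hxO).1 (hx hxO).2).1.trans
        (mul_le_mul_of_nonneg_left (hC x ⟨hxU, hxO⟩) hK.le)
    refine ⟨fun ⟨C, hC⟩ => hlog ⟨C, ?_⟩, hcod, fun ⟨C, hC⟩ => hcod ⟨C, fun x hx =>
      (ContactG2.codiffNorm_le_torsionNorm _ x).trans (hC x hx)⟩⟩
    filter_upwards [hU] with x hxU hxO using hC x ⟨hxU, hxO⟩
  · rintro ⟨b, hb⟩
    exact S.exists_le_codiffNorm hS h_inv hd hk hb
  · intro hcase
    obtain ⟨K', hK', hev⟩ := S.exists_dLogNorm_le_inv hS h_inv hd hk hcase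
    -- The extra 1 absorbs the term h of the torsion bound: near p one has h < 1 ≤ 1/r.
    refine ⟨K * (K' + 1), ?_⟩
    have h1 : ∀ᶠ x in 𝓝 p, h x < 1 := hcont.eventually_lt_const (by rw [hp]; exact one_pos)
    filter_upwards [hev, hd, h1] with x hx hdx hx1 hxO
    obtain ⟨hr, hr1, hlog⟩ := hx hxO
    obtain ⟨-, hcod, htor⟩ := hpt x (hdx hxO).1 (hdx hxO).2
    have hinv : 1 ≤ (S.leafDist p x)⁻¹ := (one_le_inv₀ hr).2 hr1
    have hsum : ContactG2.dLogNorm (S.ansatz h) h x + 1 ≤ (K' + 1) * (S.leafDist p x)⁻¹ := by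
      rw [add_mul, one_mul]
      exact add_le_add hlog hinv
    rw [mul_assoc]
    exact ⟨hcod.trans (mul_le_mul_of_nonneg_left (by linarith) hK.le),
      htor.trans (mul_le_mul_of_nonneg_left (by linarith) hK.le)⟩
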